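/- **Notation.** Let $n=3$, let $\Omega\subset\mathbb R^3$ be an open neighborhood of the origin with coordinates $y=(y_1,y_2,y_3)$, and let $\Sigma_j=\{y\in\Omega: y_j=0\}$, $j=1,2,3$. * $u\in I^{M}(\Omega,\Sigma_j)$ means that $u$ is a distribution on $\Omega$ and that, for all $N\ge 0$ and all $C^\infty$ vector fields $V_1,\dots,V_N$ on $\Omega$ tangent to $\Sigma_j$, $V_1\cdots V_Nu$ belongs to the local Besov space ${}^\infty H^{\rm loc}_{-M-\frac n4}(\Omega)$. Here $w\in{}^\infty H^{\rm loc}_{s}(\Omega)$ means that for every $\chi\in C_0^\infty(\Omega)$ the integrals of $(1+|\eta|^2)^s|\widehat{\chi w}(\eta)|^2$ over $\{|\eta|<1\}$ and over the dyadic shells $\{2^{k-1}\le|\eta|<2^{k}\}$, $k\ge1$, are bounded uniformly in $k$. * $S^r(\mathbb R\times\mathbb R^2)$ is the space of smooth $a(\eta,y'')$ with $|\partial_{y''}^\alpha\partial_\eta^\beta a|\le C_{\alpha,\beta}(1+|\eta|)^{r-\beta}$ for all $\alpha,\beta$. A symbol $a\in S^{M+\frac14}(\mathbb R\times\mathbb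 R^2)$ is (a representative of) the principal symbol of $u\in I^M(\Omega,\Sigma_j)$ if $u-\int_{\mathbb R}e^{iy_j\eta}a(\eta,y'')\,d\eta\in I^{M-1}(\Omega,\Sigma_j)$, where $y''$ denotes the other two coordinates in increasing order. * For $s\in\mathbb R$ and $k_1,k_2,k_3\ge 0$, $u\in H^{s,k_1,k_2,k_3}_{\rm loc}(\Omega)$ means that $\langle\eta_1\rangle^{k_1}\langle\eta_2\rangle^{k_2}\langle\eta_3\rangle^{k_3}\langle\eta\rangle^{s}\,\widehat{\varphi u}\in L^2(\mathbb R^3)$ for all $\varphi\in C_0^\infty(\Omega)$, where $\langle\cdot\rangle=(1+|\cdot|^2)^{1/2}$; an index $k_j=\infty$ means that this holds for all values of $k_j$; and $H^{s-,k_1,k_2,k_3}_{\rm loc}(\Omega)=\bigcap_{\varepsilon>0}H^{s-\varepsilon,k_1,k_2,k_3}_{\rm loc}(\Omega)$. **Proposition.** Let $m<-1$, let $v_j\in I^{m-\frac n4+\frac12}(\Omega,\Sigma_j)$, $j=1,2,3$, and let $a_1(\eta_1,y_2,y_3)$, $a_2(\eta_2,y_1,y_3)$, $a_3(\eta_3,y_1,y_2)\in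 S^m(\mathbb R\times\mathbb R^2)$ be the principal symbols of $v_1,v_2,v_3$ respectively. Then $v_1,v_2,v_3$ are continuous functions on $\Omega$, the integrals below converge absolutely, and $$v_1v_2=w_{12}+\mathcal E_{12},\qquad v_1v_3=w_{13}+\mathcal E_{13},\qquad v_2v_3=w_{23}+\mathcal E_{23},\qquad v_1v_2v_3=w+\mathcal E ,$$ where $$w_{12}(y)=\int_{\mathbb R^2}e^{i(y_1\eta_1+y_2\eta_2)}a_1(\eta_1,0,y_3)\,a_2(\eta_2,0,y_3)\,d\eta_1d\eta_2,$$ $$\mathcal E_{12}\in H_{\rm loc}^{0-,-m+\frac12,-m-\frac12,\infty}(\Omega)+H_{\rm loc}^{0-,-m-\frac12,-m+\frac12,\infty}(\Omega),$$ $$w_{13}(y)=\int_{\mathbb R^2}e^{i(y_1\eta_1+y_3\eta_3)}a_1(\eta_1,y_2,0)\,a_3(\eta_3,0,y_2)\,d\eta_1d\eta_3,$$ $$\mathcal E_{13}\in H_{\rm loc}^{0-,-m+\frac12,\infty,-m-\frac12}(\Omega)+H_{\rm loc}^{0-,-m-\frac12,\infty,-m+\frac12}(\Omega),$$ $$w_{23}(y)=\int_{\mathbb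 R^2}e^{i(y_2\eta_2+y_3\eta_3)}a_2(\eta_2,y_1,0)\,a_3(\eta_3,y_1,0)\,d\eta_2d\eta_3,$$ $$\mathcal E_{23}\in H_{\rm loc}^{0-,\infty,-m+\frac12,-m-\frac12}(\Omega)+H_{\rm loc}^{0-,\infty,-m-\frac12,-m+\frac12}(\Omega),$$ $$w(y)=\int_{\mathbb R^3}e^{i(y_1\eta_1+y_2\eta_2+y_3\eta_3)}a_1(\eta_1,0,0)\,a_2(\eta_2,0,0)\,a_3(\eta_3,0,0)\,d\eta_1d\eta_2d\eta_3,$$ $$\mathcal E\in H_{\rm loc}^{0-,-m+\frac12,-m-\frac12,-m-\frac12}(\Omega)+H_{\rm loc}^{0-,-m-\frac12,-m+\frac12,-m-\frac12}(\Omega)+H_{\rm loc}^{0-,-m-\frac12,-m-\frac12,-m+\frac12}(\Omega).$$ -/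

import Mathlib

open scoped Distributions ContDiff Pointwise
open MeasureTheory TopologicalSpace

noncomputable section

namespace TripleProd

/-- The ambient space, with coordinates `y 0, y 1, y 2` (written `y₁, y₂, y₃` in the text). -/
abbrev R3 : Type := EuclideanSpace ℝ (Fin 3)

/-- Complex distributions on the open set `Ω`: continuous linear forms on `C_c^∞(Ω; ℂ)`
with its LF topology. -/
abbrev CDistribution (Ω : Opens R3) : Type := 𝓓(Ω, ℂ) →L[ℂ] ℂ

/-- The distribution `u` on `Ω` is (given by) the locally integrable function `f`. -/
def Represents (Ω : Opens R3) (f : R3 → ℂ) (u : CDistribution Ω) : Prop :=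
  LocallyIntegrableOn f (Ω : Set R3) volume ∧ ∀ φ : 𝓓(Ω, ℂ), u φ = ∫ y, f y * φ y

theorem contDiff_mul_test {Ω : Opens R3} {c : R3 → ℂ} (hc : ContDiffOn ℝ ∞ c (Ω : Set R3))
    (φ : 𝓓(Ω, ℂ)) : ContDiff ℝ ∞ (fun y => c y * φ y) := by
  rw [contDiff_iff_contDiffAt]
  intro x
  by_cases hx : x ∈ (Ω : Set R3)
  · exact (hc.contDiffAt (Ω.isOpen.mem_nhds hx)).mul φ.contDiff.contDiffAt
  · have hx' : x ∉ tsupport φ := fun h => hx (φ.tsupport_subset h)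
    have h0 : (fun y => c y * φ y) =ᶠ[nhds x] fun _ => (0 : ℂ) := by
      filter_upwards [notMem_tsupport_iff_eventuallyEq.mp hx'] with y hy
      simp [hy]
    exact contDiffAt_const.congr_of_eventuallyEq h0

/-- The product `c φ` of a function `c ∈ C^∞(Ω)` and a test function `φ` on `Ω`. -/
def mulTest {Ω : Opens R3} (c : R3 → ℂ) (hc : ContDiffOn ℝ ∞ c (Ω : Set R3))
    (φ : 𝓓(Ω, ℂ)) : 𝓓(Ω, ℂ) where
  toFun y := c y * φ y
  contDiff' := contDiff_mul_test hc φ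
  hasCompactSupport' := φ.hasCompactSupport.mul_left
  tsupport_subset' := (tsupport_mul_subset_right (f := c) (g := φ)).trans φ.tsupport_subset

/-- The character `y ↦ exp (-i y·η)`. -/
def expChar (η y : R3) : ℂ := Complex.exp (-(Complex.I * ((inner ℝ y η : ℝ) : ℂ)))

theorem contDiff_expChar (η : R3) : ContDiff ℝ ∞ (expChar η) := by
  unfold expChar
  have h : ContDiff ℝ ∞ (fun y : R3 => ((inner ℝ y η : ℝ) : ℂ)) :=
    Complex.ofRealCLM.contDiff.comp (contDiff_id.inner ℝ contDiff_const)
  exact (contDiff_const.mul h).neg.cexp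

/-- The test function `y ↦ φ(y) exp (-i y·η)`. -/
def expTest {Ω : Opens R3} (η : R3) (φ : 𝓓(Ω, ℂ)) : 𝓓(Ω, ℂ) :=
  mulTest (expChar η) (contDiff_expChar η).contDiffOn φ

/-- The Fourier transform of the compactly supported distribution `φ u`, which is the function
`η ↦ ⟨u, φ e^{-i y·η}⟩`. -/
def fourierLoc {Ω : Opens R3} (u : CDistribution Ω) (φ : 𝓓(Ω, ℂ)) (η : R3) : ℂ :=
  u (expTest η φ)

/-! ### Conormal distributions with respect to `Σ_j = {y_j = 0}` -/

/-- Smooth real vector fields on `Ω`. -/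
structure VField (Ω : Opens R3) where
  coeff : Fin 3 → R3 → ℝ
  smooth : ∀ i, ContDiffOn ℝ ∞ (coeff i) (Ω : Set R3)

/-- The vector field is tangent to the hypersurface `{y ∈ Ω : y_j = 0}`. -/
def VField.TangentTo {Ω : Opens R3} (X : VField Ω) (j : Fin 3) : Prop :=
  ∀ y ∈ Ω, y j = 0 → X.coeff j y = 0

theorem VField.smooth_ofReal {Ω : Opens R3} (X : VField Ω) (i : Fin 3) :
    ContDiffOn ℝ ∞ (fun y => (X.coeff i y : ℂ)) (Ω : Set R3) :=
  Complex.ofRealCLM.contDiff.comp_contDiffOn (X.smooth i)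

/-- The formal transpose `φ ↦ -∑ᵢ ∂ᵢ(Xᵢ φ)` of the vector field `X = ∑ᵢ Xᵢ ∂ᵢ`. The distribution
`X u` is given by `⟨X u, φ⟩ = ⟨u, ᵗX φ⟩`. -/
def VField.transpose {Ω : Opens R3} (X : VField Ω) (φ : 𝓓(Ω, ℂ)) : 𝓓(Ω, ℂ) :=
  -∑ i : Fin 3, LineDeriv.lineDerivOp (EuclideanSpace.single i (1 : ℝ) : R3)
    (mulTest (fun y => (X.coeff i y : ℂ)) (X.smooth_ofReal i) φ)

/-- `ᵗ(X₁ ⋯ X_N) φ = ᵗX_N ⋯ ᵗX₁ φ`, so that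
`⟨X₁ ⋯ X_N u, φ⟩ = ⟨u, iterTranspose [X₁, …, X_N] φ⟩`. -/
def iterTranspose {Ω : Opens R3} : List (VField Ω) → 𝓓(Ω, ℂ) → 𝓓(Ω, ℂ)
  | [], φ => φ
  | X :: Xs, φ => iterTranspose Xs (X.transpose φ)

/-- The dyadic shells: `{|η| < 1}` and `{2^(k-1) ≤ |η| < 2^k}` for `k ≥ 1`. -/
def shell : ℕ → Set R3
  | 0 => {η | ‖η‖ < 1}
  | k + 1 => {η | 2 ^ k ≤ ‖η‖ ∧ ‖η‖ < 2 ^ (k + 1)}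

/-- The condition on the Fourier transform `g` of a tempered distribution which says that the
distribution belongs to the Besov space `^∞H_s(ℝ³)`: the square roots of the integrals
`∫ (1+|η|²)^s |g(η)|² dη` over the dyadic shells are bounded. -/
def IsBesovFourier (s : ℝ) (g : R3 → ℂ) : Prop :=
  AEStronglyMeasurable g volume ∧
    ∃ C : NNReal, ∀ k : ℕ,
      ∫⁻ η in shell k, ENNReal.ofReal ((1 + ‖η‖ ^ 2) ^ s) * ‖g η‖ₑ ^ 2 ≤ C

/-- `u ∈ I^M(Ω, Σ_j)`, `Σ_j = {y ∈ Ω : y_j = 0}`, in dimension `n = 3`: for all `N ≥ 0` and all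
smooth vector fields `X₁, …, X_N` on `Ω` tangent to `Σ_j`, the distribution `X₁ ⋯ X_N u` lies in
the local Besov space `^∞H^loc_{-M-n/4}(Ω)`. -/
def IsConormal (Ω : Opens R3) (j : Fin 3) (M : ℝ) (u : CDistribution Ω) : Prop :=
  ∀ Xs : List (VField Ω), (∀ X ∈ Xs, X.TangentTo j) →
    ∀ χ : 𝓓(Ω, ℂ),
      IsBesovFourier (-M - 3 / 4) (fun η => u (iterTranspose Xs (expTest η χ)))

/-! ### Symbols and principal symbols -/

/-- Partial derivative of a function on `ℝ × ℝ × ℝ` along a fixed vector. -/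
def partialD (e : ℝ × ℝ × ℝ) (a : ℝ × ℝ × ℝ → ℂ) : ℝ × ℝ × ℝ → ℂ :=
  fun p => fderiv ℝ a p e

/-- `a(η, s, t) ∈ S^r(ℝ × ℝ²)`: `a` is smooth and
`|∂_s^α₁ ∂_t^α₂ ∂_η^β a| ≤ C_{α,β} (1+|η|)^(r-β)`. -/
def IsSymbol (r : ℝ) (a : ℝ × ℝ × ℝ → ℂ) : Prop :=
  ContDiff ℝ ∞ a ∧ ∀ α₁ α₂ β : ℕ, ∃ C : ℝ, ∀ p : ℝ × ℝ × ℝ,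
    ‖((partialD (0, 1, 0))^[α₁] ((partialD (0, 0, 1))^[α₂] ((partialD (1, 0, 0))^[β] a))) p‖
      ≤ C * (1 + |p.1|) ^ (r - (β : ℝ))

/-- The pairing of the oscillatory integral `∫ e^{i y_j η} a(η, y'') dη` with a test function,
where `y''` consists of the other two coordinates in increasing order. Integrating in `y` first
makes the `η`-integral absolutely convergent for symbols of any order. -/
def oscPairing {Ω : Opens R3} (j : Fin 3) (a : ℝ × ℝ × ℝ → ℂ) (φ : 𝓓(Ω, ℂ)) : ℂ :=
  ∫ η : ℝ, ∫ y : R3, Complex.exp (Complex.I * ((y j * η : ℝ) : ℂ)) *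
    a (η, y (j.succAbove 0), y (j.succAbove 1)) * φ y

/-- The symbol `a ∈ S^{M+(n-2)/4}`, `n = 3`, represents the principal symbol of
`u ∈ I^M(Ω, Σ_j)`: the oscillatory integral with amplitude `a` represents `u` modulo
`I^{M-1}(Ω, Σ_j)`. -/
def IsPrincipalSymbol (Ω : Opens R3) (j : Fin 3) (M : ℝ) (a : ℝ × ℝ × ℝ → ℂ)
    (u : CDistribution Ω) : Prop :=
  IsSymbol (M + 1 / 4) a ∧
    ∃ r : CDistribution Ω, IsConormal Ω j (M - 1) r ∧ ∀ φ : 𝓓(Ω, ℂ), u φ = oscPairing j a φ + r φ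

/-! ### Beals spaces -/

/-- The space `H_loc^{s, k₁, k₂, k₃}(Ω)`: all `u` such that for every `φ ∈ C_c^∞(Ω)`,
`⟨η₁⟩^k₁ ⟨η₂⟩^k₂ ⟨η₃⟩^k₃ ⟨η⟩^s (φu)^ ∈ L²`. An index `k_i = ⊤` stands for `∞`: the condition is
then required for every real exponent in place of `k_i`. -/
def Beals (Ω : Opens R3) (s : ℝ) (k : Fin 3 → WithTop ℝ) : Set (CDistribution Ω) :=
  {u | ∀ κ : Fin 3 → ℝ, (∀ i, k i = ⊤ ∨ k i = (κ i : WithTop ℝ)) → ∀ φ : 𝓓(Ω, ℂ),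
    MemLp (fun η : R3 =>
      (((∏ i : Fin 3, (1 + η i ^ 2) ^ (κ i / 2)) * (1 + ‖η‖ ^ 2) ^ (s / 2) : ℝ) : ℂ) *
        fourierLoc u φ η) 2 volume}

/-- The space `H_loc^{s-, k₁, k₂, k₃}(Ω)`. -/
def BealsMinus (Ω : Opens R3) (s : ℝ) (k : Fin 3 → WithTop ℝ) : Set (CDistribution Ω) :=
  {u | ∀ ε : ℝ, 0 < ε → u ∈ Beals Ω (s - ε) k}

/-! ### Oscillatory integrals attached to the intersections -/

/-- The integrand `(η, η') ↦ e^{i (y_j η + y_k η')} b(η) c(η')`. -/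
def oscTwo (j k : Fin 3) (y : R3) (b c : ℝ → ℂ) (p : ℝ × ℝ) : ℂ :=
  Complex.exp (Complex.I * ((y j * p.1 + y k * p.2 : ℝ) : ℂ)) * (b p.1 * c p.2)

/-- The integrand `(η₁, η₂, η₃) ↦ e^{i (y₁ η₁ + y₂ η₂ + y₃ η₃)} b(η₁) c(η₂) d(η₃)`. -/
def oscThree (y : R3) (b c d : ℝ → ℂ) (p : ℝ × ℝ × ℝ) : ℂ :=
  Complex.exp (Complex.I * ((y 0 * p.1 + y 1 * p.2.1 + y 2 * p.2.2 : ℝ) : ℂ)) *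
    (b p.1 * c p.2.1 * d p.2.2)

/-- The function `g` equals the absolutely convergent integral `∫ F y` for every `y`, up to an
error distribution in `S`: `g - ∫ F = E` on `Ω` with `E ∈ S`. -/
def EqOscModulo {X : Type*} [MeasureSpace X] (Ω : Opens R3) (g : R3 → ℂ) (F : R3 → X → ℂ)
    (S : Set (CDistribution Ω)) : Prop :=
  (∀ y, Integrable (F y) volume) ∧ ∃ E ∈ S, Represents Ω (fun y => g y - ∫ p, F y p) E

end TripleProd

end

/-!
The Fourier transform of a localized function conormal to `{y_j = 0}` is concentrated near the
`η_j`-axis: it decays rapidly in the other two frequencies, and with a symbol of order `m` it is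
`O(⟨η_j⟩^m)`. Hence it has index `k = -m - 1/2` in the direction `j`, up to `ε`, and index `∞` in
the other directions (`bealsFun_osc`, `IsConormal.hasWeight`). Since `m < -1`, `k > 1/2` and the
Fourier transform is integrable, so such a distribution is a continuous function
(`IsConormal.exists_bealsFun`). Functions conormal to different coordinate planes multiply without
loss, because in every frequency variable at least one of the two factors decays rapidly
(`BealsFun.mul`).

By definition of the principal symbol, `v_j` is the oscillatory integral of `a_j` plus a conormal
remainder of one order less (`IsPrincipalSymbol.exists_function`). Taylor's formula replaces `a_j`
by its restriction to the intersection with the planes `{y_l = 0}`, `l ≠ j`, at the cost of terms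
`y_l B` with `B` of the same order as `v_j` (`osc_sub_osc_fst`, `osc_sub_osc_snd`). Such a term
gains nothing by itself, but in the product the coordinate `y_l` can be moved to the factor
conormal to `{y_l = 0}`, where integration by parts in the frequency turns it into a gain of one
order (`coord_mul_osc`). Expanding the products, each error term therefore has one index raised to
`-m + 1/2` (`exists_bealsFun_mul_sub_mul`, `exists_bealsFun_mul_mul_sub`), and the leading terms
are products of one-dimensional integrals, equal to the multiple integrals by Fubini.

The passage from conormal distributions to functions requires Fourier inversion for compactly
supported distributions. It is derived here from the finite order of a distribution and the Riesz
representation theorem (`exists_fourier_density`, `apply_testMul_eq_integral_hat`).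
-/

noncomputable section

namespace TripleProd

open scoped ENNReal FourierTransform

/-! ### Weights and Fourier transforms -/

/-- The Fourier transform `∫ f(y) e^{-i y·η} dy`, normalized as in `fourierLoc` (without the
factor `2π` in the exponent that `𝓕` has). -/
def hat (f : R3 → ℂ) (η : R3) : ℂ := ∫ y, expChar η y * f y

/-- The product weight `∏ᵢ ⟨ηᵢ⟩^{κᵢ}`. -/
def wt (κ : Fin 3 → ℝ) (η : R3) : ℝ := ∏ i, (1 + η i ^ 2) ^ (κ i / 2)

lemma wt_pos (κ : Fin 3 → ℝ) (η : R3) : 0 < wt κ η :=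
  Finset.prod_pos fun i _ => Real.rpow_pos_of_pos (by positivity) _

lemma continuous_wt (κ : Fin 3 → ℝ) : Continuous (wt κ) := by
  unfold wt
  refine continuous_finsetProd _ fun i _ => ?_
  refine Continuous.rpow_const (by fun_prop) fun x => Or.inl (by positivity)

lemma wt_add (κ κ' : Fin 3 → ℝ) (η : R3) : wt (κ + κ') η = wt κ η * wt κ' η := by
  unfold wt
  rw [← Finset.prod_mul_distrib]
  refine Finset.prod_congr rfl fun i _ => ?_
  rw [← Real.rpow_add (by positivity), Pi.add_apply, add_div]

lemma wt_neg (κ : Fin 3 → ℝ) (η : R3) : wt (-κ) η = (wt κ η)⁻¹ := by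
  unfold wt
  rw [← Finset.prod_inv_distrib]
  refine Finset.prod_congr rfl fun i _ => ?_
  rw [← Real.rpow_neg (by positivity), Pi.neg_apply, neg_div]

lemma wt_mono {κ κ' : Fin 3 → ℝ} (h : ∀ i, κ i ≤ κ' i) (η : R3) : wt κ η ≤ wt κ' η := by
  unfold wt
  refine Finset.prod_le_prod (fun i _ => by positivity) fun i _ => ?_
  refine Real.rpow_le_rpow_of_exponent_le (by nlinarith [sq_nonneg (η i)]) (by linarith [h i])

lemma wt_sq (κ : Fin 3 → ℝ) (η : R3) : wt κ η ^ 2 = ∏ i, (1 + η i ^ 2) ^ (κ i) := by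
  unfold wt
  rw [← Finset.prod_pow]
  refine Finset.prod_congr rfl fun i _ => ?_
  rw [← Real.rpow_mul_natCast (by positivity)]
  congr 1; push_cast; ring

/-- Peetre's inequality for the product weights with nonnegative exponents. -/
lemma wt_le_mul {κ : Fin 3 → ℝ} (h : ∀ i, 0 ≤ κ i) (ξ η : R3) :
    wt κ η ≤ (∏ i, (2 : ℝ) ^ (κ i / 2)) * (wt κ ξ * wt κ (η - ξ)) := by
  unfold wt
  rw [← Finset.prod_mul_distrib, ← Finset.prod_mul_distrib]
  refine Finset.prod_le_prod (fun i _ => by positivity) fun i _ => ?_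
  rw [← Real.mul_rpow (by positivity) (by positivity),
    ← Real.mul_rpow (by positivity) (by positivity)]
  refine Real.rpow_le_rpow (by positivity) ?_ (by linarith [h i])
  simp only [PiLp.sub_apply]
  nlinarith [sq_nonneg (ξ i * (η i - ξ i)), sq_nonneg (ξ i - (η i - ξ i))]

lemma integrable_prod_coord {f : Fin 3 → ℝ → ℝ} (hf : ∀ i, Integrable (f i)) :
    Integrable (fun ξ : R3 => ∏ i, f i (ξ i)) := by
  have h := (PiLp.volume_preserving_ofLp (Fin 3)).integrable_comp_of_integrable
    (Integrable.fintype_prod (f := f) hf)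
  exact h

lemma integral_prod_coord (f : Fin 3 → ℝ → ℝ) :
    ∫ ξ : R3, ∏ i, f i (ξ i) = ∏ i, ∫ t, f i t := by
  rw [← integral_fintype_prod_volume_eq_prod]
  exact (PiLp.volume_preserving_ofLp (Fin 3)).integral_comp
    (MeasurableEquiv.toLp 2 (Fin 3 → ℝ)).symm.measurableEmbedding
    (fun x : Fin 3 → ℝ => ∏ i, f i (x i))

lemma integrable_one_add_sq_rpow {s : ℝ} (hs : s < -(1 / 2)) :
    Integrable fun t : ℝ => (1 + t ^ 2) ^ s := by
  have h := integrable_rpow_neg_one_add_norm_sq (E := ℝ) (μ := volume) (r := -(2 * s))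
    (by simp; linarith)
  refine h.congr (Filter.Eventually.of_forall fun t => ?_)
  simp only [Real.norm_eq_abs, sq_abs]
  congr 1; ring

lemma integrable_wt {κ : Fin 3 → ℝ} (h : ∀ i, κ i < -1) : Integrable (wt κ) :=
  integrable_prod_coord (f := fun i t => (1 + t ^ 2) ^ (κ i / 2))
    fun i => integrable_one_add_sq_rpow (by linarith [h i])

lemma memLp_two_iff_lintegral {α : Type*} [MeasurableSpace α] {μ : Measure α} {f : α → ℂ} :
    MemLp f 2 μ ↔ AEStronglyMeasurable f μ ∧ ∫⁻ x, ‖f x‖ₑ ^ 2 ∂μ < ⊤ := by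
  unfold MemLp
  rw [eLpNorm_lt_top_iff_lintegral_rpow_enorm_lt_top (by simp) (by simp)]
  simp

lemma lintegral_mul_sq_le {α : Type*} [MeasurableSpace α] {μ : Measure α} {f g : α → ℝ≥0∞}
    (hf : AEMeasurable f μ) (hg : AEMeasurable g μ) :
    (∫⁻ x, f x * g x ∂μ) ^ 2 ≤ (∫⁻ x, f x ^ 2 ∂μ) * ∫⁻ x, g x ^ 2 ∂μ := by
  have h := ENNReal.lintegral_mul_le_Lp_mul_Lq μ Real.HolderConjugate.two_two hf hg
  simp only [Pi.mul_apply] at h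
  calc (∫⁻ x, f x * g x ∂μ) ^ 2 ≤ _ := pow_le_pow_left' h 2
    _ = _ := by
      rw [mul_pow, ← ENNReal.rpow_mul_natCast, ← ENNReal.rpow_mul_natCast]
      norm_num

/-- `g` is square integrable against every product weight whose exponents are nonnegative and
strictly below `k`. The strict inequality accounts for the loss of `ε` in `BealsMinus` and for the
failure of the endpoint exponent for conormal functions. -/
def HasWeight (g : R3 → ℂ) (k : Fin 3 → WithTop ℝ) : Prop :=
  ∀ κ : Fin 3 → ℝ, (∀ i, 0 ≤ κ i ∧ (κ i : WithTop ℝ) < k i) →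
    MemLp (fun η => (wt κ η : ℂ) * g η) 2 volume

lemma exists_between_coe {b : ℝ} {k : WithTop ℝ} (h : (b : WithTop ℝ) < k) :
    ∃ c : ℝ, b < c ∧ (c : WithTop ℝ) < k := by
  induction k using WithTop.recTopCoe with
  | top => exact ⟨b + 1, by linarith, WithTop.coe_lt_top _⟩
  | coe k =>
    obtain ⟨c, h1, h2⟩ := exists_between (WithTop.coe_lt_coe.1 h)
    exact ⟨c, h1, WithTop.coe_lt_coe.2 h2⟩

/-- By Cauchy–Schwarz, since `∏ᵢ ⟨ηᵢ⟩^{-κᵢ}` is square integrable when all `κᵢ > 1/2`. -/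
lemma HasWeight.integrable {g : R3 → ℂ} {k : Fin 3 → WithTop ℝ} (hg : HasWeight g k)
    (hk : ∀ i, ((1 / 2 : ℝ) : WithTop ℝ) < k i) : Integrable g := by
  choose κ h1 h2 using fun i => exists_between_coe (hk i)
  have hA := hg κ fun i => ⟨by linarith [h1 i], h2 i⟩
  have hB : MemLp (fun η => ((wt (-κ) η : ℝ) : ℂ)) 2 volume := by
    rw [memLp_two_iff_lintegral]
    refine ⟨(Complex.continuous_ofReal.comp (continuous_wt _)).aestronglyMeasurable, ?_⟩
    have : Integrable (wt (-κ + -κ)) := integrable_wt fun i => by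
      simp only [Pi.add_apply, Pi.neg_apply]; linarith [h1 i]
    refine lt_of_eq_of_lt ?_ this.2
    refine lintegral_congr fun η => ?_
    rw [wt_add, enorm_mul, sq, ← ofReal_norm, ← ofReal_norm, Complex.norm_real]
  have h := hA.integrable_mul hB
  refine h.congr (Filter.Eventually.of_forall fun η => ?_)
  have : (wt κ η : ℂ) ≠ 0 := Complex.ofReal_ne_zero.2 (wt_pos κ η).ne'
  simp only [Pi.mul_apply, wt_neg]
  push_cast
  field_simp

/-- A weighted `L²` bound for a convolution. In each coordinate one of the two factors has one
power of `⟨ηᵢ⟩` to spare (`F` for `i ∈ S`, `G` otherwise), which makes the Cauchy–Schwarz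
inequality in the convolution variable converge. -/
lemma lintegral_conv_sq_lt_top {κ : Fin 3 → ℝ} {F G : R3 → ℂ} (hκ : ∀ i, 0 ≤ κ i)
    (S : Finset (Fin 3))
    (hF : MemLp (fun η => (wt (κ + fun i => if i ∈ S then 1 else 0) η : ℂ) * F η) 2 volume)
    (hG : MemLp (fun η => (wt (κ + fun i => if i ∈ S then 0 else 1) η : ℂ) * G η) 2 volume) :
    ∫⁻ η, ‖(wt κ η : ℂ) * ∫ ξ, F ξ * G (η - ξ)‖ₑ ^ 2 < ⊤ := by
  set α : Fin 3 → ℝ := fun i => if i ∈ S then 1 else 0 with hα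
  set β : Fin 3 → ℝ := fun i => if i ∈ S then 0 else 1 with hβ
  set A : R3 → ℝ≥0∞ := fun η => ‖(wt (κ + α) η : ℂ) * F η‖ₑ with hA
  set B : R3 → ℝ≥0∞ := fun η => ‖(wt (κ + β) η : ℂ) * G η‖ₑ with hB
  have hAm : AEMeasurable A := hF.1.enorm
  have hBm : AEMeasurable B := hG.1.enorm
  have hBm' : ∀ η, AEMeasurable (fun ξ => B (η - ξ)) := fun η =>
    hBm.comp_quasiMeasurePreserving (quasiMeasurePreserving_sub_left volume η)
  -- `V` collects the spare powers; its square integrates to `π` in each coordinate.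
  set V : R3 → R3 → ℝ≥0∞ := fun η ξ => ENNReal.ofReal (wt (-α) ξ * wt (-β) (η - ξ)) with hV
  have hVm : ∀ η, Measurable (V η) := fun η => by
    have : Continuous fun ξ => wt (-α) ξ * wt (-β) (η - ξ) :=
      (continuous_wt _).mul ((continuous_wt _).comp (by fun_prop))
    exact this.measurable.ennreal_ofReal
  have hVint : ∀ η, ∫⁻ ξ, V η ξ ^ 2 = ENNReal.ofReal (Real.pi ^ 3) := fun η => by
    set p : Fin 3 → ℝ → ℝ := fun i =>
      if i ∈ S then fun t : ℝ => (1 + t ^ 2)⁻¹ else fun t : ℝ => (1 + (η i - t) ^ 2)⁻¹ with hp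
    have h1 : ∀ ξ : R3, (wt (-α) ξ * wt (-β) (η - ξ)) ^ 2 = ∏ i, p i (ξ i) := by
      intro ξ
      rw [mul_pow, wt_sq, wt_sq, ← Finset.prod_mul_distrib]
      refine Finset.prod_congr rfl fun i _ => ?_
      by_cases hi : i ∈ S <;> simp [hα, hβ, hp, hi, Real.rpow_neg_one]
    have h2 : ∀ i, Integrable (p i) := by
      intro i
      simp only [hp]
      split_ifs
      · exact integrable_inv_one_add_sq
      · exact integrable_inv_one_add_sq.comp_sub_left (η i)
    have h3 : ∀ i, ∫ t, p i t = Real.pi := by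
      intro i
      simp only [hp]
      split_ifs
      · exact integral_univ_inv_one_add_sq
      · rw [integral_sub_left_eq_self (fun t : ℝ => (1 + t ^ 2)⁻¹)]
        exact integral_univ_inv_one_add_sq
    have h4 : ∀ ξ, V η ξ ^ 2 = ENNReal.ofReal ((wt (-α) ξ * wt (-β) (η - ξ)) ^ 2) := fun ξ => by
      rw [hV, ENNReal.ofReal_pow (mul_pos (wt_pos _ _) (wt_pos _ _)).le]
    simp_rw [h4, h1]
    rw [← ofReal_integral_eq_lintegral_ofReal (integrable_prod_coord h2), integral_prod_coord]
    · simp_rw [h3]; simp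
    · refine Filter.Eventually.of_forall fun ξ => Finset.prod_nonneg fun i _ => ?_
      simp only [hp]
      split_ifs <;> positivity
  set c : ℝ≥0∞ := ENNReal.ofReal (∏ i, (2 : ℝ) ^ (κ i / 2)) with hc
  have key : ∀ η, ‖(wt κ η : ℂ) * ∫ ξ, F ξ * G (η - ξ)‖ₑ ^ 2 ≤
      c ^ 2 * ENNReal.ofReal (Real.pi ^ 3) * ∫⁻ ξ, A ξ ^ 2 * B (η - ξ) ^ 2 := by
    intro η
    have h1 : ‖(wt κ η : ℂ) * ∫ ξ, F ξ * G (η - ξ)‖ₑ ≤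
        c * ∫⁻ ξ, (A ξ * B (η - ξ)) * V η ξ := by
      rw [enorm_mul]
      calc ‖(wt κ η : ℂ)‖ₑ * ‖∫ ξ, F ξ * G (η - ξ)‖ₑ
          ≤ ‖(wt κ η : ℂ)‖ₑ * ∫⁻ ξ, ‖F ξ * G (η - ξ)‖ₑ := by
            gcongr; exact enorm_integral_le_lintegral_enorm _
        _ = ∫⁻ ξ, ‖(wt κ η : ℂ)‖ₑ * ‖F ξ * G (η - ξ)‖ₑ := by
            rw [lintegral_const_mul' _ _ (by simp)]
        _ ≤ ∫⁻ ξ, c * ((A ξ * B (η - ξ)) * V η ξ) := by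
            refine lintegral_mono fun ξ => ?_
            simp only [hA, hB, hV, hc, ← ofReal_norm]
            have p1 := wt_pos κ ξ
            have p2 := wt_pos κ (η - ξ)
            have p3 := wt_pos α ξ
            have p4 := wt_pos β (η - ξ)
            rw [← ENNReal.ofReal_mul (by positivity), ← ENNReal.ofReal_mul (by positivity),
              ← ENNReal.ofReal_mul (by positivity), ← ENNReal.ofReal_mul (by positivity)]
            simp only [norm_mul, Complex.norm_real, Real.norm_of_nonneg (wt_pos _ _).le, wt_add,
              wt_neg]
            refine ENNReal.ofReal_le_ofReal ?_
            have := wt_le_mul hκ ξ η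
            calc wt κ η * (‖F ξ‖ * ‖G (η - ξ)‖)
                ≤ ((∏ i, (2 : ℝ) ^ (κ i / 2)) * (wt κ ξ * wt κ (η - ξ))) *
                    (‖F ξ‖ * ‖G (η - ξ)‖) := by
                  gcongr
              _ = _ := by field_simp
        _ = _ := by rw [lintegral_const_mul' _ _ (by simp [hc])]
    calc _ ≤ (c * ∫⁻ ξ, (A ξ * B (η - ξ)) * V η ξ) ^ 2 := pow_le_pow_left' h1 2
      _ ≤ c ^ 2 * ((∫⁻ ξ, (A ξ * B (η - ξ)) ^ 2) * ∫⁻ ξ, V η ξ ^ 2) := by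
        rw [mul_pow]
        gcongr
        exact lintegral_mul_sq_le (hAm.mul (hBm' η)) (hVm η).aemeasurable
      _ = _ := by rw [hVint]; simp_rw [mul_pow]; ring
  refine (lintegral_mono key).trans_lt ?_
  rw [lintegral_const_mul' _ _ (by simp [hc]; finiteness)]
  refine ENNReal.mul_lt_top (by simp [hc]; finiteness) ?_
  -- What is left is the integral of the convolution of two integrable functions.
  have hsw : ∫⁻ η, ∫⁻ ξ, A ξ ^ 2 * B (η - ξ) ^ 2 = (∫⁻ ξ, A ξ ^ 2) * ∫⁻ η, B η ^ 2 := by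
    rw [lintegral_lintegral_swap]
    · have : ∀ ξ, ∫⁻ η, A ξ ^ 2 * B (η - ξ) ^ 2 = A ξ ^ 2 * ∫⁻ η, B η ^ 2 := fun ξ => by
        rw [lintegral_const_mul' _ _ (ENNReal.pow_ne_top enorm_ne_top),
          lintegral_sub_right_eq_self (fun η => B η ^ 2)]
      simp_rw [this]
      rw [lintegral_mul_const'']
      exact hAm.pow_const 2
    · exact ((hAm.comp_quasiMeasurePreserving Measure.quasiMeasurePreserving_snd).pow_const 2).mul
        ((hBm.comp_quasiMeasurePreserving
          (quasiMeasurePreserving_sub volume volume)).pow_const 2)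
  rw [hsw]
  exact ENNReal.mul_lt_top (memLp_two_iff_lintegral.1 hF).2 (memLp_two_iff_lintegral.1 hG).2

lemma norm_expChar (η y : R3) : ‖expChar η y‖ = 1 := by
  unfold expChar
  rw [← mul_neg, ← Complex.ofReal_neg, Complex.norm_exp_I_mul_ofReal]

lemma expChar_add (η ξ y : R3) : expChar (η + ξ) y = expChar η y * expChar ξ y := by
  unfold expChar
  rw [← Complex.exp_add, inner_add_right]
  congr 1; push_cast; ring

@[fun_prop]
lemma continuous_expChar_uncurry : Continuous fun p : R3 × R3 => expChar p.1 p.2 := by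
  unfold expChar
  fun_prop

lemma continuous_expChar (η : R3) : Continuous (expChar η) := by
  unfold expChar
  fun_prop

lemma continuous_expChar_left (y : R3) : Continuous fun η => expChar η y := by
  unfold expChar
  fun_prop

lemma integrable_expChar_mul {f : R3 → ℂ} (hf : Integrable f) (η : R3) :
    Integrable fun y => expChar η y * f y :=
  hf.bdd_mul (c := 1) (continuous_expChar η).aestronglyMeasurable
    (Filter.Eventually.of_forall fun y => (norm_expChar η y).le)

lemma continuous_hat {f : R3 → ℂ} (hf : Integrable f) : Continuous (hat f) := by
  unfold hat
  refine continuous_of_dominated (fun η => (integrable_expChar_mul hf η).1)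
    (bound := fun y => ‖f y‖) (fun η => Filter.Eventually.of_forall fun y => ?_) hf.norm
    (Filter.Eventually.of_forall fun y => (continuous_expChar_left y).mul continuous_const)
  rw [norm_mul, norm_expChar, one_mul]

lemma hat_add {f g : R3 → ℂ} (hf : Integrable f) (hg : Integrable g) (η : R3) :
    hat (fun y => f y + g y) η = hat f η + hat g η := by
  unfold hat
  rw [← integral_add (integrable_expChar_mul hf η) (integrable_expChar_mul hg η)]
  simp_rw [mul_add]

lemma fourier_eq_hat (f : R3 → ℂ) (w : R3) : 𝓕 f w = hat f ((2 * Real.pi) • w) := by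
  rw [Real.fourier_eq', hat]
  refine integral_congr_ae (Filter.Eventually.of_forall fun y => ?_)
  simp only [smul_eq_mul, expChar, inner_smul_right]
  congr 2; push_cast; ring

lemma hat_eq_fourier (f : R3 → ℂ) (η : R3) : hat f η = 𝓕 f ((2 * Real.pi)⁻¹ • η) := by
  rw [fourier_eq_hat, smul_smul, mul_inv_cancel₀ (by positivity), one_smul]

/-- Fourier inversion for `hat`, which carries the normalizing factor `(2π)⁻³`. -/
lemma hat_inversion {f : R3 → ℂ} (hc : Continuous f) (hf : Integrable f)
    (hh : Integrable (hat f)) (y : R3) :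
    f y = (((2 * Real.pi)⁻¹ ^ 3 : ℝ) : ℂ) * ∫ ξ, expChar (-ξ) y * hat f ξ := by
  have h2 : Integrable (𝓕 f) := by
    have : 𝓕 f = fun w => hat f ((2 * Real.pi) • w) := funext (fourier_eq_hat f)
    rw [this]
    exact hh.comp_smul (by positivity)
  have h := congrFun (hc.fourierInv_fourier_eq hf h2) y
  rw [Real.fourierInv_eq'] at h
  have h3 : ∀ v : R3, Complex.exp (↑(2 * Real.pi * inner ℝ v y) * Complex.I) • 𝓕 f v =
      (fun ξ => expChar (-ξ) y * hat f ξ) ((2 * Real.pi) • v) := fun v => by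
    simp only [smul_eq_mul, expChar, fourier_eq_hat]
    congr 2
    rw [inner_neg_right, inner_smul_right, real_inner_comm]; push_cast; ring
  rw [integral_congr_ae (Filter.Eventually.of_forall h3), Measure.integral_comp_smul volume
    (fun ξ => expChar (-ξ) y * hat f ξ) (2 * Real.pi)] at h
  rw [← h]
  have h4 : |((2 * Real.pi) ^ Module.finrank ℝ R3)⁻¹| = (2 * Real.pi)⁻¹ ^ 3 := by
    rw [finrank_euclideanSpace_fin, abs_of_pos (by positivity), inv_pow]
  rw [h4, Complex.real_smul]

/-- The Fourier transform of a product is the convolution of the Fourier transforms. -/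
lemma hat_mul {P Q : R3 → ℂ} (hP : Integrable P) (hQc : Continuous Q) (hQ : Integrable Q)
    (hh : Integrable (hat Q)) (η : R3) :
    hat (fun y => P y * Q y) η =
      (((2 * Real.pi)⁻¹ ^ 3 : ℝ) : ℂ) * ∫ ξ, hat Q ξ * hat P (η - ξ) := by
  have h1 : ∀ y, expChar η y * (P y * Q y) = (((2 * Real.pi)⁻¹ ^ 3 : ℝ) : ℂ) *
      ∫ ξ, expChar (η - ξ) y * (P y * hat Q ξ) := fun y => by
    have : ∀ ξ, expChar (η - ξ) y * (P y * hat Q ξ) =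
        (expChar η y * P y) * (expChar (-ξ) y * hat Q ξ) := fun ξ => by
      rw [sub_eq_add_neg, expChar_add]; ring
    simp_rw [this]
    rw [integral_const_mul]
    conv_lhs => rw [hat_inversion hQc hQ hh y]
    ring
  rw [hat]
  simp_rw [h1]
  rw [integral_const_mul, integral_integral_swap]
  · congr 2; ext ξ
    rw [hat.eq_1 P, ← integral_const_mul]
    congr 1; ext y; ring
  · change Integrable (fun p : R3 × R3 => expChar (η - p.2) p.1 * (P p.1 * hat Q p.2)) _
    have hPQ : Integrable (fun p : R3 × R3 => P p.1 * hat Q p.2) (volume.prod volume) :=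
      hP.mul_prod hh
    have hcont : Continuous fun p : R3 × R3 => expChar (η - p.2) p.1 := by
      unfold expChar
      fun_prop
    refine hPQ.mono (hcont.aestronglyMeasurable.mul hPQ.1)
      (Filter.Eventually.of_forall fun p => ?_)
    rw [norm_mul, norm_expChar, one_mul]

/-! ### Test functions and functions of finite index -/

variable {Ω : Opens R3}

lemma continuous_test_mul (χ : 𝓓(Ω, ℂ)) {f : R3 → ℂ} (hf : ContinuousOn f (Ω : Set R3)) :
    Continuous fun y => χ y * f y := by
  rw [continuous_iff_continuousAt]
  intro y
  by_cases hy : y ∈ (Ω : Set R3)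
  · exact χ.continuous.continuousAt.mul (hf.continuousAt (Ω.isOpen.mem_nhds hy))
  · have hy' : y ∉ tsupport χ := fun h => hy (χ.tsupport_subset h)
    refine (continuousAt_const (y := (0 : ℂ))).congr ?_
    filter_upwards [notMem_tsupport_iff_eventuallyEq.mp hy'] with z hz
    simp [hz]

lemma integrable_test_mul (χ : 𝓓(Ω, ℂ)) {f : R3 → ℂ} (hf : ContinuousOn f (Ω : Set R3)) :
    Integrable fun y => χ y * f y :=
  (continuous_test_mul χ hf).integrable_of_hasCompactSupport χ.hasCompactSupport.mul_right

/-- Cut-off functions: a compact subset of `Ω` carries a test function equal to `1` on it. -/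
lemma exists_test_eq_one {K : Set R3} (hK : IsCompact K) (hKΩ : K ⊆ Ω) :
    ∃ ψ : 𝓓(Ω, ℂ), ∀ y ∈ K, ψ y = 1 := by
  obtain ⟨K', hK', h1, h2⟩ := exists_compact_between hK Ω.isOpen hKΩ
  obtain ⟨g, hg1, hg2, -⟩ := exists_contMDiffMap_one_nhds_of_subset_interior (n := (⊤ : ℕ∞))
    (modelWithCornersSelf ℝ R3) hK.isClosed h1
  have hs : tsupport (fun y => (g y : ℂ)) ⊆ K' := by
    refine closure_minimal (fun y hy => ?_) hK'.isClosed
    by_contra h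
    exact hy (by simp [hg2 y h])
  refine ⟨⟨fun y => (g y : ℂ), ?_, ?_, ?_⟩, fun y hy => ?_⟩
  · exact Complex.ofRealCLM.contDiff.comp g.contMDiff.contDiff
  · exact hK'.of_isClosed_subset (isClosed_tsupport _) hs
  · exact hs.trans h2
  · have := hg1.self_of_nhdsSet y hy
    change (g y : ℂ) = 1
    rw [this, Complex.ofReal_one]

/-- The product of two test functions; the second one supplies the support. -/
def testMul (χ ψ : 𝓓(Ω, ℂ)) : 𝓓(Ω, ℂ) := mulTest χ χ.contDiff.contDiffOn ψ

/-- The continuous function `f` on `Ω` belongs to `H_loc^{0, κ₁, κ₂, κ₃}(Ω)` for all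
`0 ≤ κᵢ < kᵢ`. In this form the loss of `ε` in `H_loc^{0-, k₁, k₂, k₃}(Ω)` is spread over the three
exponents, and products can be treated one coordinate at a time. -/
def BealsFun (Ω : Opens R3) (k : Fin 3 → WithTop ℝ) (f : R3 → ℂ) : Prop :=
  ContinuousOn f (Ω : Set R3) ∧ ∀ χ : 𝓓(Ω, ℂ), HasWeight (hat fun y => χ y * f y) k

lemma BealsFun.add {k : Fin 3 → WithTop ℝ} {f g : R3 → ℂ} (hf : BealsFun Ω k f)
    (hg : BealsFun Ω k g) : BealsFun Ω k (fun y => f y + g y) := by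
  refine ⟨hf.1.add hg.1, fun χ κ hκ => ?_⟩
  refine (((hf.2 χ κ hκ).add (hg.2 χ κ hκ))).ae_eq (Filter.Eventually.of_forall fun η => ?_)
  simp only [Pi.add_apply]
  simp_rw [mul_add (χ _)]
  rw [hat_add (integrable_test_mul χ hf.1) (integrable_test_mul χ hg.1)]
  ring

lemma BealsFun.smooth_mul {k : Fin 3 → WithTop ℝ} {f c : R3 → ℂ} (hf : BealsFun Ω k f)
    (hc : ContDiff ℝ ∞ c) : BealsFun Ω k (fun y => c y * f y) := by
  refine ⟨hc.continuous.continuousOn.mul hf.1, fun χ => ?_⟩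
  have := hf.2 (mulTest c hc.contDiffOn χ)
  convert this using 3 with y
  change _ = (c y * χ y) * f y
  ring

lemma BealsFun.mono {k l : Fin 3 → WithTop ℝ} {f : R3 → ℂ} (hf : BealsFun Ω k f)
    (h : ∀ i, l i ≤ k i) : BealsFun Ω l f :=
  ⟨hf.1, fun χ κ hκ => hf.2 χ κ fun i => ⟨(hκ i).1, (hκ i).2.trans_le (h i)⟩⟩

/-- Transversality: if in every coordinate one of the factors has index `∞`, the product has in
every coordinate the smaller index. The Fourier transform of the localized product is a
convolution, and the factor with index `∞` has the power of `⟨ηᵢ⟩` to spare that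
`lintegral_conv_sq_lt_top` asks for. The lower bound `1/2` makes the Fourier transform of the
first factor integrable. -/
lemma BealsFun.mul {k l : Fin 3 → WithTop ℝ} {f g : R3 → ℂ} (hf : BealsFun Ω k f)
    (hg : BealsFun Ω l g) (hk : ∀ i, ((1 / 2 : ℝ) : WithTop ℝ) < k i)
    (hkl : ∀ i, k i = ⊤ ∨ l i = ⊤) :
    BealsFun Ω (fun i => min (k i) (l i)) (fun y => f y * g y) := by
  classical
  refine ⟨hf.1.mul hg.1, fun χ κ hκ => ?_⟩
  -- Since `ψ = 1` on the support of `χ`, the localized product is `(ψ f) (χ g)`.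
  obtain ⟨ψ, hψ⟩ := exists_test_eq_one χ.hasCompactSupport.isCompact χ.tsupport_subset
  have hF := hf.2 ψ
  have hG := hg.2 χ
  have hprod : ∀ η, hat (fun y => χ y * (f y * g y)) η = (((2 * Real.pi)⁻¹ ^ 3 : ℝ) : ℂ) *
      ∫ ξ, hat (fun y => ψ y * f y) ξ * hat (fun y => χ y * g y) (η - ξ) := fun η => by
    rw [← hat_mul (integrable_test_mul χ hg.1) (continuous_test_mul ψ hf.1)
      (integrable_test_mul ψ hf.1) (hF.integrable hk)]
    congr 1; ext y
    by_cases hy : y ∈ tsupport χ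
    · rw [hψ y hy]; ring
    · rw [image_eq_zero_of_notMem_tsupport hy]; ring
  rw [memLp_two_iff_lintegral]
  constructor
  · refine Continuous.aestronglyMeasurable ?_
    exact (Complex.continuous_ofReal.comp (continuous_wt κ)).mul
      (continuous_hat (integrable_test_mul χ (hf.1.mul hg.1)))
  set S : Finset (Fin 3) := Finset.univ.filter fun i => k i = ⊤ with hS
  have h := lintegral_conv_sq_lt_top (κ := κ) (F := hat fun y => ψ y * f y)
    (G := hat fun y => χ y * g y) (fun i => (hκ i).1) S
    (hF _ fun i => ?_) (hG _ fun i => ?_)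
  · have h2 : ∀ η, ‖(wt κ η : ℂ) * hat (fun y => χ y * (f y * g y)) η‖ₑ ^ 2 =
        ‖(((2 * Real.pi)⁻¹ ^ 3 : ℝ) : ℂ)‖ₑ ^ 2 * ‖(wt κ η : ℂ) *
          ∫ ξ, hat (fun y => ψ y * f y) ξ * hat (fun y => χ y * g y) (η - ξ)‖ₑ ^ 2 := fun η => by
      rw [hprod, ← mul_pow, ← enorm_mul]; congr 2; ring
    simp_rw [h2]
    rw [lintegral_const_mul' _ _ (ENNReal.pow_ne_top enorm_ne_top)]
    exact ENNReal.mul_lt_top (ENNReal.pow_ne_top enorm_ne_top).lt_top h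
  · have h0 := (hκ i).1
    have h1 := (hκ i).2
    simp only [Pi.add_apply, hS, Finset.mem_filter, Finset.mem_univ, true_and]
    split_ifs with hi
    · exact ⟨by linarith, by rw [hi]; exact WithTop.coe_lt_top _⟩
    · exact ⟨by linarith, by rw [add_zero]; exact h1.trans_le (min_le_left _ _)⟩
  · have h0 := (hκ i).1
    have h1 := (hκ i).2
    simp only [Pi.add_apply, hS, Finset.mem_filter, Finset.mem_univ, true_and]
    split_ifs with hi
    · exact ⟨by linarith, by rw [add_zero]; exact h1.trans_le (min_le_right _ _)⟩
    · exact ⟨by linarith, by rw [(hkl i).resolve_left hi]; exact WithTop.coe_lt_top _⟩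

/-- The factor `⟨η⟩^{-ε}` lowers each of the three exponents by `ε/3`, because `⟨ηᵢ⟩ ≤ ⟨η⟩`. -/
lemma wt_mul_rpow_norm_le {κ κ' : Fin 3 → ℝ} {ε : ℝ} (hε : 0 < ε) (h : ∀ i, κ i - ε / 3 ≤ κ' i)
    (η : R3) :
    wt κ η * (1 + ‖η‖ ^ 2) ^ ((0 - ε) / 2) ≤ wt κ' η := by
  have h1 : (1 + ‖η‖ ^ 2) ^ ((0 - ε) / 2) ≤ wt (fun _ => -(ε / 3)) η := by
    have : (1 + ‖η‖ ^ 2) ^ ((0 - ε) / 2) = ∏ _i : Fin 3, (1 + ‖η‖ ^ 2) ^ (-(ε / 3) / 2) := by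
      rw [Finset.prod_const, ← Real.rpow_mul_natCast (by positivity)]
      simp only [Finset.card_univ, Fintype.card_fin]
      congr 1; push_cast; ring
    rw [this]
    refine Finset.prod_le_prod (fun i _ => by positivity) fun i _ => ?_
    refine Real.rpow_le_rpow_of_nonpos (by positivity) ?_ (by linarith)
    have := EuclideanSpace.norm_sq_eq η
    rw [this]
    have := Finset.single_le_sum (f := fun i => ‖η i‖ ^ 2) (fun i _ => by positivity)
      (Finset.mem_univ i)
    simp only [Real.norm_eq_abs, sq_abs] at this ⊢
    linarith
  calc _ ≤ wt κ η * wt (fun _ => -(ε / 3)) η := by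
        gcongr
        exact (wt_pos _ _).le
    _ = wt (κ + fun _ => -(ε / 3)) η := (wt_add _ _ _).symm
    _ ≤ _ := wt_mono (fun i => by simp only [Pi.add_apply]; linarith [h i]) η

lemma integrable_test (φ : 𝓓(Ω, ℂ)) : Integrable φ :=
  φ.continuous.integrable_of_hasCompactSupport φ.hasCompactSupport

/-- The distribution given by a continuous function on `Ω`; it is meaningful for locally integrable
`f` only. -/
def ofContinuousOn (Ω : Opens R3) (f : R3 → ℂ) : CDistribution Ω :=
  TestFunction.integralAgainstBilinCLM (ContinuousLinearMap.mul ℂ ℂ) volume f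

lemma represents_ofContinuousOn {f : R3 → ℂ} (hf : ContinuousOn f (Ω : Set R3)) :
    Represents Ω f (ofContinuousOn Ω f) := by
  have h := hf.locallyIntegrableOn (μ := volume) Ω.isOpen.measurableSet
  refine ⟨h, fun φ => ?_⟩
  rw [ofContinuousOn, TestFunction.integralAgainstBilinCLM_eq_integral h]
  simp [mul_comm]

lemma fourierLoc_eq_hat {f : R3 → ℂ} {u : CDistribution Ω} (h : Represents Ω f u)
    (φ : 𝓓(Ω, ℂ)) (η : R3) : fourierLoc u φ η = hat (fun y => φ y * f y) η := by
  rw [fourierLoc, h.2, hat]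
  congr 1; ext y
  change f y * (expChar η y * φ y) = _
  ring

lemma BealsFun.mem_bealsMinus {k : Fin 3 → WithTop ℝ} {f : R3 → ℂ} (hf : BealsFun Ω k f)
    (hk : ∀ i, 0 < k i) : ofContinuousOn Ω f ∈ BealsMinus Ω 0 k := by
  intro ε hε κ hκ φ
  -- Exponents below `ε/3` may turn negative after the shift; they are replaced by `0`.
  set κ' : Fin 3 → ℝ := fun i => max (κ i - ε / 3) 0 with hκ'
  have h := hf.2 φ κ' fun i => ⟨le_max_right _ _, ?_⟩
  · refine MemLp.of_le h ?_ (Filter.Eventually.of_forall fun η => ?_)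
    · refine Continuous.aestronglyMeasurable ?_
      simp_rw [fourierLoc_eq_hat (represents_ofContinuousOn hf.1)]
      refine Continuous.mul ?_ (continuous_hat (integrable_test_mul φ hf.1))
      refine Complex.continuous_ofReal.comp ((continuous_wt κ).mul ?_)
      exact Continuous.rpow_const (by fun_prop) fun x => Or.inl (by positivity)
    · rw [fourierLoc_eq_hat (represents_ofContinuousOn hf.1), norm_mul, norm_mul]
      gcongr
      change ‖((wt κ η * (1 + ‖η‖ ^ 2) ^ ((0 - ε) / 2) : ℝ) : ℂ)‖ ≤ ‖(wt κ' η : ℂ)‖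
      rw [Complex.norm_real, Complex.norm_real, Real.norm_of_nonneg (wt_pos κ' η).le,
        Real.norm_of_nonneg (mul_pos (wt_pos κ η) (Real.rpow_pos_of_pos (by positivity) _)).le]
      exact wt_mul_rpow_norm_le hε (fun i => le_max_left _ _) η
  · rcases hκ i with h | h
    · rw [h]; exact WithTop.coe_lt_top _
    · rw [h, WithTop.coe_lt_coe]
      have := hk i
      rw [h, ← WithTop.coe_zero, WithTop.coe_lt_coe] at this
      exact max_lt (by linarith) this

/-! ### Amplitudes and their derivatives -/

lemma contDiff_partialD {h : ℝ × ℝ × ℝ → ℂ} (hh : ContDiff ℝ ∞ h) (e : ℝ × ℝ × ℝ) :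
    ContDiff ℝ ∞ (partialD e h) :=
  (hh.fderiv_right (m := ∞) (by simp)).clm_apply contDiff_const

lemma partialD_comm {h : ℝ × ℝ × ℝ → ℂ} (hh : ContDiff ℝ ∞ h) (e e' : ℝ × ℝ × ℝ) :
    partialD e (partialD e' h) = partialD e' (partialD e h) := by
  have hd : Differentiable ℝ (fderiv ℝ h) :=
    (hh.fderiv_right (m := ∞) (by simp)).differentiable (by simp)
  have key : ∀ e e' : ℝ × ℝ × ℝ, ∀ p,
      partialD e (partialD e' h) p = fderiv ℝ (fderiv ℝ h) p e e' := by
    intro e e' p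
    unfold partialD
    rw [fderiv_clm_apply (hd p) (differentiableAt_const _)]
    simp
  ext p
  rw [key, key]
  exact (hh.contDiffAt.isSymmSndFDerivAt (by
    rw [minSmoothness_of_isRCLikeNormedField]
    exact WithTop.coe_le_coe.2 (le_top (a := (2 : ℕ∞))))) e e'

lemma iterate_partialD_comm {h : ℝ × ℝ × ℝ → ℂ} (hh : ContDiff ℝ ∞ h) (e e' : ℝ × ℝ × ℝ) (n : ℕ) :
    (partialD e)^[n] (partialD e' h) = partialD e' ((partialD e)^[n] h) := by
  induction n generalizing h with
  | zero => rfl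
  | succ n ih =>
    rw [Function.iterate_succ_apply, Function.iterate_succ_apply, partialD_comm hh,
      ih (contDiff_partialD hh e)]

/-- `h(σ, q)` is smooth, and all its derivatives in `q` are `O((1 + |σ|)^μ)`, uniformly in `q`. In
contrast to `IsSymbol`, nothing is asked of the derivatives in `σ`, and the derivatives in `q` are
bounded as multilinear maps, which suits composition with linear maps. -/
def IsAmplitude (μ : ℝ) (h : ℝ × ℝ × ℝ → ℂ) : Prop :=
  ContDiff ℝ ∞ h ∧ ∀ n : ℕ, ∃ C : ℝ, ∀ (σ : ℝ) (q : ℝ × ℝ),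
    ‖iteratedFDeriv ℝ n (fun q => h (σ, q)) q‖ ≤ C * (1 + |σ|) ^ μ

lemma contDiff_slice {h : ℝ × ℝ × ℝ → ℂ} (hh : ContDiff ℝ ∞ h) (σ : ℝ) :
    ContDiff ℝ ∞ fun q : ℝ × ℝ => h (σ, q) :=
  hh.comp (contDiff_const.prodMk contDiff_id)

lemma fderiv_slice {h : ℝ × ℝ × ℝ → ℂ} (hh : ContDiff ℝ ∞ h) (σ : ℝ) (q e : ℝ × ℝ) :
    fderiv ℝ (fun q => h (σ, q)) q e = partialD (0, e) h (σ, q) := by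
  have h1 : HasFDerivAt (fun q : ℝ × ℝ => (σ, q)) (ContinuousLinearMap.inr ℝ ℝ (ℝ × ℝ)) q :=
    hasFDerivAt_prodMk_right σ q
  have h2 := ((hh.differentiable (by simp)) (σ, q)).hasFDerivAt.comp q h1
  have h3 := h2.fderiv
  change fderiv ℝ (h ∘ fun q => (σ, q)) q e = _
  rw [h3]
  simp [partialD]

/-- Bounds on the mixed partial derivatives in the two transverse directions give bounds on the
full derivatives, by induction on the order, since `fderiv` is a combination of the two partials.
-/
lemma norm_iteratedFDeriv_slice_le {μ : ℝ} (n : ℕ) {h : ℝ × ℝ × ℝ → ℂ} (hh : ContDiff ℝ ∞ h)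
    (hb : ∀ α₁ α₂ : ℕ, ∃ C : ℝ, ∀ p : ℝ × ℝ × ℝ,
      ‖((partialD (0, 1, 0))^[α₁] ((partialD (0, 0, 1))^[α₂] h)) p‖ ≤ C * (1 + |p.1|) ^ μ) :
    ∃ C : ℝ, ∀ (σ : ℝ) (q : ℝ × ℝ),
      ‖iteratedFDeriv ℝ n (fun q => h (σ, q)) q‖ ≤ C * (1 + |σ|) ^ μ := by
  induction n generalizing h with
  | zero =>
    obtain ⟨C, hC⟩ := hb 0 0
    exact ⟨C, fun σ q => by simpa using hC (σ, q)⟩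
  | succ n ih =>
    obtain ⟨C₁, h1⟩ := ih (contDiff_partialD hh (0, 1, 0)) fun α₁ α₂ => by
      obtain ⟨C, hC⟩ := hb (α₁ + 1) α₂
      refine ⟨C, fun p => ?_⟩
      rw [iterate_partialD_comm hh, ← Function.iterate_succ_apply]
      exact hC p
    obtain ⟨C₂, h2⟩ := ih (contDiff_partialD hh (0, 0, 1)) fun α₁ α₂ => by
      obtain ⟨C, hC⟩ := hb α₁ (α₂ + 1)
      refine ⟨C, fun p => ?_⟩
      rw [← Function.iterate_succ_apply]
      exact hC p
    set L₁ := ContinuousLinearMap.smulRightL ℝ (ℝ × ℝ) ℂ (ContinuousLinearMap.fst ℝ ℝ ℝ)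
    set L₂ := ContinuousLinearMap.smulRightL ℝ (ℝ × ℝ) ℂ (ContinuousLinearMap.snd ℝ ℝ ℝ)
    refine ⟨‖L₁‖ * C₁ + ‖L₂‖ * C₂, fun σ q => ?_⟩
    have hs1 := contDiff_slice (contDiff_partialD hh (0, 1, 0)) σ
    have hs2 := contDiff_slice (contDiff_partialD hh (0, 0, 1)) σ
    have hfd : fderiv ℝ (fun q => h (σ, q)) =
        (L₁ ∘ fun q => partialD (0, 1, 0) h (σ, q)) +
          L₂ ∘ fun q => partialD (0, 0, 1) h (σ, q) := by
      ext q : 1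
      apply ContinuousLinearMap.ext
      intro e
      have he : e = e.1 • ((1, 0) : ℝ × ℝ) + e.2 • ((0, 1) : ℝ × ℝ) := by ext <;> simp
      conv_lhs => rw [he]
      rw [map_add, map_smul, map_smul, fderiv_slice hh, fderiv_slice hh]
      simp [L₁, L₂]
    rw [← norm_iteratedFDeriv_fderiv, hfd, iteratedFDeriv_add_apply]
    · refine (norm_add_le _ _).trans ?_
      rw [add_mul, mul_assoc, mul_assoc]
      refine add_le_add ?_ ?_
      · exact (L₁.norm_iteratedFDeriv_comp_left hs1.contDiffAt (N := ∞)
          (by exact_mod_cast le_top)).trans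
          (mul_le_mul_of_nonneg_left (h1 σ q) (norm_nonneg _))
      · exact (L₂.norm_iteratedFDeriv_comp_left hs2.contDiffAt (N := ∞)
          (by exact_mod_cast le_top)).trans
          (mul_le_mul_of_nonneg_left (h2 σ q) (norm_nonneg _))
    · exact ((L₁.contDiff.comp hs1).of_le (by exact_mod_cast le_top)).contDiffAt
    · exact ((L₂.contDiff.comp hs2).of_le (by exact_mod_cast le_top)).contDiffAt

lemma IsAmplitude.partialD {μ : ℝ} {h : ℝ × ℝ × ℝ → ℂ} (hh : IsAmplitude μ h) (e : ℝ × ℝ) :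
    IsAmplitude μ (partialD (0, e) h) := by
  refine ⟨contDiff_partialD hh.1 _, fun n => ?_⟩
  obtain ⟨C, hC⟩ := hh.2 (n + 1)
  set A := ContinuousLinearMap.apply ℝ ℂ e
  refine ⟨‖A‖ * C, fun σ q => ?_⟩
  have h1 : (fun q => TripleProd.partialD (0, e) h (σ, q)) =
      A ∘ (fderiv ℝ fun q => h (σ, q)) := by
    ext q
    simp [A, fderiv_slice hh.1]
  have h2 : ContDiff ℝ ∞ (fderiv ℝ fun q => h (σ, q)) :=
    (contDiff_slice hh.1 σ).fderiv_right (m := ∞) (by simp)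
  rw [h1, mul_assoc]
  refine (A.norm_iteratedFDeriv_comp_left h2.contDiffAt (N := ∞)
      (by exact_mod_cast le_top)).trans ?_
  rw [norm_iteratedFDeriv_fderiv]
  exact mul_le_mul_of_nonneg_left (hC σ q) (norm_nonneg _)

lemma IsSymbol.isAmplitude {m : ℝ} {a : ℝ × ℝ × ℝ → ℂ} (ha : IsSymbol m a) : IsAmplitude m a :=
  ⟨ha.1, fun n => norm_iteratedFDeriv_slice_le n ha.1 fun α₁ α₂ => by
    simpa using ha.2 α₁ α₂ 0⟩

/-- A derivative in the frequency variable lowers the order by one. -/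
lemma IsSymbol.isAmplitude_partialD_freq {m : ℝ} {a : ℝ × ℝ × ℝ → ℂ} (ha : IsSymbol m a) :
    IsAmplitude (m - 1) (partialD (1, 0, 0) a) :=
  ⟨contDiff_partialD ha.1 _, fun n => norm_iteratedFDeriv_slice_le n (contDiff_partialD ha.1 _)
    fun α₁ α₂ => by simpa using ha.2 α₁ α₂ 1⟩

lemma IsAmplitude.exists_bound {μ : ℝ} {h : ℝ × ℝ × ℝ → ℂ} (hh : IsAmplitude μ h) :
    ∃ C : ℝ, 0 ≤ C ∧ ∀ (σ : ℝ) (q : ℝ × ℝ), ‖h (σ, q)‖ ≤ C * (1 + |σ|) ^ μ := by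
  obtain ⟨C, hC⟩ := hh.2 0
  refine ⟨C, ?_, fun σ q => by simpa using hC σ q⟩
  have := (norm_nonneg _).trans (hC 0 0)
  simpa using this

/-! ### Decay of the Fourier transform -/

lemma pow_mul_norm_hat_le {g : R3 → ℂ} (hg : ContDiff ℝ ∞ g) (hs : HasCompactSupport g) (n : ℕ)
    (η : R3) : ‖η‖ ^ n * ‖hat g η‖ ≤
      (4 * Real.pi) ^ n * ∑ i ∈ Finset.range (n + 1), ∫ y, ‖iteratedFDeriv ℝ i g y‖ := by
  have hint : ∀ k n : ℕ, Integrable fun v => ‖v‖ ^ k * ‖iteratedFDeriv ℝ n g v‖ := fun k n => by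
    have hc : Continuous (iteratedFDeriv ℝ n g) :=
      hg.continuous_iteratedFDeriv (by exact_mod_cast le_top)
    refine Continuous.integrable_of_hasCompactSupport (by fun_prop) ?_
    exact ((hs.iteratedFDeriv n).norm).mul_left
  have h := Real.pow_mul_norm_iteratedFDeriv_fourier_le (K := ⊤) (N := ⊤) (k := 0) (n := n) hg
    (fun k n _ _ => hint k n) le_top le_top ((2 * Real.pi)⁻¹ • η)
  rw [norm_iteratedFDeriv_zero, ← hat_eq_fourier, norm_smul] at h
  have h2 : ∑ p ∈ Finset.range (0 + 1) ×ˢ Finset.range (n + 1),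
      ∫ v, ‖v‖ ^ p.1 * ‖iteratedFDeriv ℝ p.2 g v‖
      = ∑ i ∈ Finset.range (n + 1), ∫ y, ‖iteratedFDeriv ℝ i g y‖ := by
    rw [Finset.sum_product]; simp
  rw [h2, norm_inv, Real.norm_of_nonneg (by positivity : 0 ≤ 2 * Real.pi), mul_pow] at h
  simp only [pow_zero, one_mul, Nat.cast_zero, mul_zero, zero_add] at h
  have h3 : (4 * Real.pi) ^ n = (2 * Real.pi) ^ n * 2 ^ n := by rw [← mul_pow]; ring
  rw [h3, mul_assoc]
  calc ‖η‖ ^ n * ‖hat g η‖ = (2 * Real.pi) ^ n * ((2 * Real.pi)⁻¹ ^ n * ‖η‖ ^ n * ‖hat g η‖) := by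
        rw [inv_pow]; field_simp
    _ ≤ _ := by gcongr

lemma prod_one_add_pow_le (M : ℕ) (η : R3) :
    ∏ i, (1 + |η i|) ^ M ≤ 2 ^ (3 * M) * (1 + ‖η‖ ^ (3 * M)) := by
  have h1 : ∏ i, (1 + |η i|) ^ M ≤ ∏ _i : Fin 3, (1 + ‖η‖) ^ M := by
    refine Finset.prod_le_prod (fun i _ => by positivity) fun i _ => ?_
    have := PiLp.norm_apply_le η i
    rw [Real.norm_eq_abs] at this
    gcongr
  refine h1.trans ?_
  rw [Finset.prod_const, Finset.card_univ, Fintype.card_fin, ← pow_mul, mul_comm M 3]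
  refine (add_pow_le zero_le_one (norm_nonneg η) _).trans ?_
  rw [one_pow]
  gcongr
  · norm_num
  · omega

/-- The Fourier transform in `y` of `χ(y) h(σ, L y)` decays rapidly, with a constant that is
uniform in the linear map `L` of norm at most `1`. -/
lemma exists_norm_hat_mul_le {h : ℝ × ℝ × ℝ → ℂ} {μ : ℝ} (hh : IsAmplitude μ h) {χ : R3 → ℂ}
    (hχ : ContDiff ℝ ∞ χ) (hs : HasCompactSupport χ) (M : ℕ) :
    ∃ C : ℝ, 0 ≤ C ∧ ∀ (L : R3 →L[ℝ] ℝ × ℝ), ‖L‖ ≤ 1 → ∀ (σ : ℝ) (η : R3),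
      ‖hat (fun y => χ y * h (σ, L y)) η‖ ≤
        C * (1 + |σ|) ^ μ * (∏ i, (1 + |η i|) ^ M)⁻¹ := by
  -- `C n` bounds the derivatives of order `n` of the amplitude, `D n` those of the product with
  -- `χ`.
  choose C hC using hh.2
  set D : ℕ → ℝ := fun n => ∑ i ∈ Finset.range (n + 1), (n.choose i : ℝ) * C (n - i) *
    ∫ y, ‖iteratedFDeriv ℝ i χ y‖ with hD
  have hχint : ∀ n, Integrable fun y => ‖iteratedFDeriv ℝ n χ y‖ := fun n => by
    have hc : Continuous (iteratedFDeriv ℝ n χ) :=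
      hχ.continuous_iteratedFDeriv (by exact_mod_cast le_top)
    exact Continuous.integrable_of_hasCompactSupport (by fun_prop) (hs.iteratedFDeriv n).norm
  have h1 : ∀ (n : ℕ) (L : R3 →L[ℝ] ℝ × ℝ), ‖L‖ ≤ 1 → ∀ σ : ℝ,
      ∫ y, ‖iteratedFDeriv ℝ n (fun y => χ y * h (σ, L y)) y‖ ≤ D n * (1 + |σ|) ^ μ := by
    intro n L hL σ
    have hc : ContDiff ℝ ∞ fun y => h (σ, L y) := (contDiff_slice hh.1 σ).comp L.contDiff
    have hpt : ∀ y, ‖iteratedFDeriv ℝ n (fun y => χ y * h (σ, L y)) y‖ ≤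
        ∑ i ∈ Finset.range (n + 1), ((n.choose i : ℝ) * C (n - i) * (1 + |σ|) ^ μ) *
          ‖iteratedFDeriv ℝ i χ y‖ := by
      intro y
      refine (norm_iteratedFDeriv_mul_le hχ hc y (by exact_mod_cast le_top)).trans ?_
      refine Finset.sum_le_sum fun i _ => ?_
      have h3 : ‖iteratedFDeriv ℝ (n - i) (fun y => h (σ, L y)) y‖ ≤ C (n - i) * (1 + |σ|) ^ μ := by
        have := L.iteratedFDeriv_comp_right (contDiff_slice hh.1 σ) y (i := n - i)
          (WithTop.coe_le_coe.2 le_top)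
        change ‖iteratedFDeriv ℝ (n - i) ((fun q => h (σ, q)) ∘ L) y‖ ≤ _
        rw [this]
        refine (ContinuousMultilinearMap.norm_compContinuousLinearMap_le _ _).trans ?_
        rw [Finset.prod_const]
        refine (mul_le_of_le_one_right (norm_nonneg _) (pow_le_one₀ (norm_nonneg _) hL)).trans ?_
        exact hC _ _ _
      calc _ ≤ (n.choose i : ℝ) * ‖iteratedFDeriv ℝ i χ y‖ * (C (n - i) * (1 + |σ|) ^ μ) := by
            gcongr
        _ = _ := by ring
    have hnn := integral_mono_of_nonneg (μ := (volume : Measure R3))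
      (Filter.Eventually.of_forall fun y => norm_nonneg _)
      (integrable_finsetSum _ fun i _ => (hχint i).const_mul _) (Filter.Eventually.of_forall hpt)
    refine hnn.trans (le_of_eq ?_)
    rw [integral_finsetSum _ fun i _ => (hχint i).const_mul _, hD, Finset.sum_mul]
    refine Finset.sum_congr rfl fun i _ => ?_
    rw [integral_const_mul]; ring
  have h2 : ∀ (n : ℕ), ∃ E : ℝ, ∀ (L : R3 →L[ℝ] ℝ × ℝ), ‖L‖ ≤ 1 → ∀ (σ : ℝ) (η : R3),
      ‖η‖ ^ n * ‖hat (fun y => χ y * h (σ, L y)) η‖ ≤ E * (1 + |σ|) ^ μ := by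
    intro n
    refine ⟨(4 * Real.pi) ^ n * ∑ i ∈ Finset.range (n + 1), D i, fun L hL σ η => ?_⟩
    have hc : ContDiff ℝ ∞ fun y => χ y * h (σ, L y) :=
      hχ.mul ((contDiff_slice hh.1 σ).comp L.contDiff)
    refine (pow_mul_norm_hat_le hc hs.mul_right n η).trans ?_
    rw [mul_assoc, Finset.sum_mul]
    gcongr with i
    exact h1 i L hL σ
  obtain ⟨E₀, hE₀⟩ := h2 0
  obtain ⟨E, hE⟩ := h2 (3 * M)
  refine ⟨|2 ^ (3 * M) * (E₀ + E)|, abs_nonneg _, fun L hL σ η => ?_⟩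
  rw [le_mul_inv_iff₀ (Finset.prod_pos fun i _ => by positivity)]
  have hσ : 0 < (1 + |σ|) ^ μ := Real.rpow_pos_of_pos (by positivity) _
  calc _ ≤ ‖hat (fun y => χ y * h (σ, L y)) η‖ * (2 ^ (3 * M) * (1 + ‖η‖ ^ (3 * M))) := by
        gcongr; exact prod_one_add_pow_le M η
    _ = 2 ^ (3 * M) * (‖η‖ ^ 0 * ‖hat (fun y => χ y * h (σ, L y)) η‖ +
          ‖η‖ ^ (3 * M) * ‖hat (fun y => χ y * h (σ, L y)) η‖) := by ring
    _ ≤ 2 ^ (3 * M) * (E₀ * (1 + |σ|) ^ μ + E * (1 + |σ|) ^ μ) := by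
        exact mul_le_mul_of_nonneg_left (add_le_add (hE₀ L hL σ η) (hE L hL σ η)) (by positivity)
    _ = 2 ^ (3 * M) * (E₀ + E) * (1 + |σ|) ^ μ := by ring
    _ ≤ _ := by gcongr; exact le_abs_self _

/-- Decay of order `μ` in the direction `j`, rapid in the other two, gives every exponent below
`-μ - 1/2` in the direction `j`: there `2 (κ + μ) < -1`, so that the square is integrable. -/
lemma hasWeight_of_norm_le {g : R3 → ℂ} (hg : AEStronglyMeasurable g) (j : Fin 3) {μ : ℝ}
    (hb : ∀ M : ℕ, ∃ C : ℝ, ∀ η : R3,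
      ‖g η‖ ≤ C * ∏ i, (1 + |η i|) ^ (if i = j then μ else -(M : ℝ))) :
    HasWeight g (fun i => if i = j then ((-μ - 1 / 2 : ℝ) : WithTop ℝ) else ⊤) := by
  intro κ hκ
  obtain ⟨M, hM⟩ := exists_nat_gt (∑ i, κ i + 1)
  have hMi : ∀ i, κ i + 1 < M := fun i => by
    have := Finset.single_le_sum (f := κ) (fun i _ => (hκ i).1) (Finset.mem_univ i)
    linarith
  obtain ⟨C, hC⟩ := hb M
  set e : Fin 3 → ℝ := fun i => κ i + if i = j then μ else -(M : ℝ) with he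
  have he1 : ∀ i, e i < -(1 / 2) := fun i => by
    simp only [he]
    have : (κ i : WithTop ℝ) < if i = j then ((-μ - 1 / 2 : ℝ) : WithTop ℝ) else ⊤ := (hκ i).2
    split_ifs at this ⊢ with hi
    · rw [WithTop.coe_lt_coe] at this; linarith
    · linarith [hMi i]
  rw [memLp_two_iff_lintegral]
  refine ⟨(Complex.continuous_ofReal.comp (continuous_wt κ)).aestronglyMeasurable.mul hg, ?_⟩
  have hint : Integrable fun η : R3 => ∏ i, (1 + |η i|) ^ (2 * e i) := by
    refine integrable_prod_coord (f := fun i t => (1 + |t|) ^ (2 * e i)) fun i => ?_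
    have := integrable_one_add_norm (E := ℝ) (μ := volume) (r := -(2 * e i))
      (by simp; linarith [he1 i])
    simpa using this
  have hb2 : ∀ η : R3, ‖(wt κ η : ℂ) * g η‖ₑ ^ 2 ≤
      ENNReal.ofReal (C ^ 2 * ∏ i, (1 + |η i|) ^ (2 * e i)) := by
    intro η
    rw [← ofReal_norm, ← ENNReal.ofReal_pow (norm_nonneg _)]
    refine ENNReal.ofReal_le_ofReal ?_
    have h1 : wt κ η ≤ ∏ i, (1 + |η i|) ^ κ i := by
      refine Finset.prod_le_prod (fun i _ => by positivity) fun i _ => ?_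
      have h3 : (1 + |η i|) ^ κ i = ((1 + |η i|) ^ 2) ^ (κ i / 2) := by
        rw [← Real.rpow_natCast, ← Real.rpow_mul (by positivity)]
        congr 1; push_cast; ring
      rw [h3]
      refine Real.rpow_le_rpow (by positivity) ?_ (by linarith [(hκ i).1])
      nlinarith [abs_nonneg (η i), sq_abs (η i)]
    have h2 : ‖(wt κ η : ℂ) * g η‖ ≤ C * ∏ i, (1 + |η i|) ^ e i := by
      rw [norm_mul, Complex.norm_real, Real.norm_of_nonneg (wt_pos _ _).le]
      calc _ ≤ (∏ i, (1 + |η i|) ^ κ i) *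
            (C * ∏ i, (1 + |η i|) ^ (if i = j then μ else -(M : ℝ))) := by
            gcongr
            exact hC η
        _ = C * ∏ i, (1 + |η i|) ^ e i := by
            rw [mul_left_comm, ← Finset.prod_mul_distrib]
            congr 1
            refine Finset.prod_congr rfl fun i _ => ?_
            rw [← Real.rpow_add (by positivity)]
    calc _ ≤ (C * ∏ i, (1 + |η i|) ^ e i) ^ 2 := by gcongr
      _ = _ := by
        rw [mul_pow, ← Finset.prod_pow]
        congr 1
        refine Finset.prod_congr rfl fun i _ => ?_
        rw [← Real.rpow_mul_natCast (by positivity)]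
        congr 1; push_cast; ring
  refine (lintegral_mono hb2).trans_lt ?_
  exact (hint.const_mul _).lintegral_lt_top

/-! ### One-dimensional oscillatory integrals -/

/-- The linear map `y ↦ (c y', d y'')` to the scaled coordinates `y', y''` of `y`
along `{y j = 0}`. -/
def transverse (j : Fin 3) (c d : ℝ) : R3 →L[ℝ] ℝ × ℝ :=
  (c • EuclideanSpace.proj (𝕜 := ℝ) (ι := Fin 3) (j.succAbove 0)).prod
    (d • EuclideanSpace.proj (𝕜 := ℝ) (ι := Fin 3) (j.succAbove 1))

lemma transverse_apply (j : Fin 3) (c d : ℝ) (y : R3) :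
    transverse j c d y = (c * y (j.succAbove 0), d * y (j.succAbove 1)) := rfl

lemma norm_transverse_le (j : Fin 3) {c d : ℝ} (hc : |c| ≤ 1) (hd : |d| ≤ 1) :
    ‖transverse j c d‖ ≤ 1 := by
  refine ContinuousLinearMap.opNorm_le_bound _ zero_le_one fun y => ?_
  rw [transverse_apply, Prod.norm_def, one_mul]
  refine max_le ?_ ?_
  · rw [norm_mul]
    exact (mul_le_of_le_one_left (norm_nonneg _) hc).trans (PiLp.norm_apply_le y _)
  · rw [norm_mul]
    exact (mul_le_of_le_one_left (norm_nonneg _) hd).trans (PiLp.norm_apply_le y _)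

/-- The oscillatory integral `∫ e^{i y_j σ} h(σ, c y', d y'') dσ`, where `y', y''` are the other
two coordinates in increasing order. The parameters `c, d ∈ [0, 1]` interpolate between the given
amplitude (value `1`) and its restriction to a coordinate plane (value `0`). -/
def osc (j : Fin 3) (h : ℝ × ℝ × ℝ → ℂ) (c d : ℝ) (y : R3) : ℂ :=
  ∫ σ : ℝ, Complex.exp (Complex.I * ((y j * σ : ℝ) : ℂ)) *
    h (σ, c * y (j.succAbove 0), d * y (j.succAbove 1))

lemma norm_exp_I_mul (t : ℝ) : ‖Complex.exp (Complex.I * (t : ℂ))‖ = 1 := by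
  rw [Complex.norm_exp_I_mul_ofReal]

lemma integrable_one_add_abs_rpow {μ : ℝ} (hμ : μ < -1) :
    Integrable fun σ : ℝ => (1 + |σ|) ^ μ := by
  have := integrable_one_add_norm (E := ℝ) (μ := volume) (r := -μ) (by simp; linarith)
  simpa using this

lemma IsAmplitude.integrable {μ : ℝ} {h : ℝ × ℝ × ℝ → ℂ} (hh : IsAmplitude μ h) (hμ : μ < -1)
    (q : ℝ × ℝ) : Integrable fun σ => h (σ, q) := by
  obtain ⟨C, -, hC⟩ := hh.exists_bound
  refine ((integrable_one_add_abs_rpow hμ).const_mul C).mono' ?_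
    (Filter.Eventually.of_forall fun σ => hC σ q)
  exact (hh.1.continuous.comp (by fun_prop : Continuous fun σ : ℝ => (σ, q))).aestronglyMeasurable

lemma continuous_osc_uncurry {μ : ℝ} {h : ℝ × ℝ × ℝ → ℂ} (hh : IsAmplitude μ h) (hμ : μ < -1)
    (j : Fin 3) : Continuous fun p : ℝ × ℝ × R3 => osc j h p.1 p.2.1 p.2.2 := by
  obtain ⟨C, -, hC⟩ := hh.exists_bound
  have hhc := hh.1.continuous
  unfold osc
  refine continuous_of_dominated (bound := fun σ => C * (1 + |σ|) ^ μ) (fun p => ?_)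
    (fun p => Filter.Eventually.of_forall fun σ => ?_)
    ((integrable_one_add_abs_rpow hμ).const_mul C) (Filter.Eventually.of_forall fun σ => ?_)
  · exact Continuous.aestronglyMeasurable (by fun_prop)
  · rw [norm_mul, norm_exp_I_mul, one_mul]
    exact hC _ _
  · fun_prop

lemma continuous_osc {μ : ℝ} {h : ℝ × ℝ × ℝ → ℂ} (hh : IsAmplitude μ h) (hμ : μ < -1)
    (j : Fin 3) (c d : ℝ) : Continuous (osc j h c d) :=
  (continuous_osc_uncurry hh hμ j).comp (by fun_prop : Continuous fun y : R3 => (c, d, y))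

lemma exists_norm_osc_le {μ : ℝ} {h : ℝ × ℝ × ℝ → ℂ} (hh : IsAmplitude μ h) (hμ : μ < -1)
    (j : Fin 3) : ∃ D : ℝ, ∀ c d y, ‖osc j h c d y‖ ≤ D := by
  obtain ⟨C, -, hC⟩ := hh.exists_bound
  refine ⟨∫ σ : ℝ, C * (1 + |σ|) ^ μ, fun c d y => ?_⟩
  refine norm_integral_le_of_norm_le ((integrable_one_add_abs_rpow hμ).const_mul C)
    (Filter.Eventually.of_forall fun σ => ?_)
  rw [norm_mul, norm_exp_I_mul, one_mul]
  exact hC _ _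

lemma integrable_osc {μ : ℝ} {h : ℝ × ℝ × ℝ → ℂ} (hh : IsAmplitude μ h) (hμ : μ < -1)
    (t : ℝ) (q : ℝ × ℝ) :
    Integrable fun σ : ℝ => Complex.exp (Complex.I * ((t * σ : ℝ) : ℂ)) * h (σ, q) :=
  (hh.integrable hμ q).bdd_mul (c := 1) (Continuous.aestronglyMeasurable (by fun_prop))
    (Filter.Eventually.of_forall fun σ => (norm_exp_I_mul _).le)

lemma expChar_sub_single (η y : R3) (j : Fin 3) (σ : ℝ) :
    expChar (η - EuclideanSpace.single j σ) y =
      expChar η y * Complex.exp (Complex.I * ((y j * σ : ℝ) : ℂ)) := by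
  unfold expChar
  rw [← Complex.exp_add, inner_sub_right, EuclideanSpace.inner_single_right]
  congr 1
  simp
  ring

/-- The integrability that justifies exchanging `dy` and `dσ`. -/
lemma integrable_osc_prod {μ : ℝ} {h : ℝ × ℝ × ℝ → ℂ} (hh : IsAmplitude μ h) (hμ : μ < -1)
    {χ : R3 → ℂ} (hχ : Integrable χ) (L : R3 →L[ℝ] ℝ × ℝ) {E : R3 × ℝ → ℂ} (hE : Continuous E)
    (hE1 : ∀ p, ‖E p‖ = 1) :
    Integrable (fun p : R3 × ℝ => E p * (χ p.1 * h (p.2, L p.1))) (volume.prod volume) := by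
  obtain ⟨C, -, hC⟩ := hh.exists_bound
  have hhc := hh.1.continuous
  have hb : Integrable (fun p : R3 × ℝ => ‖χ p.1‖ * (C * (1 + |p.2|) ^ μ)) (volume.prod volume) :=
    hχ.norm.mul_prod ((integrable_one_add_abs_rpow hμ).const_mul C)
  refine hb.mono' ?_ (Filter.Eventually.of_forall fun p => ?_)
  · refine hE.aestronglyMeasurable.mul (hχ.1.comp_fst.mul ?_)
    exact Continuous.aestronglyMeasurable (by fun_prop)
  · rw [norm_mul, hE1, one_mul, norm_mul]
    gcongr
    exact hC _ _

/-- The factor `e^{i y_j σ}` shifts the frequency by `σ` in the direction `j`. -/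
lemma hat_mul_osc {μ : ℝ} {h : ℝ × ℝ × ℝ → ℂ} (hh : IsAmplitude μ h) (hμ : μ < -1)
    {χ : R3 → ℂ} (hχ : Integrable χ) (j : Fin 3) (c d : ℝ) (η : R3) :
    hat (fun y => χ y * osc j h c d y) η =
      ∫ σ : ℝ, hat (fun y => χ y * h (σ, transverse j c d y)) (η - EuclideanSpace.single j σ) := by
  unfold hat osc
  rw [integral_integral_swap]
  · congr 1; ext y
    simp only []
    rw [← integral_const_mul, ← integral_const_mul]
    congr 1; ext σ
    rw [expChar_sub_single, transverse_apply]
    ring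
  · refine (integrable_osc_prod hh hμ hχ (transverse j c d)
      (E := fun p => expChar (η - EuclideanSpace.single j p.2) p.1) ?_
      fun p => norm_expChar _ _).swap
    simp_rw [expChar_sub_single]
    unfold expChar
    fun_prop

lemma rpow_one_add_abs_le {μ : ℝ} (hμ : μ ≤ 0) (s t : ℝ) :
    (1 + |s|) ^ μ ≤ (1 + |t|) ^ μ * (1 + |t - s|) ^ (-μ) := by
  have h1 : 1 + |t| ≤ (1 + |s|) * (1 + |t - s|) := by
    have : |t| ≤ |s| + |t - s| := by
      have := abs_add_le s (t - s)
      simpa using this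
    nlinarith [abs_nonneg s, abs_nonneg (t - s)]
  have h2 := Real.rpow_le_rpow_of_nonpos (by positivity) h1 hμ
  rw [Real.mul_rpow (by positivity) (by positivity)] at h2
  rw [Real.rpow_neg (by positivity), ← div_eq_mul_inv,
    le_div_iff₀ (Real.rpow_pos_of_pos (by positivity) _)]
  exact h2

/-- The localized oscillatory integral has a Fourier transform of order `μ` in the direction `j`
and rapidly decaying in the other two, uniformly in the parameters `c, d`. -/
lemma exists_norm_hat_osc_le {μ : ℝ} {h : ℝ × ℝ × ℝ → ℂ} (hh : IsAmplitude μ h) (hμ : μ < -1)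
    {χ : R3 → ℂ} (hχ : ContDiff ℝ ∞ χ) (hs : HasCompactSupport χ) (j : Fin 3) (M : ℕ) :
    ∃ C : ℝ, ∀ c d : ℝ, |c| ≤ 1 → |d| ≤ 1 → ∀ η : R3,
      ‖hat (fun y => χ y * osc j h c d y) η‖ ≤
        C * ∏ i, (1 + |η i|) ^ (if i = j then μ else -(M : ℝ)) := by
  obtain ⟨N, hN⟩ := exists_nat_gt (-μ + 2)
  obtain ⟨C, hC0, hC⟩ := exists_norm_hat_mul_le hh hχ hs (M + N)
  have hint : Integrable fun σ : ℝ => (1 + |σ|) ^ (-2 : ℝ) :=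
    integrable_one_add_abs_rpow (by norm_num)
  refine ⟨C * ∫ σ : ℝ, (1 + |σ|) ^ (-2 : ℝ), fun c d hc hd η => ?_⟩
  rw [hat_mul_osc hh hμ (hχ.continuous.integrable_of_hasCompactSupport hs)]
  set P := ∏ i, (1 + |η i|) ^ (if i = j then μ else -(M : ℝ)) with hPdef
  have hpt : ∀ σ : ℝ, ‖hat (fun y => χ y * h (σ, transverse j c d y))
      (η - EuclideanSpace.single j σ)‖ ≤ (C * P) * (1 + |η j - σ|) ^ (-2 : ℝ) := by
    intro σ
    refine (hC _ (norm_transverse_le j hc hd) σ _).trans ?_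
    rw [hPdef, ← Finset.prod_inv_distrib, Fin.prod_univ_succAbove _ j, Fin.prod_univ_succAbove _ j]
    simp only [PiLp.sub_apply, PiLp.single_apply, if_true, Fin.succAbove_ne, if_false, sub_zero]
    -- The decay in `η j - σ` turns order `μ` in `σ` into order `μ` in `η j`.
    have hj : (1 + |σ|) ^ μ * ((1 + |η j - σ|) ^ (M + N))⁻¹ ≤
        (1 + |η j|) ^ μ * (1 + |η j - σ|) ^ (-2 : ℝ) := by
      calc _ ≤ ((1 + |η j|) ^ μ * (1 + |η j - σ|) ^ (-μ)) * ((1 + |η j - σ|) ^ (M + N))⁻¹ := by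
            gcongr
            exact rpow_one_add_abs_le (by linarith) σ (η j)
        _ = (1 + |η j|) ^ μ * (1 + |η j - σ|) ^ (-μ - (M + N : ℕ)) := by
            rw [Real.rpow_sub (by positivity), Real.rpow_natCast]; ring
        _ ≤ _ := by
            gcongr
            · linarith [abs_nonneg (η j - σ)]
            · push_cast
              have : (0 : ℝ) ≤ M := by positivity
              linarith
    have hr : ∀ i : Fin 2, ((1 + |η (j.succAbove i)|) ^ (M + N))⁻¹ ≤
        (1 + |η (j.succAbove i)|) ^ (-(M : ℝ)) := by
      intro i
      rw [Real.rpow_neg (by positivity), Real.rpow_natCast]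
      gcongr
      · linarith [abs_nonneg (η (j.succAbove i))]
      · omega
    calc _ = C * ((1 + |σ|) ^ μ * ((1 + |η j - σ|) ^ (M + N))⁻¹) *
          ∏ i : Fin 2, ((1 + |η (j.succAbove i)|) ^ (M + N))⁻¹ := by ring
      _ ≤ C * ((1 + |η j|) ^ μ * (1 + |η j - σ|) ^ (-2 : ℝ)) *
          ∏ i : Fin 2, (1 + |η (j.succAbove i)|) ^ (-(M : ℝ)) := by
          gcongr
          exact hr _
      _ = _ := by ring
  have hcomp : Integrable fun σ : ℝ => (C * P) * (1 + |η j - σ|) ^ (-2 : ℝ) :=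
    (hint.comp_sub_left (η j)).const_mul _
  refine (norm_integral_le_of_norm_le hcomp (Filter.Eventually.of_forall hpt)).trans (le_of_eq ?_)
  rw [integral_const_mul, integral_sub_left_eq_self (fun σ : ℝ => (1 + |σ|) ^ (-2 : ℝ))]
  ring

/-- The index of a function conormal to `{y j = 0}`: `k` in the direction `j`, `∞` in the other
two. -/
def conormalIndex (j : Fin 3) (k : ℝ) : Fin 3 → WithTop ℝ :=
  fun i => if i = j then (k : WithTop ℝ) else ⊤

lemma bealsFun_osc {μ : ℝ} {h : ℝ × ℝ × ℝ → ℂ} (hh : IsAmplitude μ h) (hμ : μ < -1)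
    (j : Fin 3) {c d : ℝ} (hc : |c| ≤ 1) (hd : |d| ≤ 1) :
    BealsFun Ω (conormalIndex j (-μ - 1 / 2)) (osc j h c d) := by
  have hcont := (continuous_osc hh hμ j c d).continuousOn (s := (Ω : Set R3))
  refine ⟨hcont, fun χ => hasWeight_of_norm_le
    (continuous_hat (integrable_test_mul χ hcont)).aestronglyMeasurable j fun M => ?_⟩
  obtain ⟨C, hC⟩ := exists_norm_hat_osc_le hh hμ χ.contDiff χ.hasCompactSupport j M
  exact ⟨C, hC c d hc hd⟩

lemma bealsFun_integral_osc {μ : ℝ} {h : ℝ × ℝ × ℝ → ℂ} (hh : IsAmplitude μ h) (hμ : μ < -1)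
    (j : Fin 3) {c d : ℝ → ℝ} (hc : Continuous c) (hd : Continuous d)
    (hc1 : ∀ θ ∈ Set.Ioc (0 : ℝ) 1, |c θ| ≤ 1) (hd1 : ∀ θ ∈ Set.Ioc (0 : ℝ) 1, |d θ| ≤ 1) :
    BealsFun Ω (conormalIndex j (-μ - 1 / 2))
      (fun y => ∫ θ in (0 : ℝ)..1, osc j h (c θ) (d θ) y) := by
  have hjc : Continuous fun p : R3 × ℝ => osc j h (c p.2) (d p.2) p.1 :=
    (continuous_osc_uncurry hh hμ j).comp
      (by fun_prop : Continuous fun p : R3 × ℝ => (c p.2, d p.2, p.1))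
  have hcont : Continuous fun y => ∫ θ in (0 : ℝ)..1, osc j h (c θ) (d θ) y :=
    intervalIntegral.continuous_parametric_intervalIntegral_of_continuous' hjc 0 1
  refine ⟨hcont.continuousOn, fun χ => hasWeight_of_norm_le
    (continuous_hat (integrable_test_mul χ hcont.continuousOn)).aestronglyMeasurable j fun M => ?_⟩
  obtain ⟨C, hC⟩ := exists_norm_hat_osc_le hh hμ χ.contDiff χ.hasCompactSupport j M
  refine ⟨C, fun η => ?_⟩
  have hF : hat (fun y => χ y * ∫ θ in (0 : ℝ)..1, osc j h (c θ) (d θ) y) η =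
      ∫ θ in (0 : ℝ)..1, hat (fun y => χ y * osc j h (c θ) (d θ) y) η := by
    unfold hat
    rw [intervalIntegral_integral_swap]
    · congr 1; ext y
      simp only []
      rw [← intervalIntegral.integral_const_mul, ← intervalIntegral.integral_const_mul]
    · rw [Set.uIoc_of_le zero_le_one]
      obtain ⟨D, hD⟩ := exists_norm_osc_le hh hμ j
      have hb : Integrable (fun p : ℝ × R3 => D * ‖χ p.2‖)
          ((volume.restrict (Set.Ioc (0 : ℝ) 1)).prod volume) :=
        (integrable_const D).mul_prod (integrable_test χ).norm
      have hjc' : Continuous fun p : ℝ × R3 => osc j h (c p.1) (d p.1) p.2 :=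
        hjc.comp continuous_swap
      have hχc : Continuous χ := χ.continuous
      have hec := continuous_expChar η
      refine hb.mono' (Continuous.aestronglyMeasurable ?_) (Filter.Eventually.of_forall fun p => ?_)
      · exact (hec.comp continuous_snd).mul ((hχc.comp continuous_snd).mul hjc')
      · change ‖expChar η p.2 * (χ p.2 * osc j h (c p.1) (d p.1) p.2)‖ ≤ _
        rw [norm_mul, norm_expChar, one_mul, norm_mul, mul_comm]
        gcongr
        exact hD _ _ _
  rw [hF]
  have := intervalIntegral.norm_integral_le_of_norm_le_const (a := 0) (b := 1)
    (f := fun θ => hat (fun y => χ y * osc j h (c θ) (d θ) y) η)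
    (C := C * ∏ i, (1 + |η i|) ^ (if i = j then μ else -(M : ℝ))) fun θ hθ => by
      rw [Set.uIoc_of_le zero_le_one] at hθ
      exact hC _ _ (hc1 θ hθ) (hd1 θ hθ) η
  simpa using this

/-- Integration by parts: multiplication by the defining function `y j` becomes a derivative of
the amplitude in `σ`, which is of one order less. -/
lemma coord_mul_osc {μ : ℝ} {h : ℝ × ℝ × ℝ → ℂ} (hh : IsAmplitude μ h) (hμ : μ < -1)
    (hd : IsAmplitude (μ - 1) (partialD (1, 0, 0) h)) (j : Fin 3) (c d : ℝ) (y : R3) :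
    (y j : ℂ) * osc j h c d y = Complex.I * osc j (partialD (1, 0, 0) h) c d y := by
  set q : ℝ × ℝ := (c * y (j.succAbove 0), d * y (j.succAbove 1)) with hq
  have i1 := integrable_osc hh hμ (y j) q
  have i2 := integrable_osc hd (by linarith) (y j) q
  have hder : ∀ σ : ℝ, HasDerivAt
      (fun σ : ℝ => Complex.exp (Complex.I * ((y j * σ : ℝ) : ℂ)) * h (σ, q))
      (Complex.I * y j * (Complex.exp (Complex.I * ((y j * σ : ℝ) : ℂ)) * h (σ, q)) +
        Complex.exp (Complex.I * ((y j * σ : ℝ) : ℂ)) * partialD (1, 0, 0) h (σ, q)) σ := by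
    intro σ
    have e1 : HasDerivAt (fun σ : ℝ => Complex.I * ((y j * σ : ℝ) : ℂ)) (Complex.I * y j) σ := by
      have := ((hasDerivAt_id σ).const_mul (y j)).ofReal_comp.const_mul Complex.I
      simpa using this
    have e2 : HasDerivAt (fun σ : ℝ => h (σ, q)) (partialD (1, 0, 0) h (σ, q)) σ := by
      have g1 : HasDerivAt (fun σ : ℝ => (σ, q)) ((1 : ℝ), (0 : ℝ × ℝ)) σ :=
        (hasDerivAt_id σ).prodMk (hasDerivAt_const σ q)
      exact ((hh.1.differentiable (by simp)) (σ, q)).hasFDerivAt.comp_hasDerivAt σ g1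
    have e3 := e1.cexp.mul e2
    refine e3.congr_deriv ?_
    ring
  have h0 := integral_eq_zero_of_hasDerivAt_of_integrable hder
    ((i1.const_mul _).add i2) i1
  rw [integral_add (i1.const_mul _) i2, integral_const_mul] at h0
  change Complex.I * y j * osc j h c d y + osc j (partialD (1, 0, 0) h) c d y = 0 at h0
  linear_combination (-Complex.I) * h0 + (y j : ℂ) * osc j h c d y * Complex.I_mul_I

lemma intervalIntegral_osc {μ : ℝ} {h : ℝ × ℝ × ℝ → ℂ} (hh : IsAmplitude μ h) (hμ : μ < -1)
    (j : Fin 3) {c d : ℝ → ℝ} (hc : Continuous c) (hd : Continuous d) (y : R3) :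
    ∫ θ in (0 : ℝ)..1, osc j h (c θ) (d θ) y = ∫ σ : ℝ,
      Complex.exp (Complex.I * ((y j * σ : ℝ) : ℂ)) *
        ∫ θ in (0 : ℝ)..1, h (σ, c θ * y (j.succAbove 0), d θ * y (j.succAbove 1)) := by
  unfold osc
  rw [intervalIntegral_integral_swap]
  · congr 1; ext σ
    rw [← intervalIntegral.integral_const_mul]
  · rw [Set.uIoc_of_le zero_le_one]
    obtain ⟨C, -, hC⟩ := hh.exists_bound
    have hhc := hh.1.continuous
    have hb : Integrable (fun p : ℝ × ℝ => 1 * (C * (1 + |p.2|) ^ μ))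
        ((volume.restrict (Set.Ioc (0 : ℝ) 1)).prod volume) :=
      (integrable_const (1 : ℝ)).mul_prod ((integrable_one_add_abs_rpow hμ).const_mul C)
    refine hb.mono' (Continuous.aestronglyMeasurable ?_) (Filter.Eventually.of_forall fun p => ?_)
    · simp only [Function.uncurry_def]
      fun_prop
    · simp only [Function.uncurry_def]
      rw [norm_mul, norm_exp_I_mul]
      gcongr
      exact hC _ _

/-- First-order Taylor expansion of the amplitude in the first transverse variable. The remainder
is `y (j.succAbove 0)` times an oscillatory integral of the same order. -/
lemma osc_sub_osc_fst {μ : ℝ} {h : ℝ × ℝ × ℝ → ℂ} (hh : IsAmplitude μ h) (hμ : μ < -1)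
    (j : Fin 3) (d : ℝ) (y : R3) :
    osc j h 1 d y - osc j h 0 d y =
      (y (j.succAbove 0) : ℂ) * ∫ θ in (0 : ℝ)..1, osc j (partialD (0, 1, 0) h) θ d y := by
  rw [intervalIntegral_osc (hh.partialD (1, 0)) hμ j (c := fun θ => θ) (d := fun _ => d)
    continuous_id continuous_const]
  unfold osc
  rw [← integral_sub (integrable_osc hh hμ _ _) (integrable_osc hh hμ _ _), ← integral_const_mul]
  congr 1; ext σ
  set s := y (j.succAbove 0)
  set t := d * y (j.succAbove 1)
  have hder : ∀ θ : ℝ, HasDerivAt (fun θ : ℝ => h (σ, θ * s, t))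
      (s * partialD (0, 1, 0) h (σ, θ * s, t)) θ := fun θ => by
    have g1 : HasDerivAt (fun θ : ℝ => (σ, θ * s, t)) ((0 : ℝ), s, (0 : ℝ)) θ :=
      (hasDerivAt_const θ σ).prodMk ((by simpa using (hasDerivAt_id θ).mul_const s :
        HasDerivAt (fun θ : ℝ => θ * s) s θ).prodMk (hasDerivAt_const θ t))
    have g2 := ((hh.1.differentiable (by simp)) (σ, θ * s, t)).hasFDerivAt.comp_hasDerivAt θ g1
    have g3 : ((0 : ℝ), s, (0 : ℝ)) = s • ((0 : ℝ), (1 : ℝ), (0 : ℝ)) := by simp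
    rw [g3, map_smul, Complex.real_smul] at g2
    exact g2
  have hcont : Continuous fun θ : ℝ => (s : ℂ) * partialD (0, 1, 0) h (σ, θ * s, t) := by
    have := (contDiff_partialD hh.1 (0, 1, 0)).continuous
    fun_prop
  have := intervalIntegral.integral_eq_sub_of_hasDerivAt (a := 0) (b := 1) (fun θ _ => hder θ)
    (hcont.intervalIntegrable 0 1)
  rw [intervalIntegral.integral_const_mul] at this
  rw [mul_left_comm, this]
  ring

/-- First-order Taylor expansion of the amplitude in the second transverse variable. -/
lemma osc_sub_osc_snd {μ : ℝ} {h : ℝ × ℝ × ℝ → ℂ} (hh : IsAmplitude μ h) (hμ : μ < -1)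
    (j : Fin 3) (c : ℝ) (y : R3) :
    osc j h c 1 y - osc j h c 0 y =
      (y (j.succAbove 1) : ℂ) * ∫ θ in (0 : ℝ)..1, osc j (partialD (0, 0, 1) h) c θ y := by
  rw [intervalIntegral_osc (hh.partialD (0, 1)) hμ j (c := fun _ => c) (d := fun θ => θ)
    continuous_const continuous_id]
  unfold osc
  rw [← integral_sub (integrable_osc hh hμ _ _) (integrable_osc hh hμ _ _), ← integral_const_mul]
  congr 1; ext σ
  set s := c * y (j.succAbove 0)
  set t := y (j.succAbove 1)
  have hder : ∀ θ : ℝ, HasDerivAt (fun θ : ℝ => h (σ, s, θ * t))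
      (t * partialD (0, 0, 1) h (σ, s, θ * t)) θ := fun θ => by
    have g1 : HasDerivAt (fun θ : ℝ => (σ, s, θ * t)) ((0 : ℝ), (0 : ℝ), t) θ :=
      (hasDerivAt_const θ σ).prodMk ((hasDerivAt_const θ s).prodMk
        (by simpa using (hasDerivAt_id θ).mul_const t : HasDerivAt (fun θ : ℝ => θ * t) t θ))
    have g2 := ((hh.1.differentiable (by simp)) (σ, s, θ * t)).hasFDerivAt.comp_hasDerivAt θ g1
    have g3 : ((0 : ℝ), (0 : ℝ), t) = t • ((0 : ℝ), (0 : ℝ), (1 : ℝ)) := by simp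
    rw [g3, map_smul, Complex.real_smul] at g2
    exact g2
  have hcont : Continuous fun θ : ℝ => (t : ℂ) * partialD (0, 0, 1) h (σ, s, θ * t) := by
    have := (contDiff_partialD hh.1 (0, 0, 1)).continuous
    fun_prop
  have := intervalIntegral.integral_eq_sub_of_hasDerivAt (a := 0) (b := 1) (fun θ _ => hder θ)
    (hcont.intervalIntegrable 0 1)
  rw [intervalIntegral.integral_const_mul] at this
  rw [mul_left_comm, this]
  ring

lemma oscPairing_eq {μ : ℝ} {h : ℝ × ℝ × ℝ → ℂ} (hh : IsAmplitude μ h) (hμ : μ < -1)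
    (j : Fin 3) (φ : 𝓓(Ω, ℂ)) : oscPairing j h φ = ∫ y, osc j h 1 1 y * φ y := by
  unfold oscPairing osc
  rw [integral_integral_swap]
  · congr 1; ext y
    rw [← integral_mul_const]
    simp only [one_mul]
  · refine ((integrable_osc_prod hh hμ (integrable_test φ) (transverse j 1 1)
      (E := fun p => Complex.exp (Complex.I * ((p.1 j * p.2 : ℝ) : ℂ))) (by fun_prop)
      fun p => norm_exp_I_mul _).swap).congr (Filter.Eventually.of_forall fun p => ?_)
    simp only [Function.comp, Prod.fst_swap, Prod.snd_swap, transverse_apply, one_mul,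
      Function.uncurry_def]
    ring

/-! ### Conormal regularity on the Fourier side -/

lemma mulTest_apply (φ : 𝓓(Ω, ℂ)) (c : R3 → ℂ) (hc : ContDiffOn ℝ ∞ c (Ω : Set R3)) (y : R3) :
    mulTest c hc φ y = c y * φ y := rfl

lemma expTest_apply (η : R3) (φ : 𝓓(Ω, ℂ)) (y : R3) : expTest η φ y = expChar η y * φ y := rfl

lemma lineDerivOp_test_apply (φ : 𝓓(Ω, ℂ)) (v y : R3) :
    (LineDeriv.lineDerivOp v φ : 𝓓(Ω, ℂ)) y = fderiv ℝ φ y v := by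
  rw [TestFunction.lineDerivOp_eq_lineDerivCLM (𝕜 := ℂ),
    TestFunction.lineDerivCLM_apply_of_le le_top,
    ((φ.contDiff.differentiable (by simp)) y).lineDeriv_eq_fderiv]

lemma VField.transpose_add (X : VField Ω) (φ ψ : 𝓓(Ω, ℂ)) :
    X.transpose (φ + ψ) = X.transpose φ + X.transpose ψ := by
  have h : ∀ i, mulTest (fun y => (X.coeff i y : ℂ)) (X.smooth_ofReal i) (φ + ψ) =
      mulTest (fun y => (X.coeff i y : ℂ)) (X.smooth_ofReal i) φ +
      mulTest (fun y => (X.coeff i y : ℂ)) (X.smooth_ofReal i) ψ := fun i => by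
    ext y
    simp [mulTest_apply, mul_add]
  unfold VField.transpose
  simp_rw [h, LineDeriv.lineDerivOp_add]
  rw [Finset.sum_add_distrib, neg_add]

lemma VField.transpose_smul (X : VField Ω) (c : ℂ) (φ : 𝓓(Ω, ℂ)) :
    X.transpose (c • φ) = c • X.transpose φ := by
  have h : ∀ i, mulTest (fun y => (X.coeff i y : ℂ)) (X.smooth_ofReal i) (c • φ) =
      c • mulTest (fun y => (X.coeff i y : ℂ)) (X.smooth_ofReal i) φ := fun i => by
    ext y
    simp [mulTest_apply, mul_left_comm]
  unfold VField.transpose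
  simp_rw [h, LineDeriv.lineDerivOp_smul]
  rw [← Finset.smul_sum, smul_neg]

lemma iterTranspose_add (Xs : List (VField Ω)) (φ ψ : 𝓓(Ω, ℂ)) :
    iterTranspose Xs (φ + ψ) = iterTranspose Xs φ + iterTranspose Xs ψ := by
  induction Xs generalizing φ ψ with
  | nil => rfl
  | cons X Xs ih => simp only [iterTranspose, X.transpose_add, ih]

lemma iterTranspose_smul (Xs : List (VField Ω)) (c : ℂ) (φ : 𝓓(Ω, ℂ)) :
    iterTranspose Xs (c • φ) = c • iterTranspose Xs φ := by
  induction Xs generalizing φ with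
  | nil => rfl
  | cons X Xs ih => simp only [iterTranspose, X.transpose_smul, ih]

/-- The coordinate vector field `∂_l`. -/
def coordField (Ω : Opens R3) (l : Fin 3) : VField Ω where
  coeff i _ := if i = l then 1 else 0
  smooth _ := contDiffOn_const

lemma coordField_tangentTo {j l : Fin 3} (h : l ≠ j) : (coordField Ω l).TangentTo j :=
  fun _ _ _ => if_neg h.symm

lemma coordField_transpose (l : Fin 3) (φ : 𝓓(Ω, ℂ)) : (coordField Ω l).transpose φ =
    -LineDeriv.lineDerivOp (EuclideanSpace.single l (1 : ℝ) : R3) φ := by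
  unfold VField.transpose
  rw [Finset.sum_eq_single l]
  · congr 2
    ext y
    simp [mulTest_apply, coordField]
  · intro i _ hi
    have : mulTest (fun y => ((coordField Ω l).coeff i y : ℂ)) ((coordField Ω l).smooth_ofReal i) φ
        = 0 := by
      ext y
      simp [mulTest_apply, coordField, hi]
    rw [this, LineDeriv.lineDerivOp_zero]
  · simp

lemma hasFDerivAt_expChar (η y : R3) :
    HasFDerivAt (expChar η) ((-(Complex.I * expChar η y)) •
      (Complex.ofRealCLM.comp (innerSL ℝ η))) y := by
  have h1 : HasFDerivAt (fun y : R3 => ((inner ℝ y η : ℝ) : ℂ))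
      (Complex.ofRealCLM.comp (innerSL ℝ η)) y := by
    have := (Complex.ofRealCLM.comp (innerSL ℝ η)).hasFDerivAt (x := y)
    refine this.congr_of_eventuallyEq (Filter.Eventually.of_forall fun z => ?_)
    simp [real_inner_comm]
  have h2 := ((h1.const_mul Complex.I).neg).cexp
  refine h2.congr_fderiv ?_
  ext v
  simp [expChar]
  ring

/-- Multiplication by `η l` is, up to localization, the vector field `∂_l`: the Leibniz rule for
`∂_l (χ e^{-i y·η})`. -/
lemma coord_smul_expTest (l : Fin 3) (η : R3) (χ : 𝓓(Ω, ℂ)) :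
    ((η l : ℝ) : ℂ) • expTest η χ = (-Complex.I) • ((coordField Ω l).transpose (expTest η χ) +
      expTest η (LineDeriv.lineDerivOp (EuclideanSpace.single l (1 : ℝ) : R3) χ)) := by
  ext y
  have h : HasFDerivAt (expTest η χ) _ y := (hasFDerivAt_expChar η y).mul
    ((χ.contDiff.differentiable (by simp)) y).hasFDerivAt
  rw [coordField_transpose]
  simp only [IsAddApply.add_apply, IsSMulApply.smul_apply, IsNegApply.neg_apply, expTest_apply,
    lineDerivOp_test_apply, h.fderiv]
  simp [EuclideanSpace.inner_single_right]
  linear_combination ((η l : ℂ)) * χ y * expChar η y * Complex.I_mul_I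

lemma IsBesovFourier.add {s : ℝ} {f g : R3 → ℂ} (hf : IsBesovFourier s f)
    (hg : IsBesovFourier s g) : IsBesovFourier s fun η => f η + g η := by
  obtain ⟨hfm, C, hC⟩ := hf
  obtain ⟨hgm, D, hD⟩ := hg
  refine ⟨hfm.add hgm, 2 * (C + D), fun k => ?_⟩
  have hpt : ∀ η : R3, ENNReal.ofReal ((1 + ‖η‖ ^ 2) ^ s) * ‖f η + g η‖ₑ ^ 2 ≤
      2 * (ENNReal.ofReal ((1 + ‖η‖ ^ 2) ^ s) * ‖f η‖ₑ ^ 2 +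
        ENNReal.ofReal ((1 + ‖η‖ ^ 2) ^ s) * ‖g η‖ₑ ^ 2) := fun η => by
    rw [← mul_add, mul_left_comm]
    gcongr
    calc ‖f η + g η‖ₑ ^ 2 ≤ (‖f η‖ₑ + ‖g η‖ₑ) ^ 2 := by gcongr; exact enorm_add_le _ _
      _ ≤ 2 ^ (2 - 1) * (‖f η‖ₑ ^ 2 + ‖g η‖ₑ ^ 2) := by
        have := ENNReal.rpow_add_le_mul_rpow_add_rpow ‖f η‖ₑ ‖g η‖ₑ (p := 2) (by norm_num)
        norm_num at this ⊢
        exact this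
      _ = _ := by norm_num
  refine (lintegral_mono hpt).trans ?_
  have hw : Measurable fun η : R3 => ENNReal.ofReal ((1 + ‖η‖ ^ 2) ^ s) := by fun_prop
  rw [lintegral_const_mul' _ _ (by simp), lintegral_add_left']
  · push_cast
    gcongr
    · exact hC k
    · exact hD k
  · exact (hw.aemeasurable.mul (hfm.enorm.pow_const 2)).restrict

lemma IsBesovFourier.const_mul {s : ℝ} {f : R3 → ℂ} (hf : IsBesovFourier s f) (c : ℂ) :
    IsBesovFourier s fun η => c * f η := by
  obtain ⟨hfm, C, hC⟩ := hf
  refine ⟨hfm.const_mul c, ‖c‖₊ ^ 2 * C, fun k => ?_⟩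
  have hpt : ∀ η : R3, ENNReal.ofReal ((1 + ‖η‖ ^ 2) ^ s) * ‖c * f η‖ₑ ^ 2 =
      (‖c‖₊ : ℝ≥0∞) ^ 2 * (ENNReal.ofReal ((1 + ‖η‖ ^ 2) ^ s) * ‖f η‖ₑ ^ 2) := fun η => by
    rw [enorm_mul, mul_pow, mul_left_comm]; rfl
  simp_rw [hpt]
  rw [lintegral_const_mul' _ _ (by simp)]
  push_cast
  gcongr
  exact hC k

/-- Multiplication by `p(η)` preserves the Besov bounds for all localized derivatives of `u` along
vector fields tangent to `{y j = 0}`. -/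
def IsConormalMultiplier (Ω : Opens R3) (j : Fin 3) (M : ℝ) (u : CDistribution Ω)
    (p : R3 → ℝ) : Prop :=
  ∀ Xs : List (VField Ω), (∀ X ∈ Xs, X.TangentTo j) → ∀ χ : 𝓓(Ω, ℂ),
    IsBesovFourier (-M - 3 / 4) fun η => (p η : ℂ) * u (iterTranspose Xs (expTest η χ))

lemma IsConormal.isConormalMultiplier_one {j : Fin 3} {M : ℝ} {u : CDistribution Ω}
    (hu : IsConormal Ω j M u) : IsConormalMultiplier Ω j M u fun _ => 1 := fun Xs hXs χ => by
  simpa using hu Xs hXs χ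

/-- For `l ≠ j` the field `∂_l` is tangent to `{y j = 0}`, so powers of `η l` cost nothing. -/
lemma IsConormalMultiplier.coord_mul {j l : Fin 3} (hl : l ≠ j) {M : ℝ} {u : CDistribution Ω}
    {p : R3 → ℝ} (hp : IsConormalMultiplier Ω j M u p) :
    IsConormalMultiplier Ω j M u fun η => η l * p η := fun Xs hXs χ => by
  have h1 := hp (coordField Ω l :: Xs) (by
    intro X hX
    rcases List.mem_cons.1 hX with rfl | h
    · exact coordField_tangentTo hl
    · exact hXs X h) χ
  have h2 := hp Xs hXs (LineDeriv.lineDerivOp (EuclideanSpace.single l (1 : ℝ) : R3) χ)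
  convert (h1.add h2).const_mul (-Complex.I) using 2 with η
  have h3 := congrArg (fun φ => u (iterTranspose Xs φ)) (coord_smul_expTest l η χ)
  simp only [iterTranspose_smul, iterTranspose_add, map_smul, map_add, smul_eq_mul] at h3
  simp only [iterTranspose]
  push_cast
  linear_combination (p η : ℂ) * h3

lemma IsConormalMultiplier.one_add_sq_pow_mul {j l : Fin 3} (hl : l ≠ j) {M : ℝ}
    {u : CDistribution Ω} {p : R3 → ℝ} (hp : IsConormalMultiplier Ω j M u p) (N : ℕ) :
    IsConormalMultiplier Ω j M u fun η => (1 + η l ^ 2) ^ N * p η := by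
  induction N with
  | zero => simpa using hp
  | succ N ih =>
    intro Xs hXs χ
    convert (ih Xs hXs χ).add ((ih.coord_mul hl).coord_mul hl Xs hXs χ) using 2 with η
    push_cast
    ring

lemma lintegral_le_tsum_shell (f : R3 → ℝ≥0∞) : ∫⁻ η, f η ≤ ∑' k, ∫⁻ η in shell k, f η := by
  have hcover : (⋃ k, shell k) = Set.univ := by
    refine Set.eq_univ_of_forall fun η => Set.mem_iUnion.2 ?_
    by_cases h : ‖η‖ < 1
    · exact ⟨0, h⟩
    · obtain ⟨n, h1, h2⟩ := exists_nat_pow_near (not_lt.1 h) (one_lt_two)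
      exact ⟨n + 1, h1, h2⟩
  rw [← setLIntegral_univ, ← hcover]
  exact lintegral_iUnion_le _ _

/-- Below the Besov exponent the dyadic bounds sum up, as a geometric series of ratio `4^{t - s}`.
-/
lemma IsBesovFourier.lintegral_lt_top {s t : ℝ} (hst : t < s) {g : R3 → ℂ}
    (hg : IsBesovFourier s g) :
    ∫⁻ η, ENNReal.ofReal ((1 + ‖η‖ ^ 2) ^ t) * ‖g η‖ₑ ^ 2 < ⊤ := by
  obtain ⟨-, C, hC⟩ := hg
  set r : ℝ := (4 : ℝ) ^ (t - s) with hr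
  have hr0 : 0 < r := Real.rpow_pos_of_pos (by norm_num) _
  have hr1 : r < 1 := Real.rpow_lt_one_of_one_lt_of_neg (by norm_num) (by linarith)
  have hshell : ∀ k, ∀ η ∈ shell k, (1 + ‖η‖ ^ 2) ^ (t - s) ≤ r⁻¹ * r ^ k := by
    intro k η hη
    cases k with
    | zero =>
      have : (1 + ‖η‖ ^ 2) ^ (t - s) ≤ 1 :=
        Real.rpow_le_one_of_one_le_of_nonpos (by nlinarith [sq_nonneg ‖η‖]) (by linarith)
      have h2 : 1 ≤ r⁻¹ := (one_le_inv₀ hr0).2 hr1.le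
      simpa using this.trans h2
    | succ k =>
      have h1 : (4 : ℝ) ^ k ≤ 1 + ‖η‖ ^ 2 := by
        have h3 := hη.1
        have : (4 : ℝ) ^ k = (2 ^ k) ^ 2 := by rw [← pow_mul, mul_comm, pow_mul]; norm_num
        rw [this]
        have : ((2 : ℝ) ^ k) ^ 2 ≤ ‖η‖ ^ 2 := by gcongr
        linarith
      have h2 := Real.rpow_le_rpow_of_nonpos (by positivity) h1 (by linarith : t - s ≤ 0)
      refine h2.trans (le_of_eq ?_)
      rw [pow_succ', ← mul_assoc, inv_mul_cancel₀ hr0.ne', one_mul, hr, ← Real.rpow_natCast,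
        ← Real.rpow_mul (by norm_num), ← Real.rpow_mul_natCast (by norm_num), mul_comm]
  refine (lintegral_le_tsum_shell _).trans_lt ?_
  have hk : ∀ k, ∫⁻ η in shell k, ENNReal.ofReal ((1 + ‖η‖ ^ 2) ^ t) * ‖g η‖ₑ ^ 2 ≤
      (ENNReal.ofReal r⁻¹ * C) * ENNReal.ofReal r ^ k := by
    intro k
    have hm : MeasurableSet (shell k) := by
      cases k with
      | zero => exact measurableSet_lt measurable_norm measurable_const
      | succ k =>
        exact (measurableSet_le measurable_const measurable_norm).inter
          (measurableSet_lt measurable_norm measurable_const)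
    calc _ ≤ ∫⁻ η in shell k, ENNReal.ofReal (r⁻¹ * r ^ k) *
          (ENNReal.ofReal ((1 + ‖η‖ ^ 2) ^ s) * ‖g η‖ₑ ^ 2) := by
          refine setLIntegral_mono' hm fun η hη => ?_
          rw [← mul_assoc, ← ENNReal.ofReal_mul (by positivity)]
          gcongr
          have : (1 + ‖η‖ ^ 2) ^ t = (1 + ‖η‖ ^ 2) ^ (t - s) * (1 + ‖η‖ ^ 2) ^ s := by
            rw [← Real.rpow_add (by positivity)]; ring_nf
          rw [this]
          gcongr
          exact hshell k η hη
      _ ≤ ENNReal.ofReal (r⁻¹ * r ^ k) * C := by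
          rw [lintegral_const_mul' _ _ (by simp)]
          gcongr
          exact hC k
      _ = _ := by
          rw [ENNReal.ofReal_mul (by positivity), ENNReal.ofReal_pow hr0.le]; ring
  refine (ENNReal.tsum_le_tsum hk).trans_lt ?_
  rw [ENNReal.tsum_mul_left, ENNReal.tsum_geometric]
  refine ENNReal.mul_lt_top (ENNReal.mul_lt_top (by simp) (by simp)) ?_
  rw [ENNReal.inv_lt_top, tsub_pos_iff_lt]
  exact ENNReal.ofReal_lt_one.2 hr1

/-- Conormal regularity on the Fourier side: rapid decay along `{y j = 0}` from the tangent
derivatives, and every exponent below the Besov exponent in the direction `j`. -/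
lemma IsConormal.hasWeight {j : Fin 3} {M : ℝ} {u : CDistribution Ω} (hu : IsConormal Ω j M u)
    (χ : 𝓓(Ω, ℂ)) : HasWeight (fourierLoc u χ) (conormalIndex j (-M - 3 / 4)) := by
  intro κ hκ
  have hκj : κ j < -M - 3 / 4 := by
    have : (κ j : WithTop ℝ) < if j = j then ((-M - 3 / 4 : ℝ) : WithTop ℝ) else ⊤ := (hκ j).2
    rw [if_pos rfl] at this
    exact WithTop.coe_lt_coe.1 this
  obtain ⟨N, hN⟩ := exists_nat_gt (∑ i, κ i)
  have hNi : ∀ i, κ i / 2 ≤ N := fun i => by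
    have := Finset.single_le_sum (f := κ) (fun i _ => (hκ i).1) (Finset.mem_univ i)
    linarith [(hκ i).1]
  have h0 := ((hu.isConormalMultiplier_one.one_add_sq_pow_mul (Fin.succAbove_ne j 1)
    N).one_add_sq_pow_mul (Fin.succAbove_ne j 0) N) [] (by simp) χ
  have h1 := hu [] (by simp) χ
  rw [memLp_two_iff_lintegral]
  refine ⟨(Complex.continuous_ofReal.comp (continuous_wt κ)).aestronglyMeasurable.mul h1.1, ?_⟩
  refine lt_of_le_of_lt (lintegral_mono fun η => ?_) (h0.lintegral_lt_top hκj)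
  simp only [iterTranspose]
  change ‖(wt κ η : ℂ) * fourierLoc u χ η‖ₑ ^ 2 ≤ _ * ‖_ * fourierLoc u χ η‖ₑ ^ 2
  rw [← ofReal_norm, ← ofReal_norm, ← ENNReal.ofReal_pow (norm_nonneg _),
    ← ENNReal.ofReal_pow (norm_nonneg _), ← ENNReal.ofReal_mul (by positivity)]
  refine ENNReal.ofReal_le_ofReal ?_
  rw [norm_mul, norm_mul, mul_pow, mul_pow, ← mul_assoc]
  gcongr
  rw [Complex.norm_real, Complex.norm_real, Real.norm_of_nonneg (wt_pos _ _).le,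
    Real.norm_of_nonneg (by positivity)]
  have hwj : ((1 + η j ^ 2) ^ (κ j / 2)) ^ 2 ≤ (1 + ‖η‖ ^ 2) ^ κ j := by
    rw [← Real.rpow_mul_natCast (by positivity), Nat.cast_ofNat, div_mul_cancel₀ _ two_ne_zero]
    refine Real.rpow_le_rpow (by positivity) ?_ (hκ j).1
    have := PiLp.norm_apply_le η j
    rw [Real.norm_eq_abs] at this
    have := sq_le_sq' (by linarith [abs_nonneg (η j), norm_nonneg η]) this
    rw [sq_abs] at this
    linarith
  have hwi : ∀ i, (1 + η i ^ 2) ^ (κ i / 2) ≤ (1 + η i ^ 2) ^ N := fun i => by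
    rw [← Real.rpow_natCast (1 + η i ^ 2) N]
    exact Real.rpow_le_rpow_of_exponent_le (le_add_of_nonneg_right (sq_nonneg _)) (hNi i)
  have hw : wt κ η = (1 + η j ^ 2) ^ (κ j / 2) *
      ((1 + η (j.succAbove 0) ^ 2) ^ (κ (j.succAbove 0) / 2) *
      (1 + η (j.succAbove 1) ^ 2) ^ (κ (j.succAbove 1) / 2)) := by
    unfold wt
    rw [Fin.prod_univ_succAbove _ j, Fin.prod_univ_two]
  rw [hw, mul_pow, mul_one]
  gcongr
  · exact hwi _
  · exact hwi _

/-! ### Finite order of distributions -/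

/-- A distribution has finite order on the support of `χ`. -/
lemma exists_norm_apply_testMul_le (u : CDistribution Ω) (χ : 𝓓(Ω, ℂ)) :
    ∃ (N : ℕ) (C : ℝ), 0 ≤ C ∧ ∀ (τ : 𝓓(Ω, ℂ)) (B : ℝ),
      (∀ n ≤ N, ∀ y, ‖iteratedFDeriv ℝ n τ y‖ ≤ B) → ‖u (testMul τ χ)‖ ≤ C * B := by
  set K : Compacts R3 := ⟨tsupport χ, χ.hasCompactSupport.isCompact⟩ with hK
  have hKΩ : (K : Set R3) ⊆ Ω := χ.tsupport_subset
  set T : 𝓓_{K}(R3, ℂ) →L[ℂ] ℂ := u ∘L TestFunction.ofSupportedInCLM ℂ hKΩ with hT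
  obtain ⟨s, C, -, hC⟩ := Seminorm.bound_of_continuous
    (ContDiffMapSupportedIn.withSeminorms ℂ R3 ℂ ⊤ K)
    ((normSeminorm ℂ ℂ).comp T.toLinearMap) (by exact continuous_norm.comp T.continuous)
  have hχb : ∀ n : ℕ, ∃ b : ℝ, 0 ≤ b ∧ ∀ y, ‖iteratedFDeriv ℝ n χ y‖ ≤ b := fun n => by
    have hc : Continuous (iteratedFDeriv ℝ n χ) :=
      χ.contDiff.continuous_iteratedFDeriv (WithTop.coe_le_coe.2 le_top)
    obtain ⟨b, hb⟩ := (χ.hasCompactSupport.iteratedFDeriv n).exists_bound_of_continuous hc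
    exact ⟨b, (norm_nonneg _).trans (hb 0), hb⟩
  choose b hb0 hb using hχb
  refine ⟨s.sup id, C * ∑ i ∈ s, ∑ k ∈ Finset.range (i + 1), (i.choose k : ℝ) * b (i - k),
    mul_nonneg C.2 (Finset.sum_nonneg fun i _ => Finset.sum_nonneg fun k _ =>
      mul_nonneg (by positivity) (hb0 _)), fun τ B hB => ?_⟩
  have hB0 : 0 ≤ B := (norm_nonneg _).trans (hB 0 (Nat.zero_le _) 0)
  set φ : 𝓓_{K}(R3, ℂ) := ContDiffMapSupportedIn.of_support_subset (testMul τ χ).contDiff (by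
    exact (subset_tsupport _).trans (tsupport_mul_subset_right (f := τ) (g := χ))) with hφ
  have h1 := hC φ
  have h2 : ((normSeminorm ℂ ℂ).comp T.toLinearMap) φ = ‖u (testMul τ χ)‖ := by
    rfl
  rw [h2] at h1
  refine h1.trans ?_
  have h3 : (s.sup (ContDiffMapSupportedIn.seminorm ℂ R3 ℂ ⊤ K)) φ ≤
      ∑ i ∈ s, (∑ k ∈ Finset.range (i + 1), (i.choose k : ℝ) * b (i - k)) * B := by
    have hnn : ∀ i ∈ s, 0 ≤ (∑ k ∈ Finset.range (i + 1), (i.choose k : ℝ) * b (i - k)) * B :=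
      fun i _ => mul_nonneg (Finset.sum_nonneg fun k _ => mul_nonneg (by positivity) (hb0 _)) hB0
    refine Seminorm.finset_sup_apply_le (Finset.sum_nonneg hnn) fun i hi => ?_
    refine le_trans ?_ (Finset.single_le_sum hnn hi)
    refine (ContDiffMapSupportedIn.seminorm_top_le_iff ℂ (hnn i hi) i φ).2 fun y _ => ?_
    change ‖iteratedFDeriv ℝ i (fun y => τ y * χ y) y‖ ≤ _
    refine (norm_iteratedFDeriv_mul_le τ.contDiff χ.contDiff y
        (WithTop.coe_le_coe.2 le_top)).trans ?_
    rw [Finset.sum_mul]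
    refine Finset.sum_le_sum fun k hk => ?_
    have hk' : k ≤ s.sup id := (Nat.lt_succ_iff.1 (Finset.mem_range.1 hk)).trans
      (Finset.le_sup (f := id) hi)
    calc _ ≤ (i.choose k : ℝ) * B * b (i - k) := by
          gcongr
          · exact hB k hk' y
          · exact hb _ y
      _ = _ := by ring
  calc _ = (C : ℝ) * (s.sup (ContDiffMapSupportedIn.seminorm ℂ R3 ℂ ⊤ K)) φ := rfl
    _ ≤ C * ∑ i ∈ s, (∑ k ∈ Finset.range (i + 1), (i.choose k : ℝ) * b (i - k)) * B := by gcongr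
    _ = _ := by rw [← Finset.sum_mul]; ring

lemma exists_one_add_sq_pow_mul_norm_hat_le (τ : 𝓓(Ω, ℂ)) (n : ℕ) :
    ∃ C : ℝ, ∀ ξ, (1 + ‖ξ‖ ^ 2) ^ n * ‖hat τ ξ‖ ≤ C := by
  have h : ∀ k, ∃ C, ∀ ξ, ‖ξ‖ ^ k * ‖hat τ ξ‖ ≤ C := fun k =>
    ⟨_, pow_mul_norm_hat_le τ.contDiff τ.hasCompactSupport k⟩
  choose C hC using h
  refine ⟨2 ^ n * (C 0 + C (2 * n)), fun ξ => ?_⟩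
  calc (1 + ‖ξ‖ ^ 2) ^ n * ‖hat τ ξ‖ ≤ (2 ^ n * (1 + ‖ξ‖ ^ (2 * n))) * ‖hat τ ξ‖ := by
        gcongr
        refine (add_pow_le zero_le_one (by positivity) n).trans ?_
        rw [one_pow, ← pow_mul]
        gcongr
        · norm_num
        · omega
    _ = 2 ^ n * (‖ξ‖ ^ 0 * ‖hat τ ξ‖ + ‖ξ‖ ^ (2 * n) * ‖hat τ ξ‖) := by ring
    _ ≤ _ := mul_le_mul_of_nonneg_left (add_le_add (hC 0 ξ) (hC (2 * n) ξ)) (by positivity)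

lemma integrable_inv_one_add_norm_sq_sq : Integrable fun ξ : R3 => ((1 + ‖ξ‖ ^ 2) ^ 2)⁻¹ := by
  have h := integrable_rpow_neg_one_add_norm_sq (E := R3) (μ := volume) (r := 4)
    (by rw [finrank_euclideanSpace_fin]; norm_num)
  refine h.congr (Filter.Eventually.of_forall fun ξ => ?_)
  simp only
  rw [show (-4 / 2 : ℝ) = -(2 : ℕ) by norm_num, Real.rpow_neg (by positivity), Real.rpow_natCast]

/-- The Fourier transform with the weight `⟨ξ⟩^{2N}`. -/
def polyHat (N : ℕ) (τ : R3 → ℂ) (ξ : R3) : ℂ := (((1 + ‖ξ‖ ^ 2) ^ N : ℝ) : ℂ) * hat τ ξ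

lemma norm_polyHat (N : ℕ) (τ : R3 → ℂ) (ξ : R3) :
    ‖polyHat N τ ξ‖ = (1 + ‖ξ‖ ^ 2) ^ N * ‖hat τ ξ‖ := by
  rw [polyHat, norm_mul, Complex.norm_real, Real.norm_of_nonneg (by positivity)]

lemma continuous_polyHat (N : ℕ) (τ : 𝓓(Ω, ℂ)) : Continuous (polyHat N τ) := by
  have := continuous_hat (integrable_test τ)
  unfold polyHat
  fun_prop

lemma exists_norm_polyHat_le (N : ℕ) (τ : 𝓓(Ω, ℂ)) :
    ∃ C : ℝ, 0 ≤ C ∧ ∀ ξ, ‖polyHat N τ ξ‖ ≤ C * ((1 + ‖ξ‖ ^ 2) ^ 2)⁻¹ := by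
  obtain ⟨C, hC⟩ := exists_one_add_sq_pow_mul_norm_hat_le τ (N + 2)
  refine ⟨C, le_trans (by positivity) (hC 0), fun ξ => ?_⟩
  rw [norm_polyHat, le_mul_inv_iff₀ (by positivity)]
  refine le_trans (le_of_eq ?_) (hC ξ)
  ring

lemma integrable_polyHat (N : ℕ) (τ : 𝓓(Ω, ℂ)) : Integrable (polyHat N τ) := by
  obtain ⟨C, -, hC⟩ := exists_norm_polyHat_le N τ
  exact (integrable_inv_one_add_norm_sq_sq.const_mul C).mono'
    (continuous_polyHat N τ).aestronglyMeasurable (Filter.Eventually.of_forall hC)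

lemma integrable_hat_test (τ : 𝓓(Ω, ℂ)) : Integrable (hat τ) := by
  have := integrable_polyHat 0 τ
  unfold polyHat at this
  simpa using this

lemma memLp_polyHat (N : ℕ) (τ : 𝓓(Ω, ℂ)) : MemLp (polyHat N τ) 2 volume := by
  obtain ⟨C, hC0, hC⟩ := exists_norm_polyHat_le N τ
  rw [memLp_two_iff_integrable_sq_norm (continuous_polyHat N τ).aestronglyMeasurable]
  have hc := continuous_polyHat N τ
  refine (integrable_inv_one_add_norm_sq_sq.const_mul (C ^ 2)).mono'
    (by fun_prop) (Filter.Eventually.of_forall fun ξ => ?_)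
  rw [Real.norm_of_nonneg (by positivity)]
  have h1 : ((1 + ‖ξ‖ ^ 2) ^ 2)⁻¹ ≤ 1 :=
    inv_le_one_of_one_le₀ (one_le_pow₀ (by nlinarith [sq_nonneg ‖ξ‖]))
  have h0 : 0 ≤ ((1 + ‖ξ‖ ^ 2) ^ 2)⁻¹ := by positivity
  calc ‖polyHat N τ ξ‖ ^ 2 ≤ (C * ((1 + ‖ξ‖ ^ 2) ^ 2)⁻¹) ^ 2 := by gcongr; exact hC ξ
    _ = C ^ 2 * (((1 + ‖ξ‖ ^ 2) ^ 2)⁻¹ * ((1 + ‖ξ‖ ^ 2) ^ 2)⁻¹) := by ring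
    _ ≤ C ^ 2 * (((1 + ‖ξ‖ ^ 2) ^ 2)⁻¹ * 1) := by gcongr
    _ = _ := by ring

/-- A linear form bounded by the norm of `J v` in a Hilbert space is represented by a vector of
that space: it descends to the range of `J`, extends by Hahn–Banach, and Riesz applies. -/
lemma exists_inner_of_norm_le {V H : Type*} [AddCommGroup V] [Module ℂ V] [NormedAddCommGroup H]
    [InnerProductSpace ℂ H] [CompleteSpace H] (ℓ : V →ₗ[ℂ] ℂ) (J : V →ₗ[ℂ] H) (C : ℝ)
    (h : ∀ v, ‖ℓ v‖ ≤ C * ‖J v‖) : ∃ x : H, ∀ v, ℓ v = inner ℂ x (J v) := by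
  obtain ⟨s, hs⟩ := J.rangeRestrict.exists_rightInverse_of_surjective J.range_rangeRestrict
  have hker : ∀ v w, J v = J w → ℓ v = ℓ w := fun v w hvw => by
    have h1 := h (v - w)
    rw [map_sub, map_sub, hvw, sub_self, norm_zero, mul_zero] at h1
    exact sub_eq_zero.1 (norm_le_zero_iff.1 h1)
  have hsJ : ∀ x : LinearMap.range J, J (s x) = x := fun x => by
    have := congrArg Subtype.val (LinearMap.congr_fun hs x)
    simpa using this
  set f : StrongDual ℂ (LinearMap.range J) := (ℓ ∘ₗ s).mkContinuous C fun x => by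
    have := h (s x)
    rw [hsJ] at this
    exact this
  obtain ⟨g, hg, -⟩ := exists_extension_norm_eq (LinearMap.range J) f
  refine ⟨(InnerProductSpace.toDual ℂ H).symm g, fun v => ?_⟩
  rw [InnerProductSpace.toDual_symm_apply]
  have h1 := hg ⟨J v, LinearMap.mem_range_self J v⟩
  rw [h1]
  exact hker _ _ (hsJ ⟨J v, LinearMap.mem_range_self J v⟩).symm

/-- Derivatives of a test function are bounded by a weighted `L¹` norm of its Fourier transform.
-/
lemma norm_iteratedFDeriv_test_le (τ : 𝓓(Ω, ℂ)) {N n : ℕ} (hn : n ≤ N) (y : R3) :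
    ‖iteratedFDeriv ℝ n τ y‖ ≤ ((2 * Real.pi) ^ N * (N + 1)) *
      ∫ v, (1 + ‖v‖ ^ 2) ^ N * ‖𝓕 (τ : R3 → ℂ) v‖ := by
  have hτi := integrable_test τ
  have hF : 𝓕 (τ : R3 → ℂ) = fun w => hat τ ((2 * Real.pi) • w) := funext (fourier_eq_hat _)
  have hFc : Continuous (𝓕 (τ : R3 → ℂ)) := by
    rw [hF]; exact (continuous_hat hτi).comp (by fun_prop)
  have hFi : Integrable (𝓕 (τ : R3 → ℂ)) := by
    rw [hF]; exact (integrable_hat_test τ).comp_smul (by positivity)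
  -- The Fourier transform of `𝓕 τ` is the reflection of `τ`, so that a bound for the derivatives of
  -- a Fourier transform applies.
  have hinv : (τ : R3 → ℂ) = fun y => 𝓕 (𝓕 (τ : R3 → ℂ)) (-y) := by
    ext y
    rw [← Real.fourierInv_eq_fourier_neg, τ.continuous.fourierInv_fourier_eq hτi hFi]
  have hFN : Integrable fun v => (1 + ‖v‖ ^ 2) ^ N * ‖𝓕 (τ : R3 → ℂ) v‖ := by
    have h1 : Integrable fun v : R3 => polyHat N τ ((2 * Real.pi) • v) :=
      (integrable_polyHat N τ).comp_smul (by positivity)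
    refine h1.mono (by fun_prop) (Filter.Eventually.of_forall fun v => ?_)
    rw [norm_polyHat, Real.norm_of_nonneg (by positivity), hF]
    gcongr
    rw [norm_smul]
    refine le_mul_of_one_le_left (norm_nonneg _) ?_
    rw [Real.norm_of_nonneg (by positivity)]
    linarith [Real.pi_gt_three]
  have hpow : ∀ i ≤ N, ∀ v : R3, ‖v‖ ^ i ≤ (1 + ‖v‖ ^ 2) ^ N := fun i hi v =>
    calc ‖v‖ ^ i ≤ (1 + ‖v‖ ^ 2) ^ i := by
          gcongr; nlinarith [sq_nonneg (‖v‖ - 1), norm_nonneg v]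
      _ ≤ _ := pow_le_pow_right₀ (le_add_of_nonneg_right (sq_nonneg _)) hi
  have hint : ∀ i ≤ N, Integrable fun v => ‖v‖ ^ i * ‖𝓕 (τ : R3 → ℂ) v‖ := fun i hi =>
    hFN.mono (by fun_prop) (Filter.Eventually.of_forall fun v => by
      rw [Real.norm_of_nonneg (by positivity), Real.norm_of_nonneg (by positivity)]
      gcongr
      exact hpow i hi v)
  have h := Real.pow_mul_norm_iteratedFDeriv_fourier_le (f := 𝓕 (τ : R3 → ℂ)) (K := (N : ℕ∞))
    (N := 0) (contDiff_zero.2 hFc) (fun k n' hk hn' => by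
      have hn0 : n' = 0 := by simpa using hn'
      subst hn0
      simp only [norm_iteratedFDeriv_zero]
      exact hint k (by exact_mod_cast hk)) (k := n) (n := 0) (by exact_mod_cast hn) le_rfl (-y)
  have h2 : ‖iteratedFDeriv ℝ n τ y‖ = ‖iteratedFDeriv ℝ n (𝓕 (𝓕 (τ : R3 → ℂ))) (-y)‖ := by
    conv_lhs => rw [hinv]
    exact (LinearIsometryEquiv.neg ℝ).norm_iteratedFDeriv_comp_right (𝓕 (𝓕 (τ : R3 → ℂ))) y n
  rw [h2]
  simp only [pow_zero, one_mul, mul_one, zero_add, Finset.range_one] at h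
  refine h.trans ?_
  rw [mul_assoc]
  have hpi : 1 ≤ 2 * Real.pi := by linarith [Real.pi_gt_three]
  gcongr
  rw [Finset.sum_product]
  simp only [Finset.sum_singleton, norm_iteratedFDeriv_zero]
  have hI : 0 ≤ ∫ v, (1 + ‖v‖ ^ 2) ^ N * ‖𝓕 (τ : R3 → ℂ) v‖ :=
    integral_nonneg fun v => by positivity
  calc ∑ i ∈ Finset.range (n + 1), ∫ v, ‖v‖ ^ i * ‖𝓕 (τ : R3 → ℂ) v‖
      ≤ ∑ _i ∈ Finset.range (n + 1), ∫ v, (1 + ‖v‖ ^ 2) ^ N * ‖𝓕 (τ : R3 → ℂ) v‖ := by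
        refine Finset.sum_le_sum fun i hi => ?_
        have hi' : i ≤ N := by have := Finset.mem_range.1 hi; omega
        refine integral_mono (hint i hi') hFN fun v => ?_
        exact mul_le_mul_of_nonneg_right (hpow i hi' v) (norm_nonneg _)
    _ = (n + 1) * ∫ v, (1 + ‖v‖ ^ 2) ^ N * ‖𝓕 (τ : R3 → ℂ) v‖ := by simp
    _ ≤ _ := by gcongr

lemma integral_fourier_le_integral_polyHat (τ : 𝓓(Ω, ℂ)) (N : ℕ) :
    ∫ v, (1 + ‖v‖ ^ 2) ^ N * ‖𝓕 (τ : R3 → ℂ) v‖ ≤ ∫ ξ, ‖polyHat N τ ξ‖ := by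
  have h1 : Integrable fun v : R3 => ‖polyHat N τ ((2 * Real.pi) • v)‖ :=
    ((integrable_polyHat N τ).comp_smul (by positivity)).norm
  have h2 : ∫ v : R3, ‖polyHat N τ ((2 * Real.pi) • v)‖ ≤ ∫ ξ, ‖polyHat N τ ξ‖ := by
    rw [Measure.integral_comp_smul volume (fun ξ => ‖polyHat N τ ξ‖) (2 * Real.pi), smul_eq_mul]
    refine mul_le_of_le_one_left (integral_nonneg fun _ => norm_nonneg _) ?_
    rw [abs_of_pos (by positivity)]
    exact inv_le_one_of_one_le₀ (one_le_pow₀ (by linarith [Real.pi_gt_three]))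
  refine le_trans (integral_mono_of_nonneg (Filter.Eventually.of_forall fun v => by positivity) h1
    (Filter.Eventually.of_forall fun v => ?_)) h2
  simp only
  rw [norm_polyHat, fourier_eq_hat]
  gcongr
  rw [norm_smul]
  refine le_mul_of_one_le_left (norm_nonneg _) ?_
  rw [Real.norm_of_nonneg (by positivity)]
  linarith [Real.pi_gt_three]

/-- Cauchy–Schwarz, with `⟨ξ⟩^{-4}` in `L²(ℝ³)`. -/
lemma exists_integral_polyHat_le (N : ℕ) : ∃ A : ℝ, 0 ≤ A ∧ ∀ τ : 𝓓(Ω, ℂ),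
    ∫ ξ, ‖polyHat N τ ξ‖ ≤ A * (eLpNorm (polyHat (N + 2) τ) 2 volume).toReal := by
  set w : R3 → ℝ := fun ξ => ((1 + ‖ξ‖ ^ 2) ^ 2)⁻¹ with hw
  have hwc : Continuous w := by
    simp only [hw]
    exact Continuous.inv₀ (by fun_prop) fun ξ => by positivity
  have hwL : MemLp w 2 volume := by
    rw [memLp_two_iff_integrable_sq_norm hwc.aestronglyMeasurable]
    refine integrable_inv_one_add_norm_sq_sq.mono' (by fun_prop)
      (Filter.Eventually.of_forall fun ξ => ?_)
    have h1 : w ξ ≤ 1 :=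
      inv_le_one_of_one_le₀ (one_le_pow₀ (by nlinarith [sq_nonneg ‖ξ‖]))
    have h0 : 0 ≤ w ξ := by positivity
    rw [Real.norm_of_nonneg (by positivity), Real.norm_of_nonneg h0, sq]
    exact mul_le_of_le_one_left h0 h1
  refine ⟨(eLpNorm w 2 volume).toReal, ENNReal.toReal_nonneg, fun τ => ?_⟩
  have hfun : polyHat N τ = w • polyHat (N + 2) τ := by
    ext ξ
    simp only [Pi.smul_apply', hw, polyHat, Complex.real_smul]
    have : ((1 : ℂ) + (‖ξ‖ : ℂ) ^ 2) ≠ 0 := by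
      have : (1 + ‖ξ‖ ^ 2 : ℝ) ≠ 0 := by positivity
      exact_mod_cast this
    push_cast
    field_simp
    ring
  have h := eLpNorm_smul_le_mul_eLpNorm (p := 2) (q := 2) (r := 1) (μ := (volume : Measure R3))
    (memLp_polyHat (N + 2) τ).1 hwL.1
  rw [← hfun] at h
  rw [integral_norm_eq_lintegral_enorm (continuous_polyHat N τ).aestronglyMeasurable,
    ← eLpNorm_one_eq_lintegral_enorm, ← ENNReal.toReal_mul]
  exact ENNReal.toReal_mono (ENNReal.mul_ne_top hwL.2.ne (memLp_polyHat (N + 2) τ).2.ne) h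

lemma polyHat_add (N : ℕ) (τ τ' : 𝓓(Ω, ℂ)) :
    polyHat N (τ + τ' : 𝓓(Ω, ℂ)) = polyHat N τ + polyHat N τ' := by
  ext ξ
  have : ((τ + τ' : 𝓓(Ω, ℂ)) : R3 → ℂ) = fun y => τ y + τ' y := by ext y; simp
  simp only [polyHat, Pi.add_apply]
  rw [this, hat_add (integrable_test τ) (integrable_test τ')]
  ring

lemma polyHat_smul (N : ℕ) (c : ℂ) (τ : 𝓓(Ω, ℂ)) :
    polyHat N (c • τ : 𝓓(Ω, ℂ)) = c • polyHat N τ := by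
  ext ξ
  have : ((c • τ : 𝓓(Ω, ℂ)) : R3 → ℂ) = fun y => c * τ y := by ext y; simp
  simp only [polyHat, Pi.smul_apply, smul_eq_mul]
  rw [this]
  have : hat (fun y => c * τ y) ξ = c * hat τ ξ := by
    unfold hat
    rw [← integral_const_mul]
    congr 1; ext y; ring
  rw [this]
  ring

/-- A localized distribution acts on test functions through an `L²` density on the Fourier side:
finite order bounds it by a Sobolev norm, and Riesz gives the density. This replaces the theory of
Fourier transforms of compactly supported distributions. -/
lemma exists_fourier_density (u : CDistribution Ω) (χ : 𝓓(Ω, ℂ)) :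
    ∃ (N : ℕ) (h : R3 → ℂ), MemLp h 2 volume ∧
      ∀ τ : 𝓓(Ω, ℂ), u (testMul τ χ) = ∫ ξ, h ξ * polyHat N τ ξ := by
  obtain ⟨N, C, hC0, hC⟩ := exists_norm_apply_testMul_le u χ
  obtain ⟨A, hA0, hA⟩ := exists_integral_polyHat_le (Ω := Ω) N
  set ℓ : 𝓓(Ω, ℂ) →ₗ[ℂ] ℂ :=
    { toFun := fun τ => u (testMul τ χ)
      map_add' := fun τ τ' => by
        rw [← map_add]; congr 1; ext y
        simp [testMul, mulTest_apply, add_mul]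
      map_smul' := fun c τ => by
        rw [← map_smul]; congr 1; ext y
        simp [testMul, mulTest_apply, mul_assoc] }
  set J : 𝓓(Ω, ℂ) →ₗ[ℂ] Lp ℂ 2 (volume : Measure R3) :=
    { toFun := fun τ => (memLp_polyHat (N + 2) τ).toLp
      map_add' := fun τ τ' => by
        rw [← MemLp.toLp_add, MemLp.toLp_eq_toLp_iff, polyHat_add]
      map_smul' := fun c τ => by
        rw [RingHom.id_apply, ← MemLp.toLp_const_smul, MemLp.toLp_eq_toLp_iff, polyHat_smul] }
  obtain ⟨x, hx⟩ := exists_inner_of_norm_le ℓ J (C * ((2 * Real.pi) ^ N * (N + 1)) * A) fun τ => by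
    change ‖u (testMul τ χ)‖ ≤ _ * ‖(memLp_polyHat (N + 2) τ).toLp‖
    rw [Lp.norm_toLp]
    refine (hC τ _ fun n hn y => norm_iteratedFDeriv_test_le τ hn y).trans ?_
    rw [mul_assoc C, mul_assoc C, mul_assoc _ A]
    refine mul_le_mul_of_nonneg_left (mul_le_mul_of_nonneg_left ?_ (by positivity)) hC0
    exact (integral_fourier_le_integral_polyHat τ N).trans (hA τ)
  refine ⟨N + 2, fun ξ => starRingEnd ℂ (x ξ), (Lp.memLp x).star, fun τ => ?_⟩
  have h1 : u (testMul τ χ) = inner ℂ x (J τ) := hx τ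
  rw [h1, L2.inner_def]
  refine integral_congr_ae ?_
  filter_upwards [(memLp_polyHat (N + 2) τ).coeFn_toLp] with ξ hξ
  change inner ℂ (x ξ) (MemLp.toLp _ (memLp_polyHat (N + 2) τ) ξ) = _
  rw [hξ]
  simp [mul_comm]

/-! ### Localizations of a distribution and Fourier inversion -/

lemma hat_expChar_mul (f : R3 → ℂ) (a ξ : R3) :
    hat (fun y => expChar (-a) y * f y) ξ = hat f (ξ - a) := by
  unfold hat
  congr 1; ext y
  rw [sub_eq_add_neg, expChar_add]; ring

lemma one_add_norm_sq_le (ξ a : R3) : 1 + ‖ξ‖ ^ 2 ≤ 2 * ((1 + ‖a‖ ^ 2) * (1 + ‖ξ - a‖ ^ 2)) := by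
  have h : ‖ξ‖ ≤ ‖a‖ + ‖ξ - a‖ := by simpa using norm_add_le a (ξ - a)
  have h2 : ‖ξ‖ ^ 2 ≤ (‖a‖ + ‖ξ - a‖) ^ 2 := by gcongr
  nlinarith [sq_nonneg (‖a‖ - ‖ξ - a‖), sq_nonneg (‖a‖ * ‖ξ - a‖)]

/-- The integrability needed to exchange the density `h` with a convolution: Peetre's inequality
splits the weight between the two factors, and `2 x y ≤ x² + y²` reduces to integrable products. -/
lemma integrable_density_prod {N : ℕ} {h : R3 → ℂ} (hh : MemLp h 2 volume) (φ ψ : 𝓓(Ω, ℂ)) :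
    Integrable (fun p : R3 × R3 => h p.1 * ((((1 + ‖p.1‖ ^ 2) ^ N : ℝ) : ℂ) *
      (hat φ p.2 * hat ψ (p.1 - p.2)))) (volume.prod volume) := by
  have hD := (integrable_polyHat N φ).norm
  have hh2 : Integrable fun ξ => ‖h ξ‖ ^ 2 := (memLp_two_iff_integrable_sq_norm hh.1).1 hh
  have hB2 : Integrable fun ξ => ‖polyHat N ψ ξ‖ ^ 2 :=
    (memLp_two_iff_integrable_sq_norm (memLp_polyHat N ψ).1).1 (memLp_polyHat N ψ)
  have i1 : Integrable (fun p : R3 × R3 => ‖h p.1‖ ^ 2 * ‖polyHat N φ p.2‖) (volume.prod volume) :=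
    hh2.mul_prod hD
  have i2 : Integrable (fun p : R3 × R3 => ‖polyHat N φ p.2‖ * ‖polyHat N ψ (p.1 - p.2)‖ ^ 2)
      (volume.prod volume) :=
    Integrable.convolution_integrand (ContinuousLinearMap.mul ℝ ℝ) hD hB2
  have hφc := continuous_hat (integrable_test φ)
  have hψc := continuous_hat (integrable_test ψ)
  refine ((i1.add i2).const_mul (2 ^ N)).mono' ?_ (Filter.Eventually.of_forall fun p => ?_)
  · refine hh.1.comp_fst.mul (Continuous.aestronglyMeasurable ?_)
    fun_prop
  · obtain ⟨ξ, a⟩ := p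
    simp only [Pi.add_apply, norm_mul, Complex.norm_real, norm_polyHat]
    rw [Real.norm_of_nonneg (by positivity)]
    have hW : (1 + ‖ξ‖ ^ 2) ^ N ≤ 2 ^ N * ((1 + ‖a‖ ^ 2) ^ N * (1 + ‖ξ - a‖ ^ 2) ^ N) := by
      rw [← mul_pow, ← mul_pow]
      gcongr
      exact one_add_norm_sq_le ξ a
    set D := (1 + ‖a‖ ^ 2) ^ N * ‖hat φ a‖
    set B := (1 + ‖ξ - a‖ ^ 2) ^ N * ‖hat ψ (ξ - a)‖
    have hD0 : 0 ≤ D := by positivity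
    have hB0 : 0 ≤ B := by positivity
    calc ‖h ξ‖ * ((1 + ‖ξ‖ ^ 2) ^ N * (‖hat φ a‖ * ‖hat ψ (ξ - a)‖))
        ≤ ‖h ξ‖ * ((2 ^ N * ((1 + ‖a‖ ^ 2) ^ N * (1 + ‖ξ - a‖ ^ 2) ^ N)) *
            (‖hat φ a‖ * ‖hat ψ (ξ - a)‖)) := by gcongr
      _ = 2 ^ N * (D * (‖h ξ‖ * B)) := by simp only [D, B]; ring
      _ ≤ 2 ^ N * (D * (‖h ξ‖ ^ 2 + B ^ 2)) := by
          gcongr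
          nlinarith [sq_nonneg (‖h ξ‖ - B), norm_nonneg (h ξ), mul_nonneg (norm_nonneg (h ξ)) hB0]
      _ = _ := by ring

/-- Parseval's formula `⟨χ u, φ⟩ = (2π)⁻³ ∫ φ̂(a) (χ u)^(-a) da`. -/
lemma apply_testMul_eq_integral_hat (u : CDistribution Ω) (χ φ : 𝓓(Ω, ℂ)) :
    u (testMul φ χ) = (((2 * Real.pi)⁻¹ ^ 3 : ℝ) : ℂ) * ∫ a, hat φ a * fourierLoc u χ (-a) := by
  obtain ⟨N, h, hh, hrep⟩ := exists_fourier_density u χ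
  -- Inserting `ψ = 1` on the support of `χ` makes the convolution of `φ̂` and `ψ̂` appear, and thus
  -- the functions `ψ e^{i y·a}`, to which `χ u` can be applied since they are test functions.
  obtain ⟨ψ, hψ⟩ := exists_test_eq_one χ.hasCompactSupport.isCompact χ.tsupport_subset
  have hψχ : ∀ y, ψ y * χ y = χ y := fun y => by
    by_cases hy : y ∈ tsupport χ
    · rw [hψ y hy, one_mul]
    · rw [image_eq_zero_of_notMem_tsupport hy, mul_zero]
  have e1 : testMul φ χ = testMul (testMul ψ φ) χ := by
    ext y
    change φ y * χ y = (ψ y * φ y) * χ y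
    linear_combination (-φ y) * hψχ y
  have e2 : ∀ a, testMul (expTest (-a) ψ) χ = expTest (-a) χ := fun a => by
    ext y
    change (expChar (-a) y * ψ y) * χ y = expChar (-a) y * χ y
    linear_combination expChar (-a) y * hψχ y
  have hmul : ∀ ξ, hat (testMul ψ φ) ξ = (((2 * Real.pi)⁻¹ ^ 3 : ℝ) : ℂ) *
      ∫ a, hat φ a * hat ψ (ξ - a) := fun ξ =>
    hat_mul (integrable_test ψ) φ.continuous
      (integrable_test φ) (integrable_hat_test φ) ξ
  rw [e1, hrep]
  have e3 : ∀ ξ, h ξ * polyHat N (testMul ψ φ) ξ = (((2 * Real.pi)⁻¹ ^ 3 : ℝ) : ℂ) *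
      ∫ a, h ξ * ((((1 + ‖ξ‖ ^ 2) ^ N : ℝ) : ℂ) * (hat φ a * hat ψ (ξ - a))) := fun ξ => by
    rw [integral_const_mul, integral_const_mul, polyHat, hmul]; ring
  simp_rw [e3]
  rw [integral_const_mul, integral_integral_swap (integrable_density_prod hh φ ψ)]
  congr 2; ext a
  have e4 : fourierLoc u χ (-a) = ∫ ξ, h ξ * polyHat N (expTest (-a) ψ) ξ := by
    rw [← hrep, e2, fourierLoc]
  rw [e4, ← integral_const_mul]
  congr 1; ext ξ
  rw [polyHat]
  have : hat (expTest (-a) ψ) ξ = hat ψ (ξ - a) := hat_expChar_mul ψ a ξ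
  rw [this]; ring

/-- The multiplication formula for the Fourier transform. -/
lemma integral_hat_mul {f g : R3 → ℂ} (hf : Integrable f) (hg : Integrable g) :
    ∫ a, hat f a * g a = ∫ y, f y * hat g y := by
  have e1 : ∀ a, hat f a * g a = ∫ y, expChar a y * (g a * f y) := fun a => by
    rw [hat, ← integral_mul_const]
    congr 1; ext y; ring
  simp_rw [e1]
  rw [integral_integral_swap]
  · congr 1; ext y
    rw [hat, ← integral_const_mul]
    congr 1; ext a
    have : expChar a y = expChar y a := by unfold expChar; rw [real_inner_comm]
    rw [this]; ring
  · have hfg : Integrable (fun p : R3 × R3 => g p.1 * f p.2) (volume.prod volume) := hg.mul_prod hf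
    refine hfg.mono (continuous_expChar_uncurry.aestronglyMeasurable.mul hfg.1)
      (Filter.Eventually.of_forall fun p => ?_)
    simp only [Function.uncurry_def]
    rw [norm_mul, norm_expChar, one_mul]

/-- The inverse Fourier transform of `fourierLoc u χ`, which is the localization `χ u` as a
function when `fourierLoc u χ` is integrable. -/
def locFun (u : CDistribution Ω) (χ : 𝓓(Ω, ℂ)) (y : R3) : ℂ :=
  (((2 * Real.pi)⁻¹ ^ 3 : ℝ) : ℂ) * hat (fun a => fourierLoc u χ (-a)) y

lemma continuous_locFun {u : CDistribution Ω} {χ : 𝓓(Ω, ℂ)} (h : Integrable (fourierLoc u χ)) :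
    Continuous (locFun u χ) :=
  continuous_const.mul (continuous_hat h.comp_neg)

lemma apply_testMul_eq_integral_locFun {u : CDistribution Ω} {χ : 𝓓(Ω, ℂ)}
    (h : Integrable (fourierLoc u χ)) (φ : 𝓓(Ω, ℂ)) :
    u (testMul φ χ) = ∫ y, φ y * locFun u χ y := by
  rw [apply_testMul_eq_integral_hat, integral_hat_mul (integrable_test φ) h.comp_neg,
    ← integral_const_mul]
  congr 1; ext y
  rw [locFun]; ring

lemma eq_of_integral_test_mul_eq {f g : R3 → ℂ} (hf : Continuous f) (hg : Continuous g)
    (h : ∀ φ : 𝓓(Ω, ℂ), ∫ y, φ y * f y = ∫ y, φ y * g y) {y : R3} (hy : y ∈ Ω) : f y = g y := by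
  have hd : ContinuousOn (fun y => f y - g y) (Ω : Set R3) := (hf.sub hg).continuousOn
  have h0 : ∀ᵐ y ∂volume, y ∈ (Ω : Set R3) → f y - g y = 0 := by
    refine Ω.isOpen.ae_eq_zero_of_integral_contDiff_smul_eq_zero
      (hd.locallyIntegrableOn Ω.isOpen.measurableSet) fun ρ hρ hs hsub => ?_
    set φ : 𝓓(Ω, ℂ) := ⟨fun y => (ρ y : ℂ), Complex.ofRealCLM.contDiff.comp hρ,
      hs.comp_left Complex.ofReal_zero,
      (closure_mono fun y hy => by
        simpa using hy).trans hsub⟩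
    have h1 := h φ
    have h2 : ∫ y, ρ y • (f y - g y) = (∫ y, φ y * f y) - ∫ y, φ y * g y := by
      rw [← integral_sub (integrable_test_mul φ hf.continuousOn)
        (integrable_test_mul φ hg.continuousOn)]
      congr 1; ext y
      change _ = (ρ y : ℂ) * f y - (ρ y : ℂ) * g y
      rw [Complex.real_smul]; ring
    rw [h2, h1, sub_self]
  have h3 : (fun y => f y - g y) =ᵐ[volume.restrict (Ω : Set R3)] fun _ => 0 :=
    (ae_restrict_iff' Ω.isOpen.measurableSet).2 h0
  exact sub_eq_zero.1 (Measure.eqOn_open_of_ae_eq h3 Ω.isOpen hd continuousOn_const hy)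

/-- Compatibility of the localizations, both sides being `χ χ' u`. It allows dividing by the
cut-off. -/
lemma mul_locFun_comm {u : CDistribution Ω} (h : ∀ χ, Integrable (fourierLoc u χ))
    (χ χ' : 𝓓(Ω, ℂ)) {y : R3} (hy : y ∈ Ω) : χ' y * locFun u χ y = χ y * locFun u χ' y := by
  refine eq_of_integral_test_mul_eq (f := fun y => χ' y * locFun u χ y)
    (g := fun y => χ y * locFun u χ' y) (χ'.continuous.mul (continuous_locFun (h χ)))
    (χ.continuous.mul (continuous_locFun (h χ'))) (fun φ => ?_) hy
  have e1 := apply_testMul_eq_integral_locFun (h χ) (testMul φ χ')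
  have e2 := apply_testMul_eq_integral_locFun (h χ') (testMul φ χ)
  have e3 : testMul (testMul φ χ') χ = testMul (testMul φ χ) χ' := by
    ext y
    change (φ y * χ' y) * χ y = (φ y * χ y) * χ' y
    ring
  rw [e3, e2] at e1
  calc _ = ∫ y, testMul φ χ' y * locFun u χ y := by
        congr 1; ext y
        change φ y * (χ' y * locFun u χ y) = (φ y * χ' y) * locFun u χ y
        ring
    _ = ∫ y, testMul φ χ y * locFun u χ' y := e1.symm
    _ = _ := by
        congr 1; ext y
        change (φ y * χ y) * locFun u χ' y = φ y * (χ y * locFun u χ' y)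
        ring

/-- A distribution all of whose localizations have an integrable Fourier transform is a continuous
function: near each point the localization is divided by a cut-off. -/
lemma exists_continuousOn_represents {u : CDistribution Ω} (h : ∀ χ, Integrable (fourierLoc u χ)) :
    ∃ f : R3 → ℂ, ContinuousOn f (Ω : Set R3) ∧ Represents Ω f u := by
  classical
  have hex : ∀ y ∈ (Ω : Set R3), ∃ ψ : 𝓓(Ω, ℂ), ψ y = 1 := fun y hy => by
    obtain ⟨ψ, hψ⟩ := exists_test_eq_one (isCompact_singleton (x := y))
        (Set.singleton_subset_iff.2 hy)
    exact ⟨ψ, hψ y rfl⟩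
  choose ψ hψ using hex
  set f : R3 → ℂ := fun y => if hy : y ∈ (Ω : Set R3) then locFun u (ψ y hy) y else 0 with hf
  have hloc : ∀ (χ : 𝓓(Ω, ℂ)), ∀ y ∈ Ω, locFun u χ y = χ y * f y := fun χ y hy => by
    have h1 := mul_locFun_comm h χ (ψ y hy) hy
    rw [hψ, one_mul] at h1
    rw [h1, hf]
    simp only [SetLike.mem_coe]
    rw [dif_pos hy]
  have hcont : ContinuousOn f (Ω : Set R3) := fun y hy => by
    refine ContinuousAt.continuousWithinAt ?_
    have h1 : ContinuousAt (fun z => locFun u (ψ y hy) z / ψ y hy z) y :=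
      (continuous_locFun (h _)).continuousAt.div (ψ y hy).continuous.continuousAt
        (by rw [hψ]; exact one_ne_zero)
    refine h1.congr ?_
    have h2 : ∀ᶠ z in nhds y, ψ y hy z ≠ 0 :=
      (ψ y hy).continuous.continuousAt.eventually_ne (by rw [hψ]; exact one_ne_zero)
    filter_upwards [h2, Ω.isOpen.mem_nhds hy] with z hz hzΩ
    rw [hloc _ z hzΩ, mul_div_cancel_left₀ _ hz]
  refine ⟨f, hcont, hcont.locallyIntegrableOn Ω.isOpen.measurableSet, fun φ => ?_⟩
  obtain ⟨χ, hχ⟩ := exists_test_eq_one φ.hasCompactSupport.isCompact φ.tsupport_subset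
  have e1 : testMul φ χ = φ := by
    ext y
    change φ y * χ y = φ y
    by_cases hy : y ∈ tsupport φ
    · rw [hχ y hy, mul_one]
    · rw [image_eq_zero_of_notMem_tsupport hy, zero_mul]
  have e2 := apply_testMul_eq_integral_locFun (h χ) φ
  rw [e1] at e2
  rw [e2]
  congr 1; ext y
  by_cases hy : y ∈ tsupport φ
  · rw [hloc χ y (φ.tsupport_subset hy), hχ y hy]; ring
  · rw [image_eq_zero_of_notMem_tsupport hy]; ring

lemma half_lt_conormalIndex {k : ℝ} (hk : 1 / 2 < k) (j i : Fin 3) :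
    ((1 / 2 : ℝ) : WithTop ℝ) < conormalIndex j k i := by
  unfold conormalIndex
  split_ifs
  · exact WithTop.coe_lt_coe.2 hk
  · exact WithTop.coe_lt_top _

/-- A conormal distribution of sufficiently negative order is a continuous function. -/
lemma IsConormal.exists_bealsFun {j : Fin 3} {M : ℝ} {u : CDistribution Ω}
    (hu : IsConormal Ω j M u) (hM : 1 / 2 < -M - 3 / 4) :
    ∃ f : R3 → ℂ, BealsFun Ω (conormalIndex j (-M - 3 / 4)) f ∧ Represents Ω f u := by
  obtain ⟨f, hf, hr⟩ := exists_continuousOn_represents fun χ =>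
    (hu.hasWeight χ).integrable (half_lt_conormalIndex hM j)
  refine ⟨f, ⟨hf, fun χ => ?_⟩, hr⟩
  have : (hat fun y => χ y * f y) = fourierLoc u χ :=
    funext fun η => (fourierLoc_eq_hat hr χ η).symm
  rw [this]
  exact hu.hasWeight χ

/-! ### Products of conormal functions on transversal hypersurfaces -/

/-- The properties of a conormal function with symbol of order `-k - 1/2` that the product
formulas use: `f` has index `k` in the direction `j` and index `∞` in the other two, and
multiplication by the defining function `y j` gains one order. -/
structure IsConormalFun (Ω : Opens R3) (j : Fin 3) (k : ℝ) (f : R3 → ℂ) : Prop where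
  bealsFun : BealsFun Ω (conormalIndex j k) f
  coord_mul : BealsFun Ω (conormalIndex j (k + 1)) (fun y => (y j : ℂ) * f y)

lemma contDiff_coord (j : Fin 3) : ContDiff ℝ ∞ fun y : R3 => ((y j : ℝ) : ℂ) :=
  Complex.ofRealCLM.contDiff.comp (EuclideanSpace.proj (𝕜 := ℝ) (ι := Fin 3) j).contDiff

lemma conormalIndex_mono (j : Fin 3) {k l : ℝ} (h : k ≤ l) (i : Fin 3) :
    conormalIndex j k i ≤ conormalIndex j l i := by
  unfold conormalIndex
  split_ifs
  · exact WithTop.coe_le_coe.2 h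
  · exact le_rfl

lemma conormalIndex_pos {k : ℝ} (hk : 0 < k) (j i : Fin 3) : 0 < conormalIndex j k i := by
  unfold conormalIndex
  split_ifs
  · exact WithTop.coe_lt_coe.2 hk
  · exact WithTop.coe_lt_top _

lemma min_conormalIndex_zero_one (p q : ℝ) :
    (fun i => min (conormalIndex 0 p i) (conormalIndex 1 q i)) = ![(p : WithTop ℝ), q, ⊤] := by
  funext i
  fin_cases i <;> simp [conormalIndex]

lemma min_conormalIndex_zero_two (p q : ℝ) :
    (fun i => min (conormalIndex 0 p i) (conormalIndex 2 q i)) = ![(p : WithTop ℝ), ⊤, q] := by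
  funext i
  fin_cases i <;> simp [conormalIndex]

lemma min_conormalIndex_one_two (p q : ℝ) :
    (fun i => min (conormalIndex 1 p i) (conormalIndex 2 q i)) = ![⊤, (p : WithTop ℝ), q] := by
  funext i
  fin_cases i <;> simp [conormalIndex]

lemma vec_three_pos {p q r : ℝ} (hp : 0 < p) (hq : 0 < q) (hr : 0 < r) (i : Fin 3) :
    0 < ![(p : WithTop ℝ), q, r] i := by
  fin_cases i <;> simpa

lemma IsConormalFun.add {j : Fin 3} {k : ℝ} {f ρ : R3 → ℂ} (hf : IsConormalFun Ω j k f)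
    (hρ : BealsFun Ω (conormalIndex j (k + 1)) ρ) : IsConormalFun Ω j k (fun y => f y + ρ y) := by
  refine ⟨hf.1.add (hρ.mono (conormalIndex_mono j (by linarith))), ?_⟩
  simp_rw [mul_add]
  exact hf.2.add (hρ.smooth_mul (contDiff_coord j))

lemma IsSymbol.isConormalFun_osc {m : ℝ} {a : ℝ × ℝ × ℝ → ℂ} (ha : IsSymbol m a) (hm : m < -1)
    (j : Fin 3) {c d : ℝ} (hc : |c| ≤ 1) (hd : |d| ≤ 1) :
    IsConormalFun Ω j (-m - 1 / 2) (osc j a c d) := by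
  refine ⟨bealsFun_osc ha.isAmplitude hm j hc hd, ?_⟩
  simp_rw [coord_mul_osc ha.isAmplitude hm ha.isAmplitude_partialD_freq]
  have h := bealsFun_osc (Ω := Ω) ha.isAmplitude_partialD_freq (by linarith) j hc hd
  rw [show -(m - 1) - 1 / 2 = -m - 1 / 2 + 1 by ring] at h
  exact h.smooth_mul contDiff_const

lemma Represents.add {f g : R3 → ℂ} {u v : CDistribution Ω} (hf : ContinuousOn f (Ω : Set R3))
    (hg : ContinuousOn g (Ω : Set R3)) (hu : Represents Ω f u) (hv : Represents Ω g v) :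
    Represents Ω (fun y => f y + g y) (u + v) := by
  refine ⟨hu.1.add hv.1, fun φ => ?_⟩
  change u φ + v φ = _
  rw [hu.2, hv.2, ← integral_add]
  · simp_rw [add_mul]
  · simpa only [mul_comm] using integrable_test_mul φ hf
  · simpa only [mul_comm] using integrable_test_mul φ hg

/-- A distribution with principal symbol of order `m < -1` is a continuous function, equal to the
oscillatory integral of its symbol up to a function which is one order better. -/
lemma IsPrincipalSymbol.exists_function {j : Fin 3} {m : ℝ} (hm : m < -1) {a : ℝ × ℝ × ℝ → ℂ}
    {u : CDistribution Ω} (h : IsPrincipalSymbol Ω j (m - 3 / 4 + 1 / 2) a u) :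
    ∃ ρ : R3 → ℂ, BealsFun Ω (conormalIndex j (-m - 1 / 2 + 1)) ρ ∧
      Represents Ω (fun y => osc j a 1 1 y + ρ y) u := by
  obtain ⟨ha, r, hr, hur⟩ := h
  rw [show m - 3 / 4 + 1 / 2 + 1 / 4 = m by ring] at ha
  obtain ⟨ρ, hρ, hρr⟩ := hr.exists_bealsFun (by linarith)
  rw [show -(m - 3 / 4 + 1 / 2 - 1) - 3 / 4 = -m - 1 / 2 + 1 by ring] at hρ
  refine ⟨ρ, hρ, ?_⟩
  have hc := (continuous_osc ha.isAmplitude hm j 1 1).continuousOn (s := (Ω : Set R3))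
  have hrep := (represents_ofContinuousOn hc).add hc hρ.1 hρr
  refine ⟨hrep.1, fun φ => ?_⟩
  rw [← hrep.2, hur, oscPairing_eq ha.isAmplitude hm, ← (represents_ofContinuousOn hc).2]
  rfl

lemma BealsFun.mul_of_ne {j k : Fin 3} (hjk : j ≠ k) {p q : ℝ} (hp : 1 / 2 < p) {f g : R3 → ℂ}
    (hf : BealsFun Ω (conormalIndex j p) f) (hg : BealsFun Ω (conormalIndex k q) g) :
    BealsFun Ω (fun i => min (conormalIndex j p i) (conormalIndex k q i))
      (fun y => f y * g y) := by
  refine hf.mul hg (half_lt_conormalIndex hp j) fun i => ?_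
  unfold conormalIndex
  by_cases h : i = j
  · right; rw [if_neg (fun h' => hjk (h ▸ h'))]
  · left; rw [if_neg h]

lemma BealsFun.mul_three {p q r : ℝ} (hp : 1 / 2 < p) (hq : 1 / 2 < q) {f g h : R3 → ℂ}
    (hf : BealsFun Ω (conormalIndex 0 p) f) (hg : BealsFun Ω (conormalIndex 1 q) g)
    (hh : BealsFun Ω (conormalIndex 2 r) h) :
    BealsFun Ω ![(p : WithTop ℝ), q, r] (fun y => f y * g y * h y) := by
  refine ((hf.mul_of_ne (by decide) hp hg).mul hh (fun i => lt_min
    (half_lt_conormalIndex hp 0 i) (half_lt_conormalIndex hq 1 i)) fun i => ?_).mono fun i => ?_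
  · fin_cases i <;> simp [conormalIndex]
  · fin_cases i <;> simp [conormalIndex]

/-- Comparison of the product of `f = g + ρ + y_k B`, conormal to `{y j = 0}`, and
`f' = g' + ρ' + y_j B'`, conormal to `{y k = 0}`, with the product `g g'` of the leading parts. The coordinate in
each Taylor remainder is absorbed by the other factor, where it gains an order. -/
lemma exists_bealsFun_mul_sub_mul {j k : Fin 3} (hjk : j ≠ k) {κ : ℝ} (hκ : 1 / 2 < κ)
    {f g ρ B f' g' ρ' B' : R3 → ℂ}
    (hg : IsConormalFun Ω j κ g) (hρ : BealsFun Ω (conormalIndex j (κ + 1)) ρ)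
    (hB : BealsFun Ω (conormalIndex j κ) B)
    (hf' : IsConormalFun Ω k κ f') (hρ' : BealsFun Ω (conormalIndex k (κ + 1)) ρ')
    (hB' : BealsFun Ω (conormalIndex k κ) B')
    (hfe : ∀ y, f y = g y + ρ y + y k * B y) (hfe' : ∀ y, f' y = g' y + ρ' y + y j * B' y) :
    ∃ E₁ E₂ : R3 → ℂ,
      BealsFun Ω (fun i => min (conormalIndex j (κ + 1) i) (conormalIndex k κ i)) E₁ ∧
      BealsFun Ω (fun i => min (conormalIndex j κ i) (conormalIndex k (κ + 1) i)) E₂ ∧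
      ∀ y, f y * f' y - g y * g' y = E₁ y + E₂ y := by
  have hκ' : 1 / 2 < κ + 1 := by linarith
  refine ⟨_, _, (hρ.mul_of_ne hjk hκ' hf'.1).add (hg.2.mul_of_ne hjk hκ' hB'),
    (hB.mul_of_ne hjk hκ hf'.2).add (hg.1.mul_of_ne hjk hκ hρ'), fun y => ?_⟩
  linear_combination f' y * hfe y + g y * hfe' y

lemma exists_mem_bealsMinus_add {k l : Fin 3 → WithTop ℝ} (hk : ∀ i, 0 < k i) (hl : ∀ i, 0 < l i)
    {E₁ E₂ : R3 → ℂ} (h₁ : BealsFun Ω k E₁) (h₂ : BealsFun Ω l E₂) :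
    ∃ E ∈ BealsMinus Ω 0 k + BealsMinus Ω 0 l, Represents Ω (fun y => E₁ y + E₂ y) E :=
  ⟨_, Set.add_mem_add (h₁.mem_bealsMinus hk) (h₂.mem_bealsMinus hl),
    (represents_ofContinuousOn h₁.1).add h₁.1 h₂.1 (represents_ofContinuousOn h₂.1)⟩

lemma exists_mem_bealsMinus_add_add {k l n : Fin 3 → WithTop ℝ} (hk : ∀ i, 0 < k i)
    (hl : ∀ i, 0 < l i) (hn : ∀ i, 0 < n i) {E₁ E₂ E₃ : R3 → ℂ} (h₁ : BealsFun Ω k E₁)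
    (h₂ : BealsFun Ω l E₂) (h₃ : BealsFun Ω n E₃) :
    ∃ E ∈ BealsMinus Ω 0 k + BealsMinus Ω 0 l + BealsMinus Ω 0 n,
      Represents Ω (fun y => E₁ y + E₂ y + E₃ y) E := by
  obtain ⟨E, hE, hr⟩ := exists_mem_bealsMinus_add hk hl h₁ h₂
  exact ⟨_, Set.add_mem_add hE (h₃.mem_bealsMinus hn),
    hr.add (h₁.1.add h₂.1) h₃.1 (represents_ofContinuousOn h₃.1)⟩

/-! ### Taylor expansion of the factors and their multiple oscillatory integrals -/

/-- The first-order Taylor remainder of `osc j a 1 d` at `y (j.succAbove 0) = 0`, divided by that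
coordinate. -/
def taylorFst (j : Fin 3) (a : ℝ × ℝ × ℝ → ℂ) (d : ℝ) (y : R3) : ℂ :=
  ∫ θ in (0 : ℝ)..1, osc j (partialD (0, 1, 0) a) θ d y

/-- The first-order Taylor remainder of `osc j a c 1` at `y (j.succAbove 1) = 0`, divided by that
coordinate. -/
def taylorSnd (j : Fin 3) (a : ℝ × ℝ × ℝ → ℂ) (c : ℝ) (y : R3) : ℂ :=
  ∫ θ in (0 : ℝ)..1, osc j (partialD (0, 0, 1) a) c θ y

section Taylor

variable {m : ℝ} {a : ℝ × ℝ × ℝ → ℂ}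

lemma bealsFun_taylorFst (ha : IsAmplitude m a) (hm : m < -1) (j : Fin 3) {d : ℝ}
    (hd : |d| ≤ 1) : BealsFun Ω (conormalIndex j (-m - 1 / 2)) (taylorFst j a d) :=
  bealsFun_integral_osc (ha.partialD (1, 0)) hm j continuous_id continuous_const
    (fun _ hθ => abs_le.2 ⟨by linarith [hθ.1], hθ.2⟩) fun _ _ => hd

lemma bealsFun_taylorSnd (ha : IsAmplitude m a) (hm : m < -1) (j : Fin 3) {c : ℝ}
    (hc : |c| ≤ 1) : BealsFun Ω (conormalIndex j (-m - 1 / 2)) (taylorSnd j a c) :=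
  bealsFun_integral_osc (ha.partialD (0, 1)) hm j continuous_const continuous_id
    (fun _ _ => hc) fun _ hθ => abs_le.2 ⟨by linarith [hθ.1], hθ.2⟩

lemma osc_eq_add_taylorFst (ha : IsAmplitude m a) (hm : m < -1) (j : Fin 3) (d : ℝ) (y : R3) :
    osc j a 1 d y = osc j a 0 d y + y (j.succAbove 0) * taylorFst j a d y := by
  rw [taylorFst, ← osc_sub_osc_fst ha hm]
  ring

lemma osc_eq_add_taylorSnd (ha : IsAmplitude m a) (hm : m < -1) (j : Fin 3) (c : ℝ) (y : R3) :
    osc j a c 1 y = osc j a c 0 y + y (j.succAbove 1) * taylorSnd j a c y := by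
  rw [taylorSnd, ← osc_sub_osc_snd ha hm]
  ring

end Taylor

lemma oscTwo_eq_mul (j k : Fin 3) (y : R3) (b c : ℝ → ℂ) :
    oscTwo j k y b c = fun p : ℝ × ℝ => (Complex.exp (Complex.I * ((y j * p.1 : ℝ) : ℂ)) * b p.1) *
      (Complex.exp (Complex.I * ((y k * p.2 : ℝ) : ℂ)) * c p.2) := by
  ext p
  rw [oscTwo, Complex.ofReal_add, mul_add, Complex.exp_add]
  ring

lemma oscThree_eq_mul (y : R3) (b c d : ℝ → ℂ) :
    oscThree y b c d = fun p : ℝ × ℝ × ℝ =>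
      (Complex.exp (Complex.I * ((y 0 * p.1 : ℝ) : ℂ)) * b p.1) * oscTwo 1 2 y c d p.2 := by
  ext p
  rw [oscThree, oscTwo, add_assoc, Complex.ofReal_add, mul_add, Complex.exp_add]
  ring

section MultipleIntegral

variable {j k : Fin 3} {y : R3} {b c d : ℝ → ℂ}

lemma integrable_oscTwo
    (hb : Integrable fun σ : ℝ => Complex.exp (Complex.I * ((y j * σ : ℝ) : ℂ)) * b σ)
    (hc : Integrable fun σ : ℝ => Complex.exp (Complex.I * ((y k * σ : ℝ) : ℂ)) * c σ) :
    Integrable (oscTwo j k y b c) := by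
  rw [oscTwo_eq_mul]
  exact hb.mul_prod hc

lemma integral_oscTwo (j k : Fin 3) (y : R3) (b c : ℝ → ℂ) : ∫ p, oscTwo j k y b c p =
    (∫ σ : ℝ, Complex.exp (Complex.I * ((y j * σ : ℝ) : ℂ)) * b σ) *
      ∫ σ : ℝ, Complex.exp (Complex.I * ((y k * σ : ℝ) : ℂ)) * c σ := by
  rw [oscTwo_eq_mul]
  exact integral_prod_mul (fun σ : ℝ => Complex.exp (Complex.I * ((y j * σ : ℝ) : ℂ)) * b σ)
    fun σ : ℝ => Complex.exp (Complex.I * ((y k * σ : ℝ) : ℂ)) * c σ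

lemma integrable_oscThree
    (hb : Integrable fun σ : ℝ => Complex.exp (Complex.I * ((y 0 * σ : ℝ) : ℂ)) * b σ)
    (hc : Integrable fun σ : ℝ => Complex.exp (Complex.I * ((y 1 * σ : ℝ) : ℂ)) * c σ)
    (hd : Integrable fun σ : ℝ => Complex.exp (Complex.I * ((y 2 * σ : ℝ) : ℂ)) * d σ) :
    Integrable (oscThree y b c d) := by
  rw [oscThree_eq_mul]
  exact hb.mul_prod (integrable_oscTwo hc hd)

lemma integral_oscThree (y : R3) (b c d : ℝ → ℂ) : ∫ p, oscThree y b c d p =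
    (∫ σ : ℝ, Complex.exp (Complex.I * ((y 0 * σ : ℝ) : ℂ)) * b σ) *
      (∫ σ : ℝ, Complex.exp (Complex.I * ((y 1 * σ : ℝ) : ℂ)) * c σ) *
      ∫ σ : ℝ, Complex.exp (Complex.I * ((y 2 * σ : ℝ) : ℂ)) * d σ := by
  rw [oscThree_eq_mul, mul_assoc, ← integral_oscTwo]
  exact integral_prod_mul (fun σ : ℝ => Complex.exp (Complex.I * ((y 0 * σ : ℝ) : ℂ)) * b σ)
    (oscTwo 1 2 y c d)

end MultipleIntegral

/-- Two factors which are oscillatory integrals up to a remainder `ρ` of one order less and a Taylor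
term: their product is the double oscillatory integral up to errors in the two Beals spaces. -/
lemma eqOscModulo_oscTwo {m : ℝ} (hm : m < -1) {j k : Fin 3} (hjk : j ≠ k)
    {a a' : ℝ × ℝ × ℝ → ℂ} {c d c' d' : ℝ} {f ρ B f' ρ' B' : R3 → ℂ}
    (ha : IsSymbol m a) (ha' : IsSymbol m a') (hc : |c| ≤ 1) (hd : |d| ≤ 1)
    (hρ : BealsFun Ω (conormalIndex j (-m - 1 / 2 + 1)) ρ)
    (hB : BealsFun Ω (conormalIndex j (-m - 1 / 2)) B)
    (hf' : IsConormalFun Ω k (-m - 1 / 2) f')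
    (hρ' : BealsFun Ω (conormalIndex k (-m - 1 / 2 + 1)) ρ')
    (hB' : BealsFun Ω (conormalIndex k (-m - 1 / 2)) B')
    (hfe : ∀ y, f y = osc j a c d y + ρ y + y k * B y)
    (hfe' : ∀ y, f' y = osc k a' c' d' y + ρ' y + y j * B' y) :
    EqOscModulo Ω (fun y => f y * f' y)
      (fun y => oscTwo j k y
        (fun η => a (η, c * y (j.succAbove 0), d * y (j.succAbove 1)))
        (fun η => a' (η, c' * y (k.succAbove 0), d' * y (k.succAbove 1))))
      (BealsMinus Ω 0 (fun i => min (conormalIndex j (-m - 1 / 2 + 1) i)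
          (conormalIndex k (-m - 1 / 2) i)) +
        BealsMinus Ω 0 (fun i => min (conormalIndex j (-m - 1 / 2) i)
          (conormalIndex k (-m - 1 / 2 + 1) i))) := by
  refine ⟨fun y => integrable_oscTwo (integrable_osc ha.isAmplitude hm _ _)
    (integrable_osc ha'.isAmplitude hm _ _), ?_⟩
  obtain ⟨E₁, E₂, h₁, h₂, he⟩ := exists_bealsFun_mul_sub_mul hjk (by linarith)
    (ha.isConormalFun_osc hm j hc hd) hρ hB hf' hρ' hB' hfe hfe'
  obtain ⟨E, hE, hr⟩ := exists_mem_bealsMinus_add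
    (fun i => lt_min (conormalIndex_pos (by linarith) j i) (conormalIndex_pos (by linarith) k i))
    (fun i => lt_min (conormalIndex_pos (by linarith) j i) (conormalIndex_pos (by linarith) k i))
    h₁ h₂
  refine ⟨E, hE, ?_⟩
  convert hr using 2 with y
  rw [← he, integral_oscTwo]
  rfl

/-- Comparison of a triple product with the product of the leading parts `g j`, by replacing one
factor at a time. Each Taylor remainder carries a coordinate `y l` with `l ≠ j`, which is absorbed by the
factor conormal to `{y l = 0}`. -/
lemma exists_bealsFun_mul_mul_sub {κ : ℝ} (hκ : 1 / 2 < κ)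
    {f g ρ B C : Fin 3 → R3 → ℂ} (hf : ∀ j, IsConormalFun Ω j κ (f j))
    (hg : ∀ j, IsConormalFun Ω j κ (g j))
    (hρ : ∀ j, BealsFun Ω (conormalIndex j (κ + 1)) (ρ j))
    (hB : ∀ j, BealsFun Ω (conormalIndex j κ) (B j))
    (hC : ∀ j, BealsFun Ω (conormalIndex j κ) (C j))
    (hfe : ∀ j y, f j y = g j y + ρ j y + y (j.succAbove 0) * B j y +
      y (j.succAbove 1) * C j y) :
    ∃ E₁ E₂ E₃ : R3 → ℂ,
      BealsFun Ω ![((κ + 1 : ℝ) : WithTop ℝ), κ, κ] E₁ ∧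
      BealsFun Ω ![(κ : WithTop ℝ), ((κ + 1 : ℝ) : WithTop ℝ), κ] E₂ ∧
      BealsFun Ω ![(κ : WithTop ℝ), κ, ((κ + 1 : ℝ) : WithTop ℝ)] E₃ ∧
      ∀ y, f 0 y * f 1 y * f 2 y - g 0 y * g 1 y * g 2 y = E₁ y + E₂ y + E₃ y := by
  have hκ' : 1 / 2 < κ + 1 := by linarith
  -- The error is `(f₀ - g₀) f₁ f₂ + g₀ (f₁ - g₁) f₂ + g₀ g₁ (f₂ - g₂)`, sorted by the index that
  -- gains.
  refine ⟨_, _, _,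
    (((hρ 0).mul_three hκ' hκ (hf 1).1 (hf 2).1).add
      ((hg 0).2.mul_three hκ' hκ (hB 1) (hf 2).1)).add
        ((hg 0).2.mul_three hκ' hκ (hg 1).1 (hB 2)),
    (((hB 0).mul_three hκ hκ' (hf 1).2 (hf 2).1).add
      ((hg 0).1.mul_three hκ hκ' (hρ 1) (hf 2).1)).add
        ((hg 0).1.mul_three hκ hκ' (hg 1).2 (hC 2)),
    (((hC 0).mul_three hκ hκ (hf 1).1 (hf 2).2).add
      ((hg 0).1.mul_three hκ hκ (hC 1) (hf 2).2)).add
        ((hg 0).1.mul_three hκ hκ (hg 1).1 (hρ 2)), fun y => ?_⟩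
  have h0 := hfe 0 y
  have h1 := hfe 1 y
  have h2 := hfe 2 y
  simp only [show (0 : Fin 3).succAbove 0 = 1 from rfl, show (0 : Fin 3).succAbove 1 = 2 from rfl,
    show (1 : Fin 3).succAbove 0 = 0 from rfl, show (1 : Fin 3).succAbove 1 = 2 from rfl,
    show (2 : Fin 3).succAbove 0 = 0 from rfl, show (2 : Fin 3).succAbove 1 = 1 from rfl]
    at h0 h1 h2
  linear_combination f 1 y * f 2 y * h0 + g 0 y * f 2 y * h1 + g 0 y * g 1 y * h2

end TripleProd

end

theorem proposition2p11
    (Ω : TopologicalSpace.Opens TripleProd.R3) (hΩ : (0 : TripleProd.R3) ∈ Ω)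
    (m : ℝ) (hm : m < -1)
    (v : Fin 3 → TripleProd.CDistribution Ω)
    (hv : ∀ j, TripleProd.IsConormal Ω j (m - 3 / 4 + 1 / 2) (v j))
    (a : Fin 3 → ℝ × ℝ × ℝ → ℂ)
    (ha : ∀ j, TripleProd.IsPrincipalSymbol Ω j (m - 3 / 4 + 1 / 2) (a j) (v j)) :
    -- the `v j` are continuous functions `f j` on `Ω`, so that their products make sense
    ∃ f : Fin 3 → TripleProd.R3 → ℂ,
      (∀ j, ContinuousOn (f j) (Ω : Set TripleProd.R3) ∧ TripleProd.Represents Ω (f j) (v j)) ∧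
      -- `v₁ v₂`
      TripleProd.EqOscModulo Ω (fun y => f 0 y * f 1 y)
        (fun y => TripleProd.oscTwo 0 1 y
          (fun η => a 0 (η, 0, y 2)) (fun η => a 1 (η, 0, y 2)))
        (TripleProd.BealsMinus Ω 0 ![((-m + 1 / 2 : ℝ) : WithTop ℝ), ((-m - 1 / 2 : ℝ)), ⊤] +
          TripleProd.BealsMinus Ω 0 ![((-m - 1 / 2 : ℝ) : WithTop ℝ), ((-m + 1 / 2 : ℝ)), ⊤]) ∧
      -- `v₁ v₃`
      TripleProd.EqOscModulo Ω (fun y => f 0 y * f 2 y)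
        (fun y => TripleProd.oscTwo 0 2 y
          (fun η => a 0 (η, y 1, 0)) (fun η => a 2 (η, 0, y 1)))
        (TripleProd.BealsMinus Ω 0 ![((-m + 1 / 2 : ℝ) : WithTop ℝ), ⊤, ((-m - 1 / 2 : ℝ))] +
          TripleProd.BealsMinus Ω 0 ![((-m - 1 / 2 : ℝ) : WithTop ℝ), ⊤, ((-m + 1 / 2 : ℝ))]) ∧
      -- `v₂ v₃`
      TripleProd.EqOscModulo Ω (fun y => f 1 y * f 2 y)
        (fun y => TripleProd.oscTwo 1 2 y
          (fun η => a 1 (η, y 0, 0)) (fun η => a 2 (η, y 0, 0)))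
        (TripleProd.BealsMinus Ω 0 ![⊤, ((-m + 1 / 2 : ℝ) : WithTop ℝ), ((-m - 1 / 2 : ℝ))] +
          TripleProd.BealsMinus Ω 0 ![⊤, ((-m - 1 / 2 : ℝ) : WithTop ℝ), ((-m + 1 / 2 : ℝ))]) ∧
      -- `v₁ v₂ v₃`
      TripleProd.EqOscModulo Ω (fun y => f 0 y * f 1 y * f 2 y)
        (fun y => TripleProd.oscThree y
          (fun η => a 0 (η, 0, 0)) (fun η => a 1 (η, 0, 0)) (fun η => a 2 (η, 0, 0)))
        (TripleProd.BealsMinus Ω 0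
            ![((-m + 1 / 2 : ℝ) : WithTop ℝ), ((-m - 1 / 2 : ℝ)), ((-m - 1 / 2 : ℝ))] +
          TripleProd.BealsMinus Ω 0
            ![((-m - 1 / 2 : ℝ) : WithTop ℝ), ((-m + 1 / 2 : ℝ)), ((-m - 1 / 2 : ℝ))] +
          TripleProd.BealsMinus Ω 0
            ![((-m - 1 / 2 : ℝ) : WithTop ℝ), ((-m - 1 / 2 : ℝ)), ((-m + 1 / 2 : ℝ))]) := by
  open TripleProd in
  choose ρ hρ hrep using fun j => (ha j).exists_function hm
  have hs : ∀ j, IsSymbol m (a j) := fun j => by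
    have := (ha j).1
    rwa [show m - 3 / 4 + 1 / 2 + 1 / 4 = m by ring] at this
  have hamp : ∀ j, IsAmplitude m (a j) := fun j => (hs j).isAmplitude
  have h1 : |(1 : ℝ)| ≤ 1 := by simp
  have h0 : |(0 : ℝ)| ≤ 1 := by simp
  have hκ : 1 / 2 < -m - 1 / 2 := by linarith
  have hf : ∀ j, IsConormalFun Ω j (-m - 1 / 2) (fun y => osc j (a j) 1 1 y + ρ j y) := fun j =>
    ((hs j).isConormalFun_osc hm j h1 h1).add (hρ j)
  have hB : ∀ (j : Fin 3) {d : ℝ}, |d| ≤ 1 →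
      BealsFun Ω (conormalIndex j (-m - 1 / 2)) (taylorFst j (a j) d) := fun j _ hd =>
    bealsFun_taylorFst (hamp j) hm j hd
  have hC : ∀ (j : Fin 3) {c : ℝ}, |c| ≤ 1 →
      BealsFun Ω (conormalIndex j (-m - 1 / 2)) (taylorSnd j (a j) c) := fun j _ hc =>
    bealsFun_taylorSnd (hamp j) hm j hc
  have hfst : ∀ j y, osc j (a j) 1 1 y + ρ j y =
      osc j (a j) 0 1 y + ρ j y + y (j.succAbove 0) * taylorFst j (a j) 1 y := fun j y => by
    rw [osc_eq_add_taylorFst (hamp j) hm]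
    ring
  have hsnd : ∀ j y, osc j (a j) 1 1 y + ρ j y =
      osc j (a j) 1 0 y + ρ j y + y (j.succAbove 1) * taylorSnd j (a j) 1 y := fun j y => by
    rw [osc_eq_add_taylorSnd (hamp j) hm]
    ring
  -- The first transverse coordinate is put to zero before the second, hence the parameters `1`, `0`.
  have hboth : ∀ j y, osc j (a j) 1 1 y + ρ j y = osc j (a j) 0 0 y + ρ j y +
      y (j.succAbove 0) * taylorFst j (a j) 1 y + y (j.succAbove 1) * taylorSnd j (a j) 0 y :=
    fun j y => by
      rw [osc_eq_add_taylorFst (hamp j) hm, osc_eq_add_taylorSnd (hamp j) hm]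
      ring
  have he : -m - 1 / 2 + 1 = -m + 1 / 2 := by ring
  refine ⟨fun j y => osc j (a j) 1 1 y + ρ j y, fun j => ⟨(hf j).1.1, hrep j⟩, ?_, ?_, ?_, ?_⟩
  -- Each factor is expanded in the transverse coordinate that defines the other hypersurface.
  · have := eqOscModulo_oscTwo (Ω := Ω) hm (j := 0) (k := 1) (by decide) (hs 0) (hs 1) h0 h1 (hρ 0)
      (hB 0 h1) (hf 1) (hρ 1) (hB 1 h1) (hfst 0) (hfst 1)
    rw [min_conormalIndex_zero_one, min_conormalIndex_zero_one, he] at this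
    simp only [zero_mul, one_mul] at this
    exact this
  · have := eqOscModulo_oscTwo (Ω := Ω) hm (j := 0) (k := 2) (by decide) (hs 0) (hs 2) h1 h0 (hρ 0)
      (hC 0 h1) (hf 2) (hρ 2) (hB 2 h1) (hsnd 0) (hfst 2)
    rw [min_conormalIndex_zero_two, min_conormalIndex_zero_two, he] at this
    simp only [zero_mul, one_mul] at this
    exact this
  · have := eqOscModulo_oscTwo (Ω := Ω) hm (j := 1) (k := 2) (by decide) (hs 1) (hs 2) h1 h0 (hρ 1)
      (hC 1 h1) (hf 2) (hρ 2) (hC 2 h1) (hsnd 1) (hsnd 2)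
    rw [min_conormalIndex_one_two, min_conormalIndex_one_two, he] at this
    simp only [zero_mul, one_mul] at this
    exact this
  · have hi : ∀ (j : Fin 3) (y : R3), Integrable fun σ : ℝ =>
        Complex.exp (Complex.I * ((y j * σ : ℝ) : ℂ)) * a j (σ, 0, 0) :=
      fun j y => integrable_osc (hamp j) hm (y j) (0, 0)
    refine ⟨fun y => integrable_oscThree (hi 0 y) (hi 1 y) (hi 2 y), ?_⟩
    obtain ⟨E₁, E₂, E₃, e₁, e₂, e₃, hE⟩ := exists_bealsFun_mul_mul_sub hκ hf
      (fun j => (hs j).isConormalFun_osc hm j h0 h0) hρ (fun j => hB j h1) (fun j => hC j h0) hboth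
    rw [he] at e₁ e₂ e₃
    have hk : 0 < -m - 1 / 2 := by linarith
    have hk' : 0 < -m + 1 / 2 := by linarith
    obtain ⟨E, hES, hEr⟩ := exists_mem_bealsMinus_add_add (vec_three_pos hk' hk hk)
      (vec_three_pos hk hk' hk) (vec_three_pos hk hk hk') e₁ e₂ e₃
    refine ⟨E, hES, ?_⟩
    convert hEr using 2 with y
    rw [← hE, integral_oscThree]
    simp only [osc, zero_mul]
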